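/- **Conventions.** Let $n\ge 2$ and $0<\alpha<2$. On $\mathbb{R}^n$, $J^{\sigma}=(1-\Delta)^{\sigma/2}$ is the Fourier multiplier with symbol $(1+|2\pi\xi|^2)^{\sigma/2}$, $(-\Delta)^{\alpha/2}$ is the one with symbol $|2\pi\xi|^{\alpha}$, and $\|f\|_{H^\sigma}=\|J^\sigma f\|_{L^2}$. For $T>0$ write $\|u\|_{L^\infty_TH^\sigma_x}=\operatorname{ess\,sup}_{0<t<T}\|u(t)\|_{H^\sigma}$ and $\|\nabla u\|_{L^1_TL^\infty_x}=\int_0^T\|\nabla u(t)\|_{L^\infty}\,dt$ (values in $[0,\infty]$). **Lemma.** Let $s>\frac n2+1$ and $r>\frac n2$. Let $\nu=(\nu_1,\dots,\nu_n)\in\mathbb{R}^n$ with $\nu_1>0$, put $|\overline\nu|=\sqrt{\nu_2^2+\dots+\nu_n^2}$, and let $$C=\sup_{2\le j\le n}\ \sup_{0\ne f\in L^2(\mathbb{R}^n)}\frac{\|J^{-1}\partial_{x_j}f\|_{L^2}}{\|f\|_{L^2}}$$ (the norm of $J^{-1}\partial_{x_j}$ on $L^2$). Assume that either 1. $\nu_2=\dots=\nu_n=0$,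 or 2. $(\nu_2,\dots,\nu_n)\neq 0$ and, for some $\epsilon$ with $0<\epsilon<\dfrac{\nu_1}{|\overline\nu|\sqrt{n-1}}-\dfrac{\alpha\sqrt{n-1}\,|\overline\nu|}{4\nu_1}C^2$, $$0<|\overline\nu|<\min\left\{\frac{2\nu_1}{C\sqrt{\alpha(n-1)}},\ \frac{\nu_1(1+\alpha)}{\alpha\,\epsilon\sqrt{n-1}}\right\}.$$ Let $c\in\mathbb{R}$. Then there is a constant $K<\infty$, depending only on $n,\alpha,s,r,\nu,c$, such that the following holds. Let $\phi:\mathbb{R}\to\mathbb{R}$ be smooth and non-decreasing, so that $\phi'\ge 0$, with $\phi'\equiv 1$ on $[0,1]$ and $\sup_{x\in\mathbb{R}}|\phi^{(j)}(x)|\le c$ for $0\le j\le 4$; let $\delta\in\mathbb{R}$ and $\varphi(x)=\phi(\nu\cdot x+\delta)$. Let $T>0$ and let $u\in C((0,T):H^s(\mathbb{R}^n))$ be a real-valued solution of $$\partial_tu-\partial_{x_1}(-\Delta)^{\alpha/2}u+u\,\partial_{x_1}u=0 ,\qquad 0<t<T,$$ in the sense that for every Schwartz function $\psi$ the function $t\mapsto\langle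 u(t),\psi\rangle$ is differentiable on $(0,T)$ with derivative $\langle\partial_{x_1}(-\Delta)^{\alpha/2}u(t)-u(t)\partial_{x_1}u(t),\psi\rangle$. Then $$\int_0^T\!\!\int_{\mathbb{R}^n}\bigl(J^{s+\frac\alpha2}u\bigr)^2\,\partial_{x_1}\varphi\,dx\,dt+\int_0^T\!\!\int_{\mathbb{R}^n}\bigl(\partial_{x_1}J^{s+\frac{\alpha-2}2}u\bigr)^2\,\partial_{x_1}\varphi\,dx\,dt\ \le\ K\Bigl(1+T+\|\nabla u\|_{L^1_TL^\infty_x}+T\|u\|_{L^\infty_TH^r_x}\Bigr)\|u\|_{L^\infty_TH^s_x}^2 .$$ Here, for a tempered distribution $F$ and the weight $w=\partial_{x_1}\varphi\ge 0$, $\int F^2w\,dx$ is the usual integral if $F$ is a locally integrable function on the open set $\{w>0\}$, and $+\infty$ otherwise. In particular, if the right-hand side is finite, then for almost every $t\in(0,T)$ the distributions $J^{s+\frac\alpha2}u(t)$ and $\partial_{x_1}J^{s+\frac{\alpha-2}2}u(t)$ are locally square integrable functions on $\{\partial_{x_1}\varphi>0\}$. -/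

import Mathlib

open MeasureTheory Set Filter Topology
open scoped ENNReal NNReal ContDiff SchwartzMap FourierTransform LineDeriv

noncomputable section

namespace FZK

/-- The Euclidean space `ℝⁿ`. -/
abbrev Rn (n : ℕ) : Type := EuclideanSpace ℝ (Fin n)

/-- The `j`-th vector of the canonical basis of `ℝⁿ`. -/
def stdVec {n : ℕ} (j : Fin n) : Rn n := EuclideanSpace.single j 1

/-- The complex-valued `L²` class of a real-valued one. -/
def complexify {n : ℕ} (f : Lp ℝ 2 (volume : Measure (Rn n))) :
    Lp ℂ 2 (volume : Measure (Rn n)) :=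
  Complex.ofRealCLM.compLp f

/-- A real-valued `L²` function, viewed as a tempered distribution. -/
def toDist {n : ℕ} (f : Lp ℝ 2 (volume : Measure (Rn n))) : 𝓢'(Rn n, ℂ) :=
  Lp.toTemperedDistribution (complexify f)

/-! ### Bessel potentials and Sobolev norms -/

/-- The symbol `⟨2πξ⟩ ^ σ` of `J ^ σ`. -/
def besselSymbol (n : ℕ) (σ : ℝ) (ξ : Rn n) : ℂ :=
  (((1 + ‖(2 * Real.pi) • ξ‖ ^ 2) ^ (σ / 2) : ℝ) : ℂ)

/-- The symbol has temperate growth, so that the multiplier below is the genuine one. -/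
theorem besselSymbol_hasTemperateGrowth (n : ℕ) (σ : ℝ) :
    (besselSymbol n σ).HasTemperateGrowth := by
  have h : Function.HasTemperateGrowth
      (fun ξ : Rn n ↦ (1 + ‖ξ‖ ^ 2) ^ (σ / 2)) := by fun_prop
  have h2 : Function.HasTemperateGrowth (fun ξ : Rn n ↦ (2 * Real.pi) • ξ) := by fun_prop
  have h3 := h.comp h2
  have h4 : Function.HasTemperateGrowth (fun x : ℝ ↦ (x : ℂ)) :=
    Complex.ofRealCLM.hasTemperateGrowth
  exact h4.comp h3

/-- The operator `J ^ σ = (1 - Δ) ^ (σ / 2)` on tempered distributions. -/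
def besselJ {n : ℕ} (σ : ℝ) (F : 𝓢'(Rn n, ℂ)) : 𝓢'(Rn n, ℂ) :=
  TemperedDistribution.fourierMultiplierCLM ℂ (besselSymbol n σ) F

/-- The `L²` norm of a tempered distribution; it is `∞` if the distribution is not in `L²`. -/
def distL2Norm {n : ℕ} (F : 𝓢'(Rn n, ℂ)) : ℝ≥0∞ :=
  ⨅ (g : Lp ℂ 2 (volume : Measure (Rn n))) (_ : F = Lp.toTemperedDistribution g), ‖g‖ₑ

/-- The norm of `H ^ σ = J ^ (-σ) L²`, that is `‖J ^ σ F‖_{L²}`; it is finite exactly on `H ^ σ`. -/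
def sobolevNorm {n : ℕ} (σ : ℝ) (F : 𝓢'(Rn n, ℂ)) : ℝ≥0∞ :=
  distL2Norm (besselJ σ F)

/-! ### The fractional Laplacian and weak gradients -/

open Classical in
/-- `(-Δ) ^ (α / 2) f`, the `L²` function with Fourier transform `|2πξ| ^ α 𝓕 f (ξ)`, for `f` in
the `L²` domain of this operator (which contains `H ^ σ` for every `σ ≥ α`). -/
def fracLaplacian {n : ℕ} (α : ℝ) (f : Lp ℂ 2 (volume : Measure (Rn n))) :
    Lp ℂ 2 (volume : Measure (Rn n)) :=
  if h : MemLp (fun ξ : Rn n ↦ ((‖(2 * Real.pi) • ξ‖ ^ α : ℝ) : ℂ) *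
      (𝓕 f : Lp ℂ 2 (volume : Measure (Rn n))) ξ) 2 volume
  then 𝓕⁻ (h.toLp _) else 0

/-- `g` is the weak gradient of `f` on `ℝⁿ`. -/
def HasWeakGradient {n : ℕ} (f : Rn n → ℝ) (g : Rn n → Rn n) : Prop :=
  LocallyIntegrable g volume ∧
    ∀ ψ : Rn n → ℝ, ContDiff ℝ ∞ ψ → HasCompactSupport ψ → ∀ j : Fin n,
      ∫ x, f x * lineDeriv ℝ ψ x (stdVec j) = - ∫ x, g x j * ψ x

/-- `‖∇ f‖_{L^∞}`. The weak gradient is unique almost everywhere, so the infimum runs over at most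
one value; it is `∞` if there is no weak gradient. -/
def gradSupNorm {n : ℕ} (f : Rn n → ℝ) : ℝ≥0∞ :=
  ⨅ (g : Rn n → Rn n) (_ : HasWeakGradient f g), eLpNorm g ⊤ volume

/-! ### Weighted energies of distributions -/

/-- On the open set `U`, the distribution `F` is the locally integrable function `f`. -/
def RepresentsOn {n : ℕ} (F : 𝓢'(Rn n, ℂ)) (f : Rn n → ℂ) (U : Set (Rn n)) : Prop :=
  LocallyIntegrableOn f U volume ∧
    ∀ ψ : 𝓢(Rn n, ℂ), HasCompactSupport ψ → tsupport ψ ⊆ U → F ψ = ∫ x, ψ x * f x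

/-- `∫ F(x)² w(x) dx` for a real-valued distribution `F` and a continuous weight `w ≥ 0`.
It is the usual integral if `F` is a function on the open set `{w > 0}` (where this function is
unique almost everywhere, so that the infimum runs over one value), and `∞` otherwise. -/
def weightedEnergy {n : ℕ} (F : 𝓢'(Rn n, ℂ)) (w : Rn n → ℝ) : ℝ≥0∞ :=
  ⨅ (f : Rn n → ℂ) (_ : RepresentsOn F f {x | 0 < w x}),
    ∫⁻ x, ‖f x‖ₑ ^ 2 * ENNReal.ofReal (w x)

/-! ### Solutions -/

/-- `u ∈ C((0,T) : H ^ s)` is a real-valued solution of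
`∂_t u - ∂_{x₁} (-Δ) ^ (α / 2) u + u ∂_{x₁} u = 0` on `(0,T)`, in the sense of tempered
distributions in `x`. -/
structure IsSolution {n : ℕ} [NeZero n] (α s T : ℝ)
    (u : ℝ → Lp ℝ 2 (volume : Measure (Rn n))) : Prop where
  mem : ∀ t ∈ Ioo 0 T, sobolevNorm s (toDist (u t)) < ⊤
  cont : ∀ t₀ ∈ Ioo 0 T,
    Tendsto (fun t ↦ sobolevNorm s (toDist (u t) - toDist (u t₀))) (𝓝 t₀) (𝓝 0)
  eqn : ∀ t ∈ Ioo 0 T, ∃ g : Rn n → Rn n, HasWeakGradient (u t) g ∧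
    ∀ ψ : 𝓢(Rn n, ℂ), HasDerivAt (fun τ ↦ toDist (u τ) ψ)
      ((∂_{stdVec (0 : Fin n)} (Lp.toTemperedDistribution
          (fracLaplacian α (complexify (u t))) : 𝓢'(Rn n, ℂ))) ψ
        - ∫ x, ((u t x * g x 0 : ℝ) : ℂ) * ψ x) t

/-- `‖u‖_{L^∞_T H^σ_x}`. -/
def normLinftyHs {n : ℕ} (T σ : ℝ) (u : ℝ → Lp ℝ 2 (volume : Measure (Rn n))) : ℝ≥0∞ :=
  essSup (fun t ↦ sobolevNorm σ (toDist (u t))) (volume.restrict (Ioo 0 T))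

/-- `‖∇ u‖_{L¹_T L^∞_x}`. -/
def normGradL1Linfty {n : ℕ} (T : ℝ) (u : ℝ → Lp ℝ 2 (volume : Measure (Rn n))) : ℝ≥0∞ :=
  ∫⁻ t in Ioo 0 T, gradSupNorm (u t)

/-! ### The admissible directions -/

/-- The norm of the operators `J⁻¹ ∂_{x_j}`, `j = 2, …, n`, on `L²(ℝⁿ)`. -/
def transversalConst (n : ℕ) [NeZero n] : ℝ :=
  (⨆ (j : Fin n) (_ : j ≠ 0) (f : Lp ℂ 2 (volume : Measure (Rn n))) (_ : f ≠ 0),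
    sobolevNorm (-1) (∂_{stdVec j} (Lp.toTemperedDistribution f : 𝓢'(Rn n, ℂ))) / ‖f‖ₑ).toReal

/-- `√(ν₂² + ⋯ + νₙ²)`. -/
def transversalNorm {n : ℕ} [NeZero n] (ν : Fin n → ℝ) : ℝ :=
  √(∑ j ∈ Finset.univ.erase 0, ν j ^ 2)

/-- The condition on the direction `ν`: either `ν₁ > 0` and the other coordinates vanish, or
`ν₁ > 0` and the other coordinates do not all vanish and satisfy the smallness condition. -/
def Admissible {n : ℕ} [NeZero n] (α : ℝ) (ν : Fin n → ℝ) : Prop :=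
  0 < ν 0 ∧
    ((∀ j, j ≠ 0 → ν j = 0) ∨
      ((∃ j, j ≠ 0 ∧ ν j ≠ 0) ∧ ∃ ε : ℝ,
        0 < ε ∧
        ε < ν 0 / (transversalNorm ν * √(n - 1 : ℝ))
            - α * √(n - 1 : ℝ) * transversalNorm ν / (4 * ν 0) * transversalConst n ^ 2 ∧
        0 < transversalNorm ν ∧
        transversalNorm ν < min (2 * ν 0 / (transversalConst n * √(α * (n - 1 : ℝ))))
            (ν 0 * (1 + α) / (α * ε * √(n - 1 : ℝ)))))

end FZK

end

/-!
The proof is a weighted energy estimate carried out on one Littlewood–Paley block at a time, so that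
no pseudodifferential calculus is needed: every commutator is an integral operator whose kernel is
estimated by hand with Schur's test.

Let `v = P_k u` be the block of frequency `R = 2 ^ k` and `g = √(ϕ'(ν · x + δ))`, so that
`∇φ = g² ν`. Differentiating `⟪φ v, v⟫` in time produces two terms.

* The dispersion is skew-adjoint, so it contributes a commutator with `φ`. The trapezoidal rule
  `φ(x) - φ(y) = ν · (x - y) g(x) g(y) + O(|x - y|³)` (`weight_of_profile`) exhibits its principal
  part as `g b(D) g`, where `b` is the derivative in the direction `ν` of `ξ₁ |2πξ| ^ α`, with a minus
  sign. Up to a factor, `-b` is the quadratic form `ν₁ |ξ|² + α ξ₁ (ν · ξ)`. The upper bound on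
  `|ν̄|` makes this form definite (`exists_form_ge`, which rests on `transversalConst_ge`). Hence the
  gain `-c R ^ α ‖g v‖²` with an error `R ^ (α - 2) ‖v‖² ≤ ‖v‖²` (`exists_dispersive_le`).
* The nonlinearity is paraproduct-like: with `S` the part of `u` of frequency well below `R` and
  `w = u - S`, the term `S²` is not seen by the block, `S w` is a transport term which, by
  skew-adjointness, costs only the supremum and the Lipschitz constant of `u`, and `w²` is small because `|w| ≤ C R⁻¹ ‖∇u‖_∞`
  (`exists_nonlinear_le`).

Multiplying by `4 ^ (k s)`, summing over `k` and integrating in time bounds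
`∫ ∑ₖ 4 ^ (k s) R ^ α ‖g P_k u‖² dt` by the right-hand side (`exists_lintegral_smooth_le`). The weak
formulation suffices because each block of a solution is a `C¹` curve in `L²`
(`IsSolution.hasDerivAt_blk`).

It remains to recover the weighted norms of `J ^ (s + α / 2) u` and `∂_{x₁} J ^ (s + (α - 2) / 2) u`
from these sums. Both are multipliers `m(D) u` of order `s + α / 2`, and on the `k`-th block
`g m_k(D) P_k u = m_k(D) (g P_k u) + [g, m_k(D)] P_k u`. The first terms are almost orthogonal in `k`
and the commutators, being of order `s + α / 2 - 1 < s`, sum geometrically. So the truncations of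
`g m(D) u` converge in `L²`, which is also what shows that `m(D) u` is a locally square integrable
function where `g > 0` (`exists_weightedEnergy_le`).
-/

noncomputable section

namespace FZK

variable {n : ℕ}

/-- Complex-valued square-integrable functions on `ℝⁿ`. -/
abbrev L2 (n : ℕ) : Type := Lp ℂ 2 (volume : Measure (Rn n))

/-- Bounded measurable functions, given by everywhere defined representatives. -/
def BddMeas (a : Rn n → ℂ) : Prop := Measurable a ∧ ∃ C, ∀ x, ‖a x‖ ≤ C

theorem BddMeas.mul {a b : Rn n → ℂ} (ha : BddMeas a) (hb : BddMeas b) :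
    BddMeas (fun x ↦ a x * b x) := by
  obtain ⟨h1, C, hC⟩ := ha
  obtain ⟨h2, D, hD⟩ := hb
  refine ⟨h1.mul h2, C * D, fun x ↦ ?_⟩
  rw [norm_mul]
  exact mul_le_mul (hC x) (hD x) (norm_nonneg _) ((norm_nonneg _).trans (hC x))

theorem BddMeas.sub {a b : Rn n → ℂ} (ha : BddMeas a) (hb : BddMeas b) :
    BddMeas (fun x ↦ a x - b x) := by
  obtain ⟨h1, C, hC⟩ := ha
  obtain ⟨h2, D, hD⟩ := hb
  exact ⟨h1.sub h2, C + D, fun x ↦ (norm_sub_le _ _).trans (add_le_add (hC x) (hD x))⟩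

theorem BddMeas.const (c : ℂ) : BddMeas (fun _ : Rn n ↦ c) :=
  ⟨measurable_const, ‖c‖, fun _ ↦ le_rfl⟩

theorem BddMeas.const_mul {a : Rn n → ℂ} (c : ℂ) (ha : BddMeas a) :
    BddMeas (fun x ↦ c * a x) := (BddMeas.const c).mul ha

theorem BddMeas.conj {a : Rn n → ℂ} (ha : BddMeas a) :
    BddMeas (fun x ↦ (starRingEnd ℂ) (a x)) := by
  obtain ⟨h1, C, hC⟩ := ha
  exact ⟨Complex.continuous_conj.measurable.comp h1, C, fun x ↦ by simpa using hC x⟩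

theorem bddMeas_schwartz (m : 𝓢(Rn n, ℂ)) : BddMeas m :=
  ⟨m.continuous.measurable, _, fun x ↦ m.norm_le_seminorm ℂ x⟩

theorem BddMeas.memLp_mul {a : Rn n → ℂ} (ha : BddMeas a) {f : Rn n → ℂ}
    (hf : MemLp f 2 volume) : MemLp (fun x ↦ a x * f x) 2 volume := by
  obtain ⟨h1, C, hC⟩ := ha
  refine hf.of_le_mul (c := C) (h1.aestronglyMeasurable.mul hf.1) (ae_of_all _ fun x ↦ ?_)
  rw [norm_mul]
  exact mul_le_mul_of_nonneg_right (hC x) (norm_nonneg _)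

theorem norm_le_of_ae {f g : L2 n} {C : ℝ}
    (h : ∀ᵐ x, ‖f x‖ ≤ C * ‖g x‖) : ‖f‖ ≤ C * ‖g‖ :=
  Lp.norm_le_mul_norm_of_ae_le_mul h

open Classical in
/-- Multiplication by a bounded measurable function, as an operator on `L²`. It is `0` if the function
is not bounded and measurable. -/
def mulOp (a : Rn n → ℂ) : L2 n →L[ℂ] L2 n :=
  if h : BddMeas a then
    LinearMap.mkContinuous
      { toFun := fun f ↦ (h.memLp_mul (Lp.memLp f)).toLp _
        map_add' := fun f g ↦ by
          rw [← MemLp.toLp_add]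
          apply MemLp.toLp_congr
          filter_upwards [Lp.coeFn_add f g] with x hx
          change a x * (f + g : L2 n) x = a x * f x + a x * g x
          rw [hx, Pi.add_apply, mul_add]
        map_smul' := fun c f ↦ by
          rw [RingHom.id_apply, ← MemLp.toLp_const_smul]
          apply MemLp.toLp_congr
          filter_upwards [Lp.coeFn_smul c f] with x hx
          change a x * (c • f : L2 n) x = c * (a x * f x)
          rw [hx, Pi.smul_apply, smul_eq_mul]
          ring } |h.2.choose| (fun f ↦ by
        apply norm_le_of_ae
        filter_upwards [MemLp.coeFn_toLp (h.memLp_mul (Lp.memLp f))] with x hx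
        simp only [LinearMap.coe_mk, AddHom.coe_mk]
        rw [hx, norm_mul]
        exact mul_le_mul_of_nonneg_right ((h.2.choose_spec x).trans (le_abs_self _))
          (norm_nonneg _))
  else 0

theorem coeFn_mulOp {a : Rn n → ℂ} (ha : BddMeas a) (f : L2 n) :
    mulOp a f =ᵐ[volume] fun x ↦ a x * f x := by
  rw [mulOp, dif_pos ha]
  exact MemLp.coeFn_toLp (ha.memLp_mul (Lp.memLp f))

theorem norm_mulOp_le {a : Rn n → ℂ} (ha : Measurable a) {C : ℝ} (hC : ∀ x, ‖a x‖ ≤ C)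
    (f : L2 n) : ‖mulOp a f‖ ≤ C * ‖f‖ := by
  apply norm_le_of_ae
  filter_upwards [coeFn_mulOp ⟨ha, C, hC⟩ f] with x hx
  rw [hx, norm_mul]
  exact mul_le_mul_of_nonneg_right (hC x) (norm_nonneg _)

theorem mulOp_mulOp {a b : Rn n → ℂ} (ha : BddMeas a) (hb : BddMeas b) (f : L2 n) :
    mulOp a (mulOp b f) = mulOp (fun x ↦ a x * b x) f := by
  apply Lp.ext
  filter_upwards [coeFn_mulOp ha (mulOp b f), coeFn_mulOp hb f, coeFn_mulOp (ha.mul hb) f]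
    with x h1 h2 h3
  rw [h1, h2, h3, mul_assoc]

theorem mulOp_sub_left {a b : Rn n → ℂ} (ha : BddMeas a) (hb : BddMeas b) (f : L2 n) :
    mulOp (fun x ↦ a x - b x) f = mulOp a f - mulOp b f := by
  apply Lp.ext
  filter_upwards [coeFn_mulOp ha f, coeFn_mulOp hb f, coeFn_mulOp (ha.sub hb) f,
    Lp.coeFn_sub (mulOp a f) (mulOp b f)] with x h1 h2 h3 h4
  rw [h3, h4, Pi.sub_apply, h1, h2, sub_mul]

theorem mulOp_const_mul {a : Rn n → ℂ} (ha : BddMeas a) (c : ℂ) (f : L2 n) :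
    mulOp (fun x ↦ c * a x) f = c • mulOp a f := by
  apply Lp.ext
  filter_upwards [coeFn_mulOp ha f, coeFn_mulOp (ha.const_mul c) f,
    Lp.coeFn_smul c (mulOp a f)] with x h1 h2 h3
  rw [h2, h3, Pi.smul_apply, h1, smul_eq_mul, mul_assoc]

theorem inner_eq_integral (f g : L2 n) :
    inner ℂ f g = ∫ x, (starRingEnd ℂ) (f x) * g x := by
  rw [L2.inner_def]
  congr 1
  ext x
  rw [RCLike.inner_apply, mul_comm]

theorem inner_mulOp_right {a : Rn n → ℂ} (ha : BddMeas a) (f g : L2 n) :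
    inner ℂ f (mulOp a g) = inner ℂ (mulOp (fun x ↦ (starRingEnd ℂ) (a x)) f) g := by
  rw [inner_eq_integral, inner_eq_integral]
  apply integral_congr_ae
  filter_upwards [coeFn_mulOp ha g, coeFn_mulOp ha.conj f] with x h1 h2
  rw [h1, h2]
  simp
  ring

theorem inner_mulOp_real {a : Rn n → ℝ} (ha : BddMeas (fun x ↦ (a x : ℂ))) (f g : L2 n) :
    inner ℂ f (mulOp (fun x ↦ (a x : ℂ)) g) = inner ℂ (mulOp (fun x ↦ (a x : ℂ)) f) g := by
  rw [inner_mulOp_right ha]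
  simp

theorem norm_sq_eq_integral (f : L2 n) : ‖f‖ ^ 2 = ∫ x, ‖f x‖ ^ 2 := by
  have := inner_self_eq_norm_sq_to_K (𝕜 := ℂ) f
  rw [inner_eq_integral] at this
  have h2 : ∀ x, (starRingEnd ℂ) (f x) * f x = ((‖f x‖ ^ 2 : ℝ) : ℂ) := fun x ↦ by
    rw [Complex.conj_mul']; simp
  simp_rw [h2] at this
  rw [integral_complex_ofReal] at this
  apply Complex.ofReal_injective
  rw [this]
  simp

theorem integrable_norm_sq (f : L2 n) : Integrable (fun x ↦ ‖f x‖ ^ 2) volume :=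
  (memLp_two_iff_integrable_sq_norm (Lp.memLp f).1).1 (Lp.memLp f)

/-! ### Fourier multipliers on `L²` -/

/-- The Fourier multiplier on `L²` with bounded measurable symbol `m`. -/
def mult (m : Rn n → ℂ) : L2 n →L[ℂ] L2 n :=
  (FourierTransform.fourierInvCLM ℂ (L2 n)) ∘L mulOp m ∘L (FourierTransform.fourierCLM ℂ (L2 n))

theorem mult_apply (m : Rn n → ℂ) (f : L2 n) : mult m f = 𝓕⁻ (mulOp m (𝓕 f)) := rfl

theorem fourier_mult (m : Rn n → ℂ) (f : L2 n) : 𝓕 (mult m f) = mulOp m (𝓕 f) := by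
  rw [mult_apply, FourierTransform.fourier_fourierInv_eq]

theorem coeFn_fourier_mult {m : Rn n → ℂ} (hm : BddMeas m) (f : L2 n) :
    (𝓕 (mult m f) : L2 n) =ᵐ[volume] fun ξ ↦ m ξ * (𝓕 f : L2 n) ξ := by
  rw [fourier_mult]
  exact coeFn_mulOp hm _

theorem fourier_injective {f g : L2 n} (h : (𝓕 f : L2 n) = 𝓕 g) : f = g := by
  rw [← FourierTransform.fourierInv_fourier_eq (F := L2 n) f, h,
    FourierTransform.fourierInv_fourier_eq]

theorem norm_mult_le {m : Rn n → ℂ} (hm : Measurable m) {C : ℝ} (hC : ∀ x, ‖m x‖ ≤ C)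
    (f : L2 n) : ‖mult m f‖ ≤ C * ‖f‖ := by
  rw [← Lp.norm_fourier_eq, fourier_mult, ← Lp.norm_fourier_eq f]
  exact norm_mulOp_le hm hC _

theorem mult_mult {a b : Rn n → ℂ} (ha : BddMeas a) (hb : BddMeas b) (f : L2 n) :
    mult a (mult b f) = mult (fun x ↦ a x * b x) f := by
  apply fourier_injective
  rw [fourier_mult, fourier_mult, fourier_mult, mulOp_mulOp ha hb]

theorem mult_sub_left {a b : Rn n → ℂ} (ha : BddMeas a) (hb : BddMeas b) (f : L2 n) :
    mult (fun x ↦ a x - b x) f = mult a f - mult b f := by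
  apply fourier_injective
  rw [sub_eq_add_neg, FourierTransform.fourier_add, ← neg_one_smul ℂ (mult b f),
    FourierTransform.fourier_smul, fourier_mult, fourier_mult, fourier_mult,
    mulOp_sub_left ha hb, neg_one_smul, sub_eq_add_neg]

theorem mult_const_mul {a : Rn n → ℂ} (ha : BddMeas a) (c : ℂ) (f : L2 n) :
    mult (fun x ↦ c * a x) f = c • mult a f := by
  simp only [mult_apply]
  rw [mulOp_const_mul ha, FourierTransform.fourierInv_smul]

theorem mult_one (f : L2 n) : mult (fun _ ↦ 1) f = f := by
  apply fourier_injective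
  rw [fourier_mult]
  apply Lp.ext
  filter_upwards [coeFn_mulOp (BddMeas.const 1) (𝓕 f : L2 n)] with x h1
  rw [h1, one_mul]

theorem inner_mult_right {a : Rn n → ℂ} (ha : BddMeas a) (f g : L2 n) :
    inner ℂ f (mult a g) = inner ℂ (mult (fun x ↦ (starRingEnd ℂ) (a x)) f) g := by
  rw [← Lp.inner_fourier_eq, ← Lp.inner_fourier_eq _ g, fourier_mult, fourier_mult,
    inner_mulOp_right ha]

theorem norm_mult_sq {m : Rn n → ℂ} (hm : BddMeas m) (f : L2 n) :
    ‖mult m f‖ ^ 2 = ∫ ξ, ‖m ξ‖ ^ 2 * ‖(𝓕 f : L2 n) ξ‖ ^ 2 := by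
  rw [← Lp.norm_fourier_eq, norm_sq_eq_integral]
  apply integral_congr_ae
  filter_upwards [coeFn_fourier_mult hm f] with x h1
  rw [h1, norm_mul, mul_pow]

theorem mult_toLp {m : Rn n → ℂ} (hm : BddMeas m) (hg : m.HasTemperateGrowth)
    (f : 𝓢(Rn n, ℂ)) :
    mult m (f.toLp 2) = (SchwartzMap.fourierMultiplierCLM ℂ m f).toLp 2 := by
  rw [mult_apply, SchwartzMap.toLp_fourier_eq, SchwartzMap.fourierMultiplierCLM_apply,
    ← SchwartzMap.toLp_fourierInv_eq]
  congr 1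
  apply Lp.ext
  filter_upwards [coeFn_mulOp hm ((𝓕 f).toLp 2), (𝓕 f).coeFn_toLp 2 volume,
    (SchwartzMap.smulLeftCLM ℂ m (𝓕 f)).coeFn_toLp 2 volume] with x h1 h2 h3
  rw [h1, h2, h3, SchwartzMap.smulLeftCLM_apply_apply hg, smul_eq_mul]

end FZK

end

noncomputable section

namespace FZK

variable {n : ℕ}

/-! ### Convolution kernels and commutators -/

theorem memLp_conj {ψ : Rn n → ℂ} (hψ : MemLp ψ 2 volume) :
    MemLp (fun x ↦ (starRingEnd ℂ) (ψ x)) 2 volume :=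
  hψ.of_le (Complex.continuous_conj.comp_aestronglyMeasurable hψ.1)
    (ae_of_all _ fun x ↦ by simp)

theorem integral_mul_eq_inner {ψ : Rn n → ℂ} (hψ : MemLp ψ 2 volume) (f : L2 n) :
    ∫ x, ψ x * f x = inner ℂ ((memLp_conj hψ).toLp _) f := by
  rw [inner_eq_integral]
  apply integral_congr_ae
  filter_upwards [(memLp_conj hψ).coeFn_toLp] with x hx
  rw [hx]
  simp

/-- The convolution kernel of the Fourier multiplier with Schwartz symbol `m`. -/
def ker (m : 𝓢(Rn n, ℂ)) (z : Rn n) : ℂ := (𝓕⁻ m : 𝓢(Rn n, ℂ)) z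

theorem ker_integrable (m : 𝓢(Rn n, ℂ)) : Integrable (ker m) volume :=
  (𝓕⁻ m : 𝓢(Rn n, ℂ)).integrable

theorem ker_sub_memLp (m : 𝓢(Rn n, ℂ)) (x : Rn n) :
    MemLp (fun y ↦ ker m (x - y)) 2 volume :=
  ((𝓕⁻ m : 𝓢(Rn n, ℂ)).memLp 2 volume).comp_measurePreserving
    (Measure.measurePreserving_sub_left volume x)

theorem fourierMultiplier_eq_integral_ker (m g : 𝓢(Rn n, ℂ)) (x : Rn n) :
    SchwartzMap.fourierMultiplierCLM ℂ m g x = ∫ y, ker m (x - y) * g y := by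
  have h1 : SchwartzMap.fourierMultiplierCLM ℂ m g =
      SchwartzMap.convolution (ContinuousLinearMap.mul ℂ ℂ) (𝓕⁻ m : 𝓢(Rn n, ℂ)) g := by
    have h2 := SchwartzMap.fourier_convolution (ContinuousLinearMap.mul ℂ ℂ)
      (𝓕⁻ m : 𝓢(Rn n, ℂ)) g
    rw [SchwartzMap.fourierMultiplierCLM_apply,
      ← FourierTransform.fourierInv_fourier_eq (F := 𝓢(Rn n, ℂ))
        (SchwartzMap.convolution (ContinuousLinearMap.mul ℂ ℂ) (𝓕⁻ m : 𝓢(Rn n, ℂ)) g), h2,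
      FourierTransform.fourier_fourierInv_eq]
    congr 1
    ext ξ
    rw [SchwartzMap.smulLeftCLM_apply_apply m.hasTemperateGrowth]
    rfl
  rw [h1, SchwartzMap.convolution_apply, convolution_eq_swap]
  rfl

theorem tendsto_toLp_schwartz (f : L2 n) :
    ∃ g : ℕ → 𝓢(Rn n, ℂ), Tendsto (fun j ↦ (g j).toLp 2) atTop (𝓝 f) := by
  have h := SchwartzMap.denseRange_toLpCLM (E := Rn n) (F := ℂ)
    (μ := (volume : Measure (Rn n))) (p := 2) ENNReal.ofNat_ne_top
  obtain ⟨u, hu, hlim⟩ := mem_closure_iff_seq_limit.1 (h f)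
  choose g hg using hu
  refine ⟨g, ?_⟩
  have : (fun j ↦ (g j).toLp 2) = u := by
    ext1 j
    rw [← hg j]
    rfl
  rw [this]
  exact hlim

theorem mult_eq_integral_ker (m : 𝓢(Rn n, ℂ)) (f : L2 n) :
    mult m f =ᵐ[volume] fun x ↦ ∫ y, ker m (x - y) * f y := by
  obtain ⟨g, hg⟩ := tendsto_toLp_schwartz f
  have h1 : Tendsto (fun j ↦ mult m ((g j).toLp 2)) atTop (𝓝 (mult m f)) :=
    ((mult (m : Rn n → ℂ)).continuous.tendsto f).comp hg
  obtain ⟨ns, hmono, hns⟩ := (tendstoInMeasure_of_tendsto_Lp h1).exists_seq_tendsto_ae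
  have h2 : ∀ᵐ x, ∀ j, (mult m ((g j).toLp 2) : L2 n) x = ∫ y, ker m (x - y) * g j y := by
    rw [ae_all_iff]
    intro j
    rw [mult_toLp (bddMeas_schwartz m) m.hasTemperateGrowth]
    filter_upwards [(SchwartzMap.fourierMultiplierCLM ℂ m (g j)).coeFn_toLp 2 volume] with x hx
    rw [hx, fourierMultiplier_eq_integral_ker]
  filter_upwards [hns, h2] with x hx1 hx2
  refine tendsto_nhds_unique hx1 ?_
  simp_rw [hx2]
  have h3 : ∀ j, ∫ y, ker m (x - y) * g j y =
      inner ℂ ((memLp_conj (ker_sub_memLp m x)).toLp _) ((g j).toLp 2) := by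
    intro j
    rw [← integral_mul_eq_inner (ker_sub_memLp m x)]
    apply integral_congr_ae
    filter_upwards [(g j).coeFn_toLp 2 volume] with y hy
    rw [hy]
  simp_rw [h3, integral_mul_eq_inner (ker_sub_memLp m x)]
  exact ((continuous_const.inner continuous_id).tendsto f).comp (hg.comp hmono.tendsto_atTop)

theorem integrable_ker_mul (m : 𝓢(Rn n, ℂ)) (f : L2 n) (x : Rn n) :
    Integrable (fun y ↦ ker m (x - y) * f y) volume :=
  (ker_sub_memLp m x).integrable_mul (Lp.memLp f)

theorem enorm_sq_lintegral (f : L2 n) : ‖f‖ₑ ^ 2 = ∫⁻ x, ‖f x‖ₑ ^ 2 := by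
  have h := MeasureTheory.eLpNorm_nnreal_pow_eq_lintegral (f := (f : Rn n → ℂ)) (μ := volume)
    (p := 2) (by norm_num)
  rw [Lp.enorm_def]
  simpa using h

/-- Schur's test for an integral operator dominated by a convolution. -/
theorem norm_le_of_kernel_le {k : Rn n → Rn n → ℂ} {h : Rn n → ℝ} (hh : Integrable h volume)
    (hbd : ∀ x y, ‖k x y‖ ≤ h (x - y)) (f D : L2 n)
    (hD : D =ᵐ[volume] fun x ↦ ∫ y, k x y * f y) : ‖D‖ ≤ (∫ z, h z) * ‖f‖ := by
  have h0 : ∀ z, 0 ≤ h z := fun z ↦ by simpa using (norm_nonneg _).trans (hbd z 0)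
  obtain ⟨H, hHm, hH⟩ := hh.aestronglyMeasurable.enorm
  set I : ℝ≥0∞ := ∫⁻ z, ‖h z‖ₑ with hI
  have hIfin : I = ENNReal.ofReal (∫ z, h z) := by
    rw [ofReal_integral_eq_lintegral_ofReal hh (ae_of_all _ h0), hI]
    exact lintegral_congr fun z ↦ Real.enorm_of_nonneg (h0 z)
  have hIH : ∫⁻ z, H z = I := lintegral_congr_ae hH.symm
  have hHx : ∀ x, (fun y ↦ ‖h (x - y)‖ₑ) =ᵐ[volume] fun y ↦ H (x - y) := fun x ↦
    (Measure.measurePreserving_sub_left volume x).quasiMeasurePreserving.ae_eq hH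
  have hF : Measurable fun x ↦ ‖f x‖ₑ := (Lp.stronglyMeasurable f).measurable.enorm
  have h1 : ∀ᵐ x, ‖D x‖ₑ ^ 2 ≤ I * ∫⁻ y, H (x - y) * ‖f y‖ₑ ^ 2 := by
    filter_upwards [hD] with x hx
    have h2 : ‖D x‖ₑ ≤ ∫⁻ y, H (x - y) ^ (1 / 2 : ℝ) * (H (x - y) ^ (1 / 2 : ℝ) * ‖f y‖ₑ) := by
      rw [hx]
      refine (enorm_integral_le_lintegral_enorm _).trans (lintegral_mono_ae ?_)
      filter_upwards [hHx x] with y hy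
      rw [enorm_mul, ← mul_assoc, ← ENNReal.rpow_add_of_nonneg _ _ (by norm_num) (by norm_num)]
      norm_num
      rw [← hy]
      gcongr
      rw [Real.enorm_of_nonneg (h0 _), ← ofReal_norm]
      exact ENNReal.ofReal_le_ofReal (hbd x y)
    have hm : Measurable fun y ↦ H (x - y) := hHm.comp (measurable_const.sub measurable_id)
    have h3 := ENNReal.lintegral_mul_le_Lp_mul_Lq volume (Real.HolderConjugate.two_two)
      (hm.pow_const (1 / 2 : ℝ)).aemeasurable ((hm.pow_const (1 / 2 : ℝ)).mul hF).aemeasurable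
    have h4 : ∫⁻ y, H (x - y) = I := by
      rw [lintegral_sub_left_eq_self, hIH]
    simp only [Pi.mul_apply] at h3
    have h5 := h2.trans h3
    have h6 : ∀ a : ℝ≥0∞, (a ^ (1 / 2 : ℝ)) ^ (2 : ℝ) = a := fun a ↦ by
      rw [← ENNReal.rpow_mul]; norm_num
    simp_rw [ENNReal.mul_rpow_of_nonneg _ _ (show (0 : ℝ) ≤ 2 by norm_num), h6] at h5
    calc ‖D x‖ₑ ^ 2 ≤ _ := pow_le_pow_left' h5 2
      _ = _ := by
        rw [mul_pow, h4, ← ENNReal.rpow_natCast, ← ENNReal.rpow_natCast, Nat.cast_ofNat, h6, h6]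
        simp
  have h7 : ‖D‖ₑ ^ 2 ≤ (I * ‖f‖ₑ) ^ 2 := by
    rw [enorm_sq_lintegral]
    calc _ ≤ ∫⁻ x, I * ∫⁻ y, H (x - y) * ‖f y‖ₑ ^ 2 := lintegral_mono_ae h1
      _ = I * ∫⁻ x, ∫⁻ y, H (x - y) * ‖f y‖ₑ ^ 2 := by
        rw [lintegral_const_mul]
        apply Measurable.lintegral_prod_right
        exact (hHm.comp (measurable_fst.sub measurable_snd)).mul
          ((hF.comp measurable_snd).pow_const 2)
      _ = I * ∫⁻ y, ∫⁻ x, H (x - y) * ‖f y‖ₑ ^ 2 := by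
        rw [lintegral_lintegral_swap]
        exact ((hHm.comp (measurable_fst.sub measurable_snd)).mul
          ((hF.comp measurable_snd).pow_const 2)).aemeasurable
      _ = I * ∫⁻ y, I * ‖f y‖ₑ ^ 2 := by
        congr 1
        apply lintegral_congr
        intro y
        have hm : Measurable fun x ↦ H (x - y) := hHm.comp (measurable_id.sub measurable_const)
        rw [lintegral_mul_const _ hm, lintegral_sub_right_eq_self, hIH]
      _ = _ := by
        rw [lintegral_const_mul _ (hF.pow_const 2), ← enorm_sq_lintegral]
        ring
  have h8 : ‖D‖ₑ ≤ I * ‖f‖ₑ := (ENNReal.pow_le_pow_left_iff two_ne_zero).1 h7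
  rw [hIfin, ← ofReal_norm, ← ofReal_norm,
    ← ENNReal.ofReal_mul (integral_nonneg h0)] at h8
  exact (ENNReal.ofReal_le_ofReal_iff
    (mul_nonneg (integral_nonneg h0) (norm_nonneg _))).1 h8

/-- The `j`-th absolute moment of the convolution kernel of `m(D)`. -/
def mom (j : ℕ) (m : 𝓢(Rn n, ℂ)) : ℝ := ∫ z, ‖z‖ ^ j * ‖ker m z‖

theorem mom_integrable (j : ℕ) (m : 𝓢(Rn n, ℂ)) :
    Integrable (fun z ↦ ‖z‖ ^ j * ‖ker m z‖) volume :=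
  (𝓕⁻ m : 𝓢(Rn n, ℂ)).integrable_pow_mul volume j

theorem mom_nonneg (j : ℕ) (m : 𝓢(Rn n, ℂ)) : 0 ≤ mom j m :=
  integral_nonneg fun z ↦ by positivity

theorem norm_le_mom_mul {m : 𝓢(Rn n, ℂ)} {θ : Rn n → Rn n → ℂ} {C : ℝ} {j : ℕ}
    (hθ : ∀ x y, ‖θ x y‖ ≤ C * ‖x - y‖ ^ j) (f D : L2 n)
    (hD : D =ᵐ[volume] fun x ↦ ∫ y, θ x y * ker m (x - y) * f y) :
    ‖D‖ ≤ C * mom j m * ‖f‖ := by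
  have h := norm_le_of_kernel_le (h := fun z ↦ C * (‖z‖ ^ j * ‖ker m z‖))
    ((mom_integrable j m).const_mul C) (k := fun x y ↦ θ x y * ker m (x - y)) (fun x y ↦ by
      rw [norm_mul, ← mul_assoc]
      exact mul_le_mul_of_nonneg_right (hθ x y) (norm_nonneg _)) f D hD
  rwa [integral_const_mul] at h

/-- The commutator of a Lipschitz function with `m(D)` gains the first moment of the kernel. -/
theorem norm_commutator_le (m : 𝓢(Rn n, ℂ)) {a : Rn n → ℂ} (ha : BddMeas a) {Λ : ℝ}
    (hΛ : ∀ x y, ‖a x - a y‖ ≤ Λ * ‖x - y‖) (f : L2 n) :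
    ‖mulOp a (mult m f) - mult m (mulOp a f)‖ ≤ Λ * mom 1 m * ‖f‖ := by
  refine norm_le_mom_mul (θ := fun x y ↦ a x - a y) (j := 1) (by simpa using hΛ) f _ ?_
  filter_upwards [Lp.coeFn_sub (mulOp a (mult m f)) (mult m (mulOp a f)),
    coeFn_mulOp ha (mult m f), mult_eq_integral_ker m f, mult_eq_integral_ker m (mulOp a f)]
    with x h1 h2 h3 h4
  rw [h1, Pi.sub_apply, h2, h3, h4, ← integral_const_mul, ← integral_sub
    ((integrable_ker_mul m f x).const_mul _) (integrable_ker_mul m _ x)]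
  apply integral_congr_ae
  filter_upwards [coeFn_mulOp ha f] with y hy
  rw [hy]
  ring

/-- A second commutator expansion: the symmetrised principal part `g b(D) g` of `[φ, m(D)]` leaves
a remainder controlled by the third moment of the kernel. -/
theorem norm_commutator_sub_symm_le (m b : 𝓢(Rn n, ℂ)) {ν : Rn n}
    (hb : ∀ z, ker b z = (inner ℝ ν z : ℝ) * ker m z)
    {φ g : Rn n → ℂ} (hφ : BddMeas φ) (hg : BddMeas g) {Λ : ℝ}
    (hΛ : ∀ x y, ‖φ x - φ y - (inner ℝ ν (x - y) : ℝ) * (g x * g y)‖ ≤ Λ * ‖x - y‖ ^ 3)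
    (f : L2 n) :
    ‖mulOp φ (mult m f) - mult m (mulOp φ f) - mulOp g (mult b (mulOp g f))‖
      ≤ Λ * mom 3 m * ‖f‖ := by
  refine norm_le_mom_mul hΛ f _ ?_
  filter_upwards [Lp.coeFn_sub (mulOp φ (mult m f) - mult m (mulOp φ f))
      (mulOp g (mult b (mulOp g f))), Lp.coeFn_sub (mulOp φ (mult m f)) (mult m (mulOp φ f)),
    coeFn_mulOp hφ (mult m f), mult_eq_integral_ker m f, mult_eq_integral_ker m (mulOp φ f),
    coeFn_mulOp hg (mult b (mulOp g f)), mult_eq_integral_ker b (mulOp g f)]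
    with x h0 h1 h2 h3 h4 h5 h6
  have i1 : Integrable (fun y ↦ φ x * (ker m (x - y) * f y) -
      ker m (x - y) * (mulOp φ f : L2 n) y) volume :=
    ((integrable_ker_mul m f x).const_mul _).sub (integrable_ker_mul m _ x)
  rw [h0, Pi.sub_apply, h1, Pi.sub_apply, h2, h3, h4, h5, h6, ← integral_const_mul,
    ← integral_const_mul, ← integral_sub
    ((integrable_ker_mul m f x).const_mul _) (integrable_ker_mul m _ x), ← integral_sub i1
    ((integrable_ker_mul b _ x).const_mul _)]
  apply integral_congr_ae
  filter_upwards [coeFn_mulOp hφ f, coeFn_mulOp hg f] with y hy hy2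
  rw [hy, hy2, hb]
  ring

/-! ### Dilations of symbols -/

/-- The dilated symbol `ξ ↦ m (ξ / R)`. -/
def dil (R : ℝ) (hR : R ≠ 0) (m : 𝓢(Rn n, ℂ)) : 𝓢(Rn n, ℂ) :=
  SchwartzMap.compCLMOfContinuousLinearEquiv ℂ
    (ContinuousLinearEquiv.smulLeft (Units.mk0 R⁻¹ (inv_ne_zero hR))) m

theorem dil_apply (R : ℝ) (hR : R ≠ 0) (m : 𝓢(Rn n, ℂ)) (ξ : Rn n) :
    dil R hR m ξ = m (R⁻¹ • ξ) := rfl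

theorem ker_dil {R : ℝ} (hR : 0 < R) (m : 𝓢(Rn n, ℂ)) (z : Rn n) :
    ker (dil R hR.ne' m) z = (R ^ n : ℝ) * ker m (R • z) := by
  simp only [ker, SchwartzMap.fourierInv_coe, Real.fourierInv_eq, dil_apply]
  have h := Measure.integral_comp_smul (volume : Measure (Rn n))
    (fun ξ ↦ (Real.fourierChar (inner ℝ ξ (R • z)) : Circle) • m ξ) R⁻¹
  have h2 : ∀ ξ : Rn n, inner ℝ (R⁻¹ • ξ) (R • z) = (inner ℝ ξ z : ℝ) := fun ξ ↦ by
    rw [inner_smul_left, inner_smul_right]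
    simp [hR.ne']
  simp only [h2] at h
  rw [h]
  simp [abs_of_pos hR]

theorem mom_dil {R : ℝ} (hR : 0 < R) (j : ℕ) (m : 𝓢(Rn n, ℂ)) :
    mom j (dil R hR.ne' m) = (R ^ j)⁻¹ * mom j m := by
  simp only [mom, ker_dil hR]
  have h := Measure.integral_comp_smul (volume : Measure (Rn n))
    (fun z ↦ (R ^ j)⁻¹ * (‖z‖ ^ j * ‖ker m z‖)) R
  have h2 : ∀ z : Rn n, ‖z‖ ^ j * ‖((R ^ n : ℝ) : ℂ) * ker m (R • z)‖ =
      R ^ n * ((R ^ j)⁻¹ * (‖R • z‖ ^ j * ‖ker m (R • z)‖)) := fun z ↦ by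
    rw [norm_mul, norm_smul, Complex.norm_real, mul_pow]
    simp only [norm_pow, Real.norm_eq_abs, abs_of_pos hR]
    field_simp
  simp_rw [h2]
  rw [integral_const_mul, h, integral_const_mul]
  simp only [finrank_euclideanSpace, Fintype.card_fin, abs_inv, abs_pow, abs_of_pos hR,
    smul_eq_mul]
  rw [mul_inv_cancel_left₀ (by positivity)]

theorem mom_smul (j : ℕ) (c : ℂ) (m : 𝓢(Rn n, ℂ)) : mom j (c • m) = ‖c‖ * mom j m := by
  have h : ∀ z, ker (c • m) z = c * ker m z := fun z ↦ by
    simp [ker, FourierTransform.fourierInv_smul]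
  simp only [mom, h, norm_mul]
  rw [← integral_const_mul]
  congr 1
  ext z
  ring

end FZK

end

noncomputable section

namespace FZK

variable {n : ℕ}

/-! ### Dyadic symbols -/

/-- A smooth radial cut-off, equal to `1` on the unit ball and to `0` where `2 ≤ ‖ξ‖ ^ 2`. -/
def bump (ξ : Rn n) : ℝ := Real.smoothTransition (2 - ‖ξ‖ ^ 2)

theorem bump_contDiff : ContDiff ℝ ∞ (bump : Rn n → ℝ) :=
  Real.smoothTransition.contDiff.comp (contDiff_const.sub (contDiff_norm_sq ℝ))

theorem bump_nonneg (ξ : Rn n) : 0 ≤ bump ξ := Real.smoothTransition.nonneg _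

theorem bump_le_one (ξ : Rn n) : bump ξ ≤ 1 := Real.smoothTransition.le_one _

theorem bump_eq_one {ξ : Rn n} (h : ‖ξ‖ ≤ 1) : bump ξ = 1 :=
  Real.smoothTransition.one_of_one_le (by nlinarith [norm_nonneg ξ])

theorem bump_eq_zero {ξ : Rn n} (h : 2 ≤ ‖ξ‖ ^ 2) : bump ξ = 0 :=
  Real.smoothTransition.zero_of_nonpos (by linarith)

theorem bump_neg (ξ : Rn n) : bump (-ξ) = bump ξ := by simp [bump]

theorem bump_hasCompactSupport : HasCompactSupport (bump : Rn n → ℝ) := by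
  apply HasCompactSupport.of_support_subset_isCompact (isCompact_closedBall (0 : Rn n) 2)
  intro ξ hξ
  rw [mem_closedBall_zero_iff]
  by_contra h
  exact hξ (bump_eq_zero (by nlinarith))

/-- A smooth complex-valued function with compact support, as a Schwartz function. -/
def toS (f : Rn n → ℂ) (h1 : HasCompactSupport f) (h2 : ContDiff ℝ ∞ f) : 𝓢(Rn n, ℂ) :=
  h1.toSchwartzMap h2

@[simp] theorem toS_apply (f : Rn n → ℂ) (h1 : HasCompactSupport f) (h2 : ContDiff ℝ ∞ f)
    (x : Rn n) : toS f h1 h2 x = f x := by simp [toS]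

/-- The cut-off `bump` as a Schwartz function. -/
def lowSym : 𝓢(Rn n, ℂ) :=
  toS (fun ξ ↦ (bump ξ : ℂ)) (bump_hasCompactSupport.comp_left (g := fun x : ℝ ↦ (x : ℂ)) rfl)
    (Complex.ofRealCLM.contDiff.comp bump_contDiff)

@[simp] theorem lowSym_apply (ξ : Rn n) : lowSym ξ = (bump ξ : ℂ) := toS_apply _ _ _ _

/-- The cut-off to the annulus `1 ≤ ‖ξ‖ ≤ 2√2`, whose dyadic dilates form a partition of unity
together with `bump`. -/
def annReal (ξ : Rn n) : ℝ := bump ((2 : ℝ)⁻¹ • ξ) - bump ξ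

/-- A cut-off to a larger annulus, equal to `1` on the support of `annReal`. -/
def fatReal (ξ : Rn n) : ℝ := bump ((4 : ℝ)⁻¹ • ξ) - bump ((2 : ℝ) • ξ)

/-- A cut-off to a still larger annulus, equal to `1` near the support of `fatReal`. -/
def wideReal (ξ : Rn n) : ℝ := bump ((16 : ℝ)⁻¹ • ξ) - bump ((8 : ℝ) • ξ)

theorem bump_smul_contDiff (c : ℝ) : ContDiff ℝ ∞ (fun ξ : Rn n ↦ bump (c • ξ)) :=
  bump_contDiff.comp (contDiff_const_smul c)

theorem norm_smul_pos {c : ℝ} (hc : 0 < c) (ξ : Rn n) : ‖c • ξ‖ = c * ‖ξ‖ := by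
  rw [norm_smul, Real.norm_of_nonneg hc.le]

theorem annReal_eq_zero_of_le {ξ : Rn n} (h : ‖ξ‖ ≤ 1) : annReal ξ = 0 := by
  rw [annReal, bump_eq_one h, bump_eq_one, sub_self]
  rw [norm_smul_pos (by norm_num)]; linarith [norm_nonneg ξ]

theorem annReal_eq_zero_of_ge {ξ : Rn n} (h : 4 ≤ ‖ξ‖) : annReal ξ = 0 := by
  rw [annReal, bump_eq_zero (ξ := ξ) (by nlinarith), bump_eq_zero, sub_self]
  rw [norm_smul_pos (by norm_num)]; nlinarith

theorem fatReal_eq_one {ξ : Rn n} (h : 1 ≤ ‖ξ‖) (h2 : ‖ξ‖ ≤ 4) : fatReal ξ = 1 := by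
  rw [fatReal, bump_eq_one, bump_eq_zero, sub_zero]
  · rw [norm_smul_pos (by norm_num)]; nlinarith
  · rw [norm_smul_pos (by norm_num)]; linarith

theorem fatReal_eq_zero_of_le {ξ : Rn n} (h : ‖ξ‖ ≤ 1 / 2) : fatReal ξ = 0 := by
  rw [fatReal, bump_eq_one, bump_eq_one, sub_self]
  · rw [norm_smul_pos (by norm_num)]; linarith
  · rw [norm_smul_pos (by norm_num)]; linarith [norm_nonneg ξ]

theorem fatReal_eq_zero_of_ge {ξ : Rn n} (h : 8 ≤ ‖ξ‖) : fatReal ξ = 0 := by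
  rw [fatReal, bump_eq_zero, bump_eq_zero, sub_self]
  · rw [norm_smul_pos (by norm_num)]; nlinarith
  · rw [norm_smul_pos (by norm_num)]; nlinarith

theorem wideReal_eq_one {ξ : Rn n} (h : 1 / 4 ≤ ‖ξ‖) (h2 : ‖ξ‖ ≤ 16) : wideReal ξ = 1 := by
  rw [wideReal, bump_eq_one, bump_eq_zero, sub_zero]
  · rw [norm_smul_pos (by norm_num)]; nlinarith
  · rw [norm_smul_pos (by norm_num)]; linarith

theorem wideReal_eq_zero_of_le {ξ : Rn n} (h : ‖ξ‖ ≤ 1 / 8) : wideReal ξ = 0 := by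
  rw [wideReal, bump_eq_one, bump_eq_one, sub_self]
  · rw [norm_smul_pos (by norm_num)]; linarith
  · rw [norm_smul_pos (by norm_num)]; linarith [norm_nonneg ξ]

theorem wideReal_eq_zero_of_ge {ξ : Rn n} (h : 32 ≤ ‖ξ‖) : wideReal ξ = 0 := by
  rw [wideReal, bump_eq_zero, bump_eq_zero, sub_self]
  · rw [norm_smul_pos (by norm_num)]; nlinarith
  · rw [norm_smul_pos (by norm_num)]; nlinarith

theorem abs_sub_bump_le (ξ η : Rn n) : |bump ξ - bump η| ≤ 1 := by
  rw [abs_le]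
  constructor <;> linarith [bump_nonneg ξ, bump_nonneg η, bump_le_one ξ, bump_le_one η]

theorem abs_annReal_le (ξ : Rn n) : |annReal ξ| ≤ 1 := abs_sub_bump_le _ _

theorem annReal_contDiff : ContDiff ℝ ∞ (annReal : Rn n → ℝ) :=
  (bump_smul_contDiff _).sub bump_contDiff

theorem fatReal_contDiff : ContDiff ℝ ∞ (fatReal : Rn n → ℝ) :=
  (bump_smul_contDiff _).sub (bump_smul_contDiff _)

theorem wideReal_contDiff : ContDiff ℝ ∞ (wideReal : Rn n → ℝ) :=
  (bump_smul_contDiff _).sub (bump_smul_contDiff _)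

theorem hasCompactSupport_of_ball {F : Type*} [Zero F] {f : Rn n → F} (r : ℝ)
    (h : ∀ ξ, r ≤ ‖ξ‖ → f ξ = 0) : HasCompactSupport f := by
  apply HasCompactSupport.of_support_subset_isCompact (isCompact_closedBall (0 : Rn n) r)
  intro ξ hξ
  rw [mem_closedBall_zero_iff]
  by_contra h'
  exact hξ (h ξ (by linarith))

/-- The cut-off `annReal` as a Schwartz function. -/
def annSym : 𝓢(Rn n, ℂ) :=
  toS (fun ξ ↦ (annReal ξ : ℂ))
    (hasCompactSupport_of_ball 4 fun ξ h ↦ by simp [annReal_eq_zero_of_ge h])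
    (Complex.ofRealCLM.contDiff.comp annReal_contDiff)

/-- The cut-off `fatReal` as a Schwartz function. -/
def fatSym : 𝓢(Rn n, ℂ) :=
  toS (fun ξ ↦ (fatReal ξ : ℂ))
    (hasCompactSupport_of_ball 8 fun ξ h ↦ by simp [fatReal_eq_zero_of_ge h])
    (Complex.ofRealCLM.contDiff.comp fatReal_contDiff)

@[simp] theorem annSym_apply (ξ : Rn n) : annSym ξ = (annReal ξ : ℂ) := toS_apply _ _ _ _

@[simp] theorem fatSym_apply (ξ : Rn n) : fatSym ξ = (fatReal ξ : ℂ) := toS_apply _ _ _ _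

theorem coord_contDiff (j : Fin n) : ContDiff ℝ ∞ (fun ξ : Rn n ↦ ξ j) :=
  (EuclideanSpace.proj j : Rn n →L[ℝ] ℝ).contDiff

variable [NeZero n]

/-- The symbol `2πi ξ₁` of `∂_{x₁}`. -/
def dsym (ξ : Rn n) : ℂ := 2 * Real.pi * Complex.I * (ξ 0 : ℝ)

theorem dsym_contDiff : ContDiff ℝ ∞ (dsym : Rn n → ℂ) :=
  contDiff_const.mul (Complex.ofRealCLM.contDiff.comp (coord_contDiff 0))

theorem dsym_smul (c : ℝ) (ξ : Rn n) : dsym (c • ξ) = c * dsym ξ := by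
  simp [dsym]; ring

theorem conj_dsym (ξ : Rn n) : (starRingEnd ℂ) (dsym ξ) = -dsym ξ := by
  simp [dsym, Complex.conj_ofNat]

/-- The symbol of `∂_{x₁}`, cut off to the annulus of `annReal`. -/
def dannSym : 𝓢(Rn n, ℂ) :=
  toS (fun ξ ↦ dsym ξ * annReal ξ)
    (hasCompactSupport_of_ball 4 fun ξ h ↦ by simp [annReal_eq_zero_of_ge h])
    (dsym_contDiff.mul (Complex.ofRealCLM.contDiff.comp annReal_contDiff))

/-- The symbol of `∂_{x₁}`, cut off to the annulus of `fatReal`. -/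
def dfatSym : 𝓢(Rn n, ℂ) :=
  toS (fun ξ ↦ dsym ξ * fatReal ξ)
    (hasCompactSupport_of_ball 8 fun ξ h ↦ by simp [fatReal_eq_zero_of_ge h])
    (dsym_contDiff.mul (Complex.ofRealCLM.contDiff.comp fatReal_contDiff))

@[simp] theorem dannSym_apply (ξ : Rn n) : dannSym ξ = dsym ξ * annReal ξ := toS_apply _ _ _ _

@[simp] theorem dfatSym_apply (ξ : Rn n) : dfatSym ξ = dsym ξ * fatReal ξ := toS_apply _ _ _ _

/-- The real function `ξ₁ |2πξ| ^ α`, cut off to the annulus of `wideReal`. -/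
def dispReal (α : ℝ) (ξ : Rn n) : ℝ := ξ 0 * ‖(2 * Real.pi) • ξ‖ ^ α * wideReal ξ

theorem dispReal_contDiff (α : ℝ) : ContDiff ℝ ∞ (dispReal α : Rn n → ℝ) := by
  rw [contDiff_iff_contDiffAt]
  intro ξ
  by_cases h : ξ = 0
  · have h0 : (dispReal α : Rn n → ℝ) =ᶠ[𝓝 ξ] fun _ ↦ 0 := by
      filter_upwards [Metric.ball_mem_nhds ξ (show (0 : ℝ) < 1 / 8 by norm_num)] with η hη
      rw [h, mem_ball_zero_iff] at hη
      rw [dispReal, wideReal_eq_zero_of_le hη.le, mul_zero]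
    exact contDiffAt_const.congr_of_eventuallyEq h0
  · have h1 : (2 * Real.pi) • ξ ≠ 0 := smul_ne_zero (by positivity) h
    refine ContDiffAt.mul (ContDiffAt.mul (coord_contDiff 0).contDiffAt ?_)
      wideReal_contDiff.contDiffAt
    refine ContDiffAt.rpow_const_of_ne ?_ (norm_ne_zero_iff.2 h1)
    exact ContDiffAt.norm ℝ (contDiff_const_smul _).contDiffAt h1

/-- The symbol of `∂_{x₁} (-Δ) ^ (α / 2)`, cut off to the annulus of `wideReal`. -/
def dispSym (α : ℝ) : 𝓢(Rn n, ℂ) :=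
  toS (fun ξ ↦ 2 * Real.pi * Complex.I * (dispReal α ξ : ℝ))
    (hasCompactSupport_of_ball 32 fun ξ h ↦ by simp [dispReal, wideReal_eq_zero_of_ge h])
    (contDiff_const.mul (Complex.ofRealCLM.contDiff.comp (dispReal_contDiff α)))

@[simp] theorem dispSym_apply (α : ℝ) (ξ : Rn n) :
    dispSym α ξ = 2 * Real.pi * Complex.I * (dispReal α ξ : ℝ) := toS_apply _ _ _ _

/-- The symbol whose kernel is `⟪ν, z⟫` times the kernel of `dispSym α`. -/
def dispDerivSym (α : ℝ) (ν : Rn n) : 𝓢(Rn n, ℂ) :=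
  (Complex.I / (2 * Real.pi)) • ∂_{ν} (dispSym α : 𝓢(Rn n, ℂ))

theorem ker_dispDerivSym (α : ℝ) (ν z : Rn n) :
    ker (dispDerivSym α ν) z = (inner ℝ ν z : ℝ) * ker (dispSym α) z := by
  have hg : (fun x : Rn n ↦ inner ℝ x ν).HasTemperateGrowth := by fun_prop
  rw [ker, dispDerivSym, FourierTransform.fourierInv_smul, SchwartzMap.fourierInv_lineDerivOp_eq]
  simp only [FunLike.coe_smul, Pi.smul_apply, SchwartzMap.smulLeftCLM_apply_apply hg, smul_eq_mul,
    Complex.real_smul, real_inner_comm z ν, ker]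
  have hpi : (Real.pi : ℂ) ≠ 0 := by exact_mod_cast Real.pi_ne_zero
  field_simp
  simp

theorem dispDerivSym_apply (α : ℝ) (ν ξ : Rn n) :
    dispDerivSym α ν ξ = ((-(fderiv ℝ (dispReal α) ξ ν) : ℝ) : ℂ) := by
  have hd : HasFDerivAt (dispReal α) (fderiv ℝ (dispReal α) ξ) ξ :=
    ((dispReal_contDiff α).differentiable (by simp)).differentiableAt.hasFDerivAt
  have h2 : HasFDerivAt (dispSym α : 𝓢(Rn n, ℂ))
      ((2 * Real.pi * Complex.I : ℂ) • Complex.ofRealCLM.comp (fderiv ℝ (dispReal α) ξ)) ξ := by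
    have h3 := (Complex.ofRealCLM.hasFDerivAt.comp ξ hd).const_mul (2 * Real.pi * Complex.I : ℂ)
    refine h3.congr_of_eventuallyEq (Eventually.of_forall fun x ↦ ?_)
    simp
  simp only [dispDerivSym, FunLike.coe_smul, Pi.smul_apply, SchwartzMap.lineDerivOp_apply_eq_fderiv,
    h2.fderiv]
  have hpi : (Real.pi : ℂ) ≠ 0 := by exact_mod_cast Real.pi_ne_zero
  simp
  field_simp
  simp

/-- On the annulus of `fatReal` the symbol `dispDerivSym` is the (negative) quadratic form that
governs the smoothing effect, times a power of `‖ξ‖`. -/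
theorem fderiv_dispReal (α : ℝ) (ν : Rn n) {ξ : Rn n} (h : 1 / 4 < ‖ξ‖) (h2 : ‖ξ‖ < 16) :
    fderiv ℝ (dispReal α) ξ ν = (2 * Real.pi) ^ α * ‖ξ‖ ^ (α - 2) *
      (ν 0 * ‖ξ‖ ^ 2 + α * ξ 0 * inner ℝ ν ξ) := by
  have hξ : 0 < ‖ξ‖ := by linarith
  have hne : ξ ≠ 0 := norm_pos_iff.1 hξ
  have heq : dispReal α =ᶠ[𝓝 ξ] fun η : Rn n ↦ (2 * Real.pi) ^ α * (η 0 * ‖η‖ ^ α) := by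
    have ho : IsOpen {η : Rn n | 1 / 4 < ‖η‖ ∧ ‖η‖ < 16} :=
      (isOpen_lt continuous_const continuous_norm).inter
        (isOpen_lt continuous_norm continuous_const)
    filter_upwards [ho.mem_nhds ⟨h, h2⟩] with η hη
    rw [dispReal, wideReal_eq_one hη.1.le hη.2.le, norm_smul_pos (by positivity),
      Real.mul_rpow (by positivity) (norm_nonneg _)]
    ring
  have h0 : HasFDerivAt (fun η : Rn n ↦ η 0)
      (EuclideanSpace.proj (0 : Fin n) : Rn n →L[ℝ] ℝ) ξ :=
    (EuclideanSpace.proj (0 : Fin n) : Rn n →L[ℝ] ℝ).hasFDerivAt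
  have h1 : HasFDerivAt (fun η : Rn n ↦ (‖η‖ ^ 2) ^ (α / 2))
      (((α / 2) * (‖ξ‖ ^ 2) ^ (α / 2 - 1)) • (2 • innerSL ℝ ξ)) ξ :=
    (hasStrictFDerivAt_norm_sq ξ).hasFDerivAt.rpow_const (Or.inl (by positivity))
  have hpow : ∀ (η : Rn n) (p : ℝ), (‖η‖ ^ 2) ^ (p / 2) = ‖η‖ ^ p := fun η p ↦ by
    rw [← Real.rpow_natCast, ← Real.rpow_mul (norm_nonneg _)]
    congr 1
    push_cast
    ring
  have e1 : α / 2 - 1 = (α - 2) / 2 := by ring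
  rw [e1, hpow] at h1
  simp_rw [hpow] at h1
  have h3 : HasFDerivAt (fun η : Rn n ↦ (2 * Real.pi) ^ α * (η 0 * ‖η‖ ^ α)) _ ξ :=
    (h0.mul h1).const_mul ((2 * Real.pi) ^ α)
  rw [heq.fderiv_eq, h3.fderiv]
  have h4 : (EuclideanSpace.proj (0 : Fin n) : Rn n →L[ℝ] ℝ) ν = ν 0 := rfl
  simp only [smul_apply, add_apply, smul_eq_mul, innerSL_apply_apply, two_smul,
    real_inner_comm ξ ν, h4]
  have e2 : ‖ξ‖ ^ α = ‖ξ‖ ^ (α - 2) * ‖ξ‖ ^ 2 := by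
    rw [← Real.rpow_natCast, ← Real.rpow_add hξ]
    norm_num
  rw [e2]
  ring

end FZK

end

noncomputable section

namespace FZK

/-! ### One-dimensional weights -/

/-- Second-order Taylor bound for a function with Lipschitz derivative. -/
theorem abs_taylor_two {p p' : ℝ → ℝ} {M : ℝ} (hp : ∀ x, HasDerivAt p (p' x) x)
    (hM : ∀ x y, |p' x - p' y| ≤ M * |x - y|) (x y : ℝ) :
    |p x - p y - p' y * (x - y)| ≤ M * |x - y| ^ 2 := by
  have h : ∀ z ∈ uIcc y x, HasDerivWithinAt (fun z ↦ p z - p' y * z) (p' z - p' y) (uIcc y x) z :=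
    fun z _ ↦ ((hp z).sub (by simpa using (hasDerivAt_id z).const_mul (p' y))).hasDerivWithinAt
  have hM0 : 0 ≤ M := by simpa using (abs_nonneg _).trans (hM 1 0)
  have h2 := Convex.norm_image_sub_le_of_norm_hasDerivWithin_le h
    (C := M * |x - y|) (fun z hz ↦ by
      rw [Real.norm_eq_abs]
      exact (hM z y).trans (mul_le_mul_of_nonneg_left (abs_sub_left_of_mem_uIcc hz) hM0))
    (convex_uIcc y x) left_mem_uIcc right_mem_uIcc
  rw [Real.norm_eq_abs, Real.norm_eq_abs] at h2
  calc _ = |p x - p' y * x - (p y - p' y * y)| := by congr 1; ring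
    _ ≤ _ := h2
    _ = _ := by ring

/-- The square root of a nonnegative function with Lipschitz derivative is Lipschitz. -/
theorem abs_sqrt_sub_sqrt_le {p p' : ℝ → ℝ} {M : ℝ} (hp : ∀ x, HasDerivAt p (p' x) x)
    (hM : ∀ x y, |p' x - p' y| ≤ M * |x - y|) (h0 : ∀ x, 0 ≤ p x) (x y : ℝ) :
    |√(p x) - √(p y)| ≤ √M * |x - y| := by
  have hM0 : 0 ≤ M := by simpa using (abs_nonneg _).trans (hM 1 0)
  have key : ∀ a b, √(p b) ≤ √(p a) + √M * |b - a| := by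
    intro a b
    -- nonnegativity of the quadratic Taylor majorant bounds `p'` by `√p`
    have hq : ∀ t : ℝ, 0 ≤ M * (t * t) + p' a * t + p a := by
      intro t
      have h1 := abs_le.1 (abs_taylor_two hp hM (a + t) a)
      rw [add_sub_cancel_left, sq_abs] at h1
      nlinarith [h0 (a + t), h1.2]
    have hd := discrim_le_zero hq
    rw [discrim] at hd
    have h2 : |p' a| ≤ 2 * (√M * √(p a)) := by
      apply abs_le_of_sq_le_sq _ (by positivity)
      rw [mul_pow, mul_pow, Real.sq_sqrt hM0, Real.sq_sqrt (h0 a)]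
      linarith
    have h3 := (abs_le.1 (abs_taylor_two hp hM b a)).2
    apply Real.sqrt_le_iff.2 ⟨by positivity, ?_⟩
    have h4 : p' a * (b - a) ≤ 2 * (√M * √(p a)) * |b - a| := by
      refine (le_abs_self _).trans ?_
      rw [abs_mul]
      exact mul_le_mul_of_nonneg_right h2 (abs_nonneg _)
    nlinarith [Real.sq_sqrt hM0, Real.sq_sqrt (h0 a)]
  rw [abs_le]
  constructor
  · have := key x y
    rw [abs_sub_comm] at this
    linarith
  · linarith [key y x]

/-- The geometric mean in the trapezoidal rule leaves a cubic error. -/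
theorem abs_trapezoid_le {ϕ p p' : ℝ → ℝ} {M : ℝ} (hϕ : ∀ x, HasDerivAt ϕ (p x) x)
    (hp : ∀ x, HasDerivAt p (p' x) x)
    (hM : ∀ x y, |p' x - p' y| ≤ M * |x - y|) (h0 : ∀ x, 0 ≤ p x) (x y : ℝ) :
    |ϕ x - ϕ y - (x - y) * (√(p x) * √(p y))| ≤ 2 * M * |x - y| ^ 3 := by
  have hM0 : 0 ≤ M := by simpa using (abs_nonneg _).trans (hM 1 0)
  have h : ∀ z ∈ uIcc y x, HasDerivWithinAt
      (fun z ↦ ϕ z - p y * z - p' y * ((z - y) ^ 2 / 2)) (p z - p y - p' y * (z - y))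
      (uIcc y x) z := by
    intro z _
    have h1 : HasDerivAt (fun z ↦ p' y * ((z - y) ^ 2 / 2)) (p' y * (z - y)) z := by
      have := ((((hasDerivAt_id z).sub_const y).pow 2).div_const 2).const_mul (p' y)
      refine this.congr_deriv ?_
      simp
    have h2 : HasDerivAt (fun z ↦ p y * z) (p y) z := by
      simpa using (hasDerivAt_id z).const_mul (p y)
    exact (((hϕ z).sub h2).sub h1).hasDerivWithinAt
  have h2 := Convex.norm_image_sub_le_of_norm_hasDerivWithin_le h
    (C := M * |x - y| ^ 2) (fun z hz ↦ by
      rw [Real.norm_eq_abs]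
      refine (abs_taylor_two hp hM z y).trans (mul_le_mul_of_nonneg_left ?_ hM0)
      exact pow_le_pow_left₀ (abs_nonneg _) (abs_sub_left_of_mem_uIcc hz) 2)
    (convex_uIcc y x) left_mem_uIcc right_mem_uIcc
  rw [Real.norm_eq_abs, Real.norm_eq_abs] at h2
  have h3 := abs_taylor_two hp hM x y
  have h4 := abs_sqrt_sub_sqrt_le hp hM h0 x y
  have h5 : (√(p x) - √(p y)) ^ 2 ≤ M * |x - y| ^ 2 := by
    rw [← sq_abs (√(p x) - √(p y))]
    calc _ ≤ (√M * |x - y|) ^ 2 := pow_le_pow_left₀ (abs_nonneg _) h4 2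
      _ = _ := by rw [mul_pow, Real.sq_sqrt hM0]
  set d := x - y with hd
  set A := ϕ x - p y * x - p' y * (d ^ 2 / 2) - (ϕ y - p y * y - p' y * ((y - y) ^ 2 / 2)) with hA
  set B := p x - p y - p' y * d with hB
  set D := √(p x) - √(p y) with hD
  have e : ϕ x - ϕ y - d * (√(p x) * √(p y)) = A - d / 2 * B + d / 2 * D ^ 2 := by
    have e1 := Real.sq_sqrt (h0 x)
    have e2 := Real.sq_sqrt (h0 y)
    rw [hA, hB, hD, hd]
    linear_combination (-(x - y) / 2) * (e1 + e2)
  rw [e]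
  have h6 : |d / 2 * B| ≤ |d| / 2 * (M * |d| ^ 2) := by
    rw [abs_mul, abs_div, abs_two]
    exact mul_le_mul_of_nonneg_left h3 (by positivity)
  have h7 : |d / 2 * D ^ 2| ≤ |d| / 2 * (M * |d| ^ 2) := by
    rw [abs_mul, abs_div, abs_two, abs_of_nonneg (sq_nonneg D)]
    exact mul_le_mul_of_nonneg_left h5 (by positivity)
  calc _ ≤ |A| + |d / 2 * B| + |d / 2 * D ^ 2| :=
        (abs_add_le _ _).trans (add_le_add_left (abs_sub _ _) _)
    _ ≤ M * |d| ^ 2 * |d| + |d| / 2 * (M * |d| ^ 2) + |d| / 2 * (M * |d| ^ 2) := by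
        gcongr
    _ = _ := by ring

variable {n : ℕ}

/-- A bounded weight `φ` on `ℝⁿ` with gradient `g ^ 2 • ν`, with all the bounds used in the commutator
estimates. The relation between `φ` and `g` enters only through the trapezoidal rule `cubic`. -/
structure Weight (ν : Rn n) (Λ : ℝ) (φ g : Rn n → ℝ) : Prop where
  cont : Continuous φ
  cont_sqrt : Continuous g
  abs_le : ∀ x, |φ x| ≤ Λ
  abs_sqrt_le : ∀ x, |g x| ≤ Λ
  lip : ∀ x y, |φ x - φ y| ≤ Λ * ‖x - y‖
  lip_sqrt : ∀ x y, |g x - g y| ≤ Λ * ‖x - y‖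
  cubic : ∀ x y, |φ x - φ y - inner ℝ ν (x - y) * (g x * g y)| ≤ Λ * ‖x - y‖ ^ 3

/-- Plane-wave weights satisfy the bounds of `Weight`, with a constant depending only on the
direction and on bounds for three derivatives of the profile. -/
theorem weight_of_profile (ν : Rn n) (c : ℝ) : ∃ Λ : ℝ, 0 ≤ Λ ∧ ∀ (ϕ : ℝ → ℝ) (δ : ℝ),
    ContDiff ℝ ∞ ϕ → (∀ j : ℕ, j ≤ 4 → ∀ y : ℝ, |iteratedDeriv j ϕ y| ≤ c) →
    (∀ y : ℝ, 0 ≤ deriv ϕ y) →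
    Weight ν Λ (fun x ↦ ϕ (inner ℝ ν x + δ)) (fun x ↦ √(deriv ϕ (inner ℝ ν x + δ))) := by
  set N := ‖ν‖ with hN
  set c' := max c 0 with hc'
  have hc0 : 0 ≤ c' := le_max_right _ _
  have hN0 : 0 ≤ N := norm_nonneg _
  refine ⟨c' + √c' + c' * N + √c' * N + 2 * c' * N ^ 3, by positivity, ?_⟩
  intro ϕ δ hϕ hb hpos
  have hb' : ∀ j : ℕ, j ≤ 4 → ∀ y : ℝ, |iteratedDeriv j ϕ y| ≤ c' :=
    fun j hj y ↦ (hb j hj y).trans (le_max_left _ _)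
  have hd : ∀ j x, HasDerivAt (iteratedDeriv j ϕ) (iteratedDeriv (j + 1) ϕ x) x := by
    intro j x
    rw [iteratedDeriv_succ]
    exact ((hϕ.differentiable_iteratedDeriv j (by exact_mod_cast WithTop.coe_lt_top _))
      x).hasDerivAt
  have hlip : ∀ j, j ≤ 3 → ∀ x y, |iteratedDeriv j ϕ x - iteratedDeriv j ϕ y| ≤ c' * |x - y| := by
    intro j hj x y
    have := Convex.norm_image_sub_le_of_norm_hasDerivWithin_le (s := univ) (C := c')
      (fun z _ ↦ (hd j z).hasDerivWithinAt) (fun z _ ↦ hb' (j + 1) (by omega) z) convex_univ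
      (mem_univ y) (mem_univ x)
    simpa using this
  have e1 : iteratedDeriv 1 ϕ = deriv ϕ := iteratedDeriv_one
  have h1 := hd 0
  have h2 := hd 1
  have hM := hlip 2 (by norm_num)
  simp only [zero_add, iteratedDeriv_zero, e1] at h1 h2
  have hin : ∀ x y : Rn n, |inner ℝ ν x + δ - (inner ℝ ν y + δ)| ≤ N * ‖x - y‖ := fun x y ↦ by
    have : inner ℝ ν x + δ - (inner ℝ ν y + δ) = (inner ℝ ν (x - y) : ℝ) := by
      rw [inner_sub_right]; ring
    rw [this]
    exact abs_real_inner_le_norm _ _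
  have hs0 : 0 ≤ √c' := Real.sqrt_nonneg _
  have p1 : 0 ≤ c' * N := by positivity
  have p2 : 0 ≤ √c' * N := by positivity
  have p3 : 0 ≤ 2 * c' * N ^ 3 := by positivity
  have hcont : Continuous (deriv ϕ) := by
    rw [← e1]
    exact hϕ.continuous_iteratedDeriv 1 (by exact_mod_cast le_top)
  refine ⟨by have := hϕ.continuous; fun_prop, by fun_prop, fun x ↦ ?_, fun x ↦ ?_, fun x y ↦ ?_,
    fun x y ↦ ?_, fun x y ↦ ?_⟩
  · have := hb' 0 (by norm_num) (inner ℝ ν x + δ)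
    rw [iteratedDeriv_zero] at this
    linarith
  · rw [abs_of_nonneg (Real.sqrt_nonneg _)]
    have := hb' 1 (by norm_num) (inner ℝ ν x + δ)
    rw [e1] at this
    have := Real.sqrt_le_sqrt ((le_abs_self _).trans this)
    linarith
  · have := hlip 0 (by norm_num) (inner ℝ ν x + δ) (inner ℝ ν y + δ)
    rw [iteratedDeriv_zero] at this
    calc _ ≤ c' * (N * ‖x - y‖) := this.trans (mul_le_mul_of_nonneg_left (hin x y) hc0)
      _ = c' * N * ‖x - y‖ := by ring
      _ ≤ _ := mul_le_mul_of_nonneg_right (by linarith) (norm_nonneg _)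
  · have := abs_sqrt_sub_sqrt_le h2 hM hpos (inner ℝ ν x + δ) (inner ℝ ν y + δ)
    calc _ ≤ √c' * (N * ‖x - y‖) := this.trans (mul_le_mul_of_nonneg_left (hin x y) hs0)
      _ = √c' * N * ‖x - y‖ := by ring
      _ ≤ _ := mul_le_mul_of_nonneg_right (by linarith) (norm_nonneg _)
  · have h := abs_trapezoid_le h1 h2 hM hpos (inner ℝ ν x + δ) (inner ℝ ν y + δ)
    have e : inner ℝ ν x + δ - (inner ℝ ν y + δ) = (inner ℝ ν (x - y) : ℝ) := by
      rw [inner_sub_right]; ring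
    have h3 := hin x y
    rw [e] at h h3
    calc _ ≤ 2 * c' * (N * ‖x - y‖) ^ 3 := h.trans (mul_le_mul_of_nonneg_left
          (pow_le_pow_left₀ (abs_nonneg _) h3 3) (by positivity))
      _ = 2 * c' * N ^ 3 * ‖x - y‖ ^ 3 := by ring
      _ ≤ _ := mul_le_mul_of_nonneg_right (by linarith) (by positivity)

end FZK

end

noncomputable section

namespace FZK

variable {n : ℕ}

/-! ### Integrable Fourier transforms -/

theorem toTD_apply (f : L2 n) (ψ : 𝓢(Rn n, ℂ)) :
    (Lp.toTemperedDistribution f : 𝓢'(Rn n, ℂ)) ψ = ∫ x, ψ x * f x := by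
  simp [Lp.toTemperedDistribution_apply]

theorem integral_schwartz_mul_fourier (f : L2 n) (ψ : 𝓢(Rn n, ℂ)) :
    ∫ x, ψ x * (𝓕 f : L2 n) x = ∫ x, (𝓕 ψ : 𝓢(Rn n, ℂ)) x * f x := by
  rw [← toTD_apply, ← toTD_apply, ← Lp.fourier_toTemperedDistribution_eq,
    TemperedDistribution.fourier_apply]

theorem integral_schwartz_mul_fourierInv (ψ : 𝓢(Rn n, ℂ)) {G : Rn n → ℂ}
    (hG : Integrable G volume) :
    ∫ x, ψ x * 𝓕⁻ G x = ∫ x, (𝓕⁻ ψ : 𝓢(Rn n, ℂ)) x * G x := by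
  have h := VectorFourier.integral_fourierIntegral_smul_eq_flip (L := innerₗ (Rn n))
    (μ := volume) (ν := volume) Real.continuous_fourierChar continuous_inner
    (f := fun x ↦ ψ (-x)) (g := G) ψ.integrable.comp_neg hG
  have hflip : (innerₗ (Rn n)).flip = innerₗ (Rn n) := flip_innerₗ _
  rw [hflip] at h
  have h1 : ∫ x, ψ x * 𝓕⁻ G x = ∫ x, ψ (-x) * 𝓕 G x := by
    rw [← integral_neg_eq_self]
    apply integral_congr_ae (ae_of_all _ fun x ↦ ?_)
    simp only [Real.fourierInv_eq_fourier_neg, neg_neg]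
  rw [h1, SchwartzMap.fourierInv_coe, Real.fourierInv_eq_fourier_comp_neg]
  exact h.symm

theorem ae_eq_of_integral_schwartz {f g : Rn n → ℂ} (hf : LocallyIntegrable f volume)
    (hg : LocallyIntegrable g volume)
    (h : ∀ ψ : 𝓢(Rn n, ℂ), HasCompactSupport ψ → ∫ x, ψ x * f x = ∫ x, ψ x * g x) : f =ᵐ[volume] g := by
  apply ae_eq_of_integral_contDiff_smul_eq hf hg
  intro ψ h1 h2
  have h3 : HasCompactSupport (fun x ↦ (ψ x : ℂ)) := h2.comp_left (g := fun x : ℝ ↦ (x : ℂ)) rfl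
  set Ψ := toS (fun x ↦ (ψ x : ℂ)) h3 (Complex.ofRealCLM.contDiff.comp h1) with hΨ
  have h4 : (Ψ : Rn n → ℂ) = fun x ↦ (ψ x : ℂ) := funext fun x ↦ toS_apply _ _ _ _
  have h5 := h Ψ (by rw [h4]; exact h3)
  simpa [h4] using h5

theorem locallyIntegrable_L2 (f : L2 n) : LocallyIntegrable f volume :=
  (Lp.memLp f).locallyIntegrable (by norm_num)

/-- An `L²` function that is pointwise the inverse Fourier integral of an integrable function has
this function as its Fourier transform. -/
theorem fourier_ae_eq_of_ae_eq_fourierInv {g : L2 n} {G : Rn n → ℂ} (hG : Integrable G volume)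
    (hg : g =ᵐ[volume] 𝓕⁻ G) : (𝓕 g : L2 n) =ᵐ[volume] G := by
  apply ae_eq_of_integral_schwartz (locallyIntegrable_L2 _) hG.locallyIntegrable
  intro ψ _
  rw [integral_schwartz_mul_fourier]
  have h1 : ∫ x, (𝓕 ψ : 𝓢(Rn n, ℂ)) x * g x = ∫ x, (𝓕 ψ : 𝓢(Rn n, ℂ)) x * 𝓕⁻ G x := by
    apply integral_congr_ae
    filter_upwards [hg] with x hx
    rw [hx]
  rw [h1, integral_schwartz_mul_fourierInv _ hG, FourierTransform.fourierInv_fourier_eq]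

/-- Fourier inversion for `L²` functions with integrable Fourier transform. -/
theorem ae_eq_fourierInv_fourier {f : L2 n} (hf : Integrable (𝓕 f : L2 n) volume) :
    f =ᵐ[volume] 𝓕⁻ ((𝓕 f : L2 n) : Rn n → ℂ) := by
  have hcont : Continuous (𝓕⁻ ((𝓕 f : L2 n) : Rn n → ℂ)) := by
    rw [Real.fourierInv_eq_fourier_comp_neg]
    exact VectorFourier.fourierIntegral_continuous Real.continuous_fourierChar continuous_inner
      hf.comp_neg
  apply ae_eq_of_integral_schwartz (locallyIntegrable_L2 _) hcont.locallyIntegrable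
  intro ψ _
  rw [integral_schwartz_mul_fourierInv _ hf, integral_schwartz_mul_fourier,
    FourierTransform.fourier_fourierInv_eq]

open scoped Convolution in
/-- The product of two functions with frequencies in a ball of radius `ρ` has frequencies in the
ball of radius `2ρ`. -/
theorem mult_mul_eq_zero {S : L2 n} {s : Rn n → ℂ} (hs : BddMeas s) (hS : S =ᵐ[volume] s) {ρ : ℝ}
    (hsupp : ∀ᵐ ξ, ρ < ‖ξ‖ → (𝓕 S : L2 n) ξ = 0) {m : Rn n → ℂ} (hm : BddMeas m)
    (hm0 : ∀ ξ, ‖ξ‖ ≤ 2 * ρ → m ξ = 0) : mult m (mulOp s S) = 0 := by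
  set F : Rn n → ℂ := ⇑(𝓕 S : L2 n) with hF
  have hFi : Integrable F volume := by
    have h1 : IntegrableOn F (Metric.closedBall 0 ρ) volume :=
      ((Lp.memLp (𝓕 S : L2 n)).locallyIntegrable (by norm_num)).integrableOn_isCompact
        (isCompact_closedBall _ _)
    refine (integrable_indicator_iff measurableSet_closedBall).2 h1 |>.congr ?_
    filter_upwards [hsupp] with ξ hξ
    by_cases h : ξ ∈ Metric.closedBall (0 : Rn n) ρ
    · rw [indicator_of_mem h]
    · rw [indicator_of_notMem h, hξ]
      simpa using h
  set G : Rn n → ℂ := F ⋆[ContinuousLinearMap.mul ℂ ℂ] F with hG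
  have hGi : Integrable G volume := hFi.integrable_convolution _ hFi
  have h1 : (mulOp s S : L2 n) =ᵐ[volume] 𝓕⁻ G := by
    filter_upwards [coeFn_mulOp hs S, hS, ae_eq_fourierInv_fourier hFi] with x h1 h2 h3
    rw [h1, ← h2, h3, Real.fourierInv_eq_fourier_neg, Real.fourierInv_eq_fourier_neg, hG,
      Real.fourier_mul_convolution_eq hFi hFi]
  have h2 := fourier_ae_eq_of_ae_eq_fourierInv hGi h1
  have h3 : ∀ ξ, 2 * ρ < ‖ξ‖ → G ξ = 0 := by
    intro ξ hξ
    rw [hG, convolution_def]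
    apply integral_eq_zero_of_ae
    have h4 : ∀ᵐ t, ρ < ‖ξ - t‖ → F (ξ - t) = 0 :=
      (Measure.measurePreserving_sub_left volume ξ).quasiMeasurePreserving.ae hsupp
    filter_upwards [hsupp, h4] with t h5 h6
    by_cases h7 : ρ < ‖t‖
    · simp [h5 h7]
    · have : ρ < ‖ξ - t‖ := by
        have := norm_sub_norm_le ξ t
        linarith
      simp [h6 this]
  apply fourier_injective
  apply Lp.ext
  have h0 : (𝓕 (0 : L2 n) : L2 n) = 0 := FourierTransform.fourier_zero
  rw [h0]
  filter_upwards [coeFn_fourier_mult hm (mulOp s S), h2, Lp.coeFn_zero ℂ 2 (volume : Measure (Rn n))]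
    with ξ h5 h6 h7
  rw [h5, h6, h7, Pi.zero_apply]
  by_cases h8 : ‖ξ‖ ≤ 2 * ρ
  · rw [hm0 ξ h8, zero_mul]
  · rw [h3 ξ (not_le.1 h8), mul_zero]

/-! ### Skew-adjoint multipliers and weights -/

theorem re_inner_self_symm (f g : L2 n) : (inner ℂ f g : ℂ).re = (inner ℂ g f : ℂ).re := by
  rw [← inner_conj_symm f g, Complex.conj_re]

/-- For a skew-adjoint multiplier, the weighted energy form is a commutator. -/
theorem two_mul_re_inner_skew {m : Rn n → ℂ} (hm : BddMeas m)
    (hskew : ∀ ξ, (starRingEnd ℂ) (m ξ) = -m ξ) {φ : Rn n → ℝ} (hφ : BddMeas fun x ↦ (φ x : ℂ))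
    (v : L2 n) :
    2 * (inner ℂ (mulOp (fun x ↦ (φ x : ℂ)) v) (mult m v) : ℂ).re =
      (inner ℂ v (mulOp (fun x ↦ (φ x : ℂ)) (mult m v)
        - mult m (mulOp (fun x ↦ (φ x : ℂ)) v)) : ℂ).re := by
  have h1 : (inner ℂ v (mult m (mulOp (fun x ↦ (φ x : ℂ)) v)) : ℂ) =
      -inner ℂ (mult m v) (mulOp (fun x ↦ (φ x : ℂ)) v) := by
    rw [inner_mult_right hm]
    simp_rw [hskew]
    have := mult_const_mul hm (-1) v
    simp only [neg_one_mul, neg_one_smul] at this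
    rw [this, inner_neg_left]
  rw [inner_sub_right, h1, inner_mulOp_real hφ, sub_neg_eq_add, Complex.add_re,
    re_inner_self_symm (mult m v)]
  ring

theorem re_inner_mult_real {r : Rn n → ℝ} (hr : BddMeas fun x ↦ (r x : ℂ)) (f : L2 n) :
    (inner ℂ f (mult (fun x ↦ (r x : ℂ)) f) : ℂ).re = ∫ ξ, r ξ * ‖(𝓕 f : L2 n) ξ‖ ^ 2 := by
  rw [← Lp.inner_fourier_eq, inner_eq_integral]
  have : ∫ ξ, (starRingEnd ℂ) ((𝓕 f : L2 n) ξ) * (𝓕 (mult (fun x ↦ (r x : ℂ)) f) : L2 n) ξ =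
      ∫ ξ, ((r ξ * ‖(𝓕 f : L2 n) ξ‖ ^ 2 : ℝ) : ℂ) := by
    apply integral_congr_ae
    filter_upwards [coeFn_fourier_mult hr f] with ξ h
    rw [h, mul_left_comm, Complex.conj_mul']
    push_cast
    rfl
  rw [this, integral_complex_ofReal, Complex.ofReal_re]

theorem integrable_bdd_mul_norm_sq {r : Rn n → ℝ} (hr : BddMeas fun x ↦ (r x : ℂ)) (f : L2 n) :
    Integrable (fun ξ ↦ r ξ * ‖f ξ‖ ^ 2) volume := by
  obtain ⟨h1, C, hC⟩ := hr
  have h2 : Measurable r := by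
    have := Complex.measurable_re.comp h1
    simpa [Function.comp_def] using this
  exact (integrable_norm_sq f).bdd_mul h2.aestronglyMeasurable
    (ae_of_all _ fun x ↦ by simpa using hC x)

/-- Gårding's inequality for multipliers: the form is negative up to frequencies where the symbol
`p` differs from `1`. -/
theorem re_inner_mult_le {r p : Rn n → ℝ} (hr : BddMeas fun x ↦ (r x : ℂ))
    (hp : BddMeas fun x ↦ (p x : ℂ)) {c C : ℝ}
    (h : ∀ ξ, r ξ ≤ -c + C * (1 - p ξ) ^ 2) (f : L2 n) :
    (inner ℂ f (mult (fun x ↦ (r x : ℂ)) f) : ℂ).re ≤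
      -c * ‖f‖ ^ 2 + C * ‖f - mult (fun x ↦ (p x : ℂ)) f‖ ^ 2 := by
  have hq : BddMeas fun x ↦ (1 : ℂ) - (p x : ℂ) := (BddMeas.const 1).sub hp
  have h1 : f - mult (fun x ↦ (p x : ℂ)) f = mult (fun x ↦ (1 : ℂ) - (p x : ℂ)) f := by
    rw [mult_sub_left (BddMeas.const 1) hp, mult_one]
  have hn : ∀ ξ, ‖(1 : ℂ) - (p ξ : ℂ)‖ ^ 2 = (1 - p ξ) ^ 2 := fun ξ ↦ by
    rw [← Complex.ofReal_one, ← Complex.ofReal_sub, Complex.norm_real, Real.norm_eq_abs, sq_abs]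
  have hq2 : BddMeas fun x ↦ (((1 - p x) ^ 2 : ℝ) : ℂ) := by
    have := hq.mul hq
    convert this using 2
    push_cast
    ring
  rw [h1, norm_mult_sq hq, re_inner_mult_real hr, ← Lp.norm_fourier_eq f, norm_sq_eq_integral,
    ← integral_const_mul, ← integral_const_mul, ← integral_add ((integrable_norm_sq _).const_mul _)]
  · apply integral_mono (integrable_bdd_mul_norm_sq hr _)
    · refine ((integrable_norm_sq _).const_mul _).add (Integrable.const_mul ?_ _)
      simp_rw [hn]
      exact integrable_bdd_mul_norm_sq hq2 _
    · intro ξ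
      have := mul_le_mul_of_nonneg_right (h ξ) (sq_nonneg ‖(𝓕 f : L2 n) ξ‖)
      simp only [hn]
      linarith
  · simp_rw [hn]
    exact (integrable_bdd_mul_norm_sq hq2 _).const_mul _

end FZK

end

noncomputable section

namespace FZK

variable {n : ℕ}

/-! ### Dyadic blocks -/

/-- The symbol `m` dilated to the frequency scale `2 ^ k`. -/
def dyad (k : ℕ) (m : 𝓢(Rn n, ℂ)) : 𝓢(Rn n, ℂ) := dil ((2 : ℝ) ^ k) (by positivity) m

theorem dyad_apply (k : ℕ) (m : 𝓢(Rn n, ℂ)) (ξ : Rn n) :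
    dyad k m ξ = m (((2 : ℝ) ^ k)⁻¹ • ξ) := rfl

theorem mom_dyad (j k : ℕ) (m : 𝓢(Rn n, ℂ)) :
    mom j (dyad k m) = (((2 : ℝ) ^ k) ^ j)⁻¹ * mom j m := mom_dil (by positivity) j m

/-- The `k`-th dyadic block of an `L²` function. -/
def blk (k : ℕ) : L2 n →L[ℂ] L2 n := mult (dyad k annSym)

/-- The part of an `L²` function well below the frequency scale `2 ^ k`. -/
def lowPart (k : ℕ) : L2 n →L[ℂ] L2 n := mult (dil ((2 : ℝ) ^ k / 8) (by positivity) lowSym)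

theorem annReal_mul_fatReal (ξ : Rn n) : fatReal ξ * annReal ξ = annReal ξ := by
  by_cases h : ‖ξ‖ ≤ 1
  · rw [annReal_eq_zero_of_le h, mul_zero]
  by_cases h2 : 4 ≤ ‖ξ‖
  · rw [annReal_eq_zero_of_ge h2, mul_zero]
  · rw [fatReal_eq_one (by linarith) (by linarith), one_mul]

theorem mult_fat_blk (k : ℕ) (f : L2 n) : mult (dyad k fatSym) (blk k f) = blk k f := by
  rw [blk, mult_mult (bddMeas_schwartz _) (bddMeas_schwartz _)]
  congr 2
  ext ξ
  rw [dyad_apply, dyad_apply, fatSym_apply, annSym_apply, ← Complex.ofReal_mul,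
    annReal_mul_fatReal]

theorem re_inner_le (f g : L2 n) : (inner ℂ f g : ℂ).re ≤ ‖f‖ * ‖g‖ :=
  (Complex.re_le_norm _).trans (norm_inner_le_norm f g)

theorem Weight.bdd {ν : Rn n} {Λ : ℝ} {φ g : Rn n → ℝ} (h : Weight ν Λ φ g) :
    BddMeas fun x ↦ (φ x : ℂ) :=
  ⟨Complex.measurable_ofReal.comp h.cont.measurable, Λ, fun x ↦ by simpa using h.abs_le x⟩

theorem Weight.bdd_sqrt {ν : Rn n} {Λ : ℝ} {φ g : Rn n → ℝ} (h : Weight ν Λ φ g) :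
    BddMeas fun x ↦ (g x : ℂ) :=
  ⟨Complex.measurable_ofReal.comp h.cont_sqrt.measurable, Λ, fun x ↦ by simpa using h.abs_sqrt_le x⟩

theorem Weight.nonneg {ν : Rn n} {Λ : ℝ} {φ g : Rn n → ℝ} (h : Weight ν Λ φ g) : 0 ≤ Λ :=
  (abs_nonneg _).trans (h.abs_le 0)

variable [NeZero n]

/-! ### The dispersive term -/

theorem exists_dispDerivSym_le {α : ℝ} (hα : 0 < α) {ν : Rn n} {c₀ : ℝ} (hc₀ : 0 < c₀)
    (hform : ∀ ξ : Rn n, c₀ * ‖ξ‖ ^ 2 ≤ ν 0 * ‖ξ‖ ^ 2 + α * ξ 0 * inner ℝ ν ξ) :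
    ∃ c C : ℝ, 0 < c ∧ 0 ≤ C ∧ ∀ ξ : Rn n,
      -(fderiv ℝ (dispReal α) ξ ν) ≤ -c + C * (1 - fatReal ξ) ^ 2 := by
  obtain ⟨-, M, hM⟩ := bddMeas_schwartz (dispDerivSym α ν)
  have hM0 : 0 ≤ M := (norm_nonneg _).trans (hM 0)
  set c := (2 * Real.pi) ^ α * c₀ * (1 / 2) ^ α with hc
  have hcpos : 0 < c := by positivity
  refine ⟨c, M + c, hcpos, by linarith, fun ξ ↦ ?_⟩
  by_cases h : 1 / 2 < ‖ξ‖ ∧ ‖ξ‖ < 8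
  · have hξ : 0 < ‖ξ‖ := by linarith [h.1]
    rw [fderiv_dispReal α ν (by linarith [h.1]) (by linarith [h.2])]
    have e2 : ‖ξ‖ ^ α = ‖ξ‖ ^ (α - 2) * ‖ξ‖ ^ 2 := by
      rw [← Real.rpow_natCast, ← Real.rpow_add hξ]
      norm_num
    have h3 : (1 / 2 : ℝ) ^ α ≤ ‖ξ‖ ^ α := Real.rpow_le_rpow (by norm_num) h.1.le hα.le
    have h4 : c ≤ (2 * Real.pi) ^ α * ‖ξ‖ ^ (α - 2) *
        (ν 0 * ‖ξ‖ ^ 2 + α * ξ 0 * inner ℝ ν ξ) := by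
      calc c ≤ (2 * Real.pi) ^ α * c₀ * ‖ξ‖ ^ α := by rw [hc]; gcongr
        _ = (2 * Real.pi) ^ α * ‖ξ‖ ^ (α - 2) * (c₀ * ‖ξ‖ ^ 2) := by rw [e2]; ring
        _ ≤ _ := by gcongr; exact hform ξ
    nlinarith [sq_nonneg (1 - fatReal ξ)]
  · have h0 : fatReal ξ = 0 := by
      rw [not_and_or, not_lt, not_lt] at h
      exact h.elim fatReal_eq_zero_of_le fatReal_eq_zero_of_ge
    have h1 := hM ξ
    rw [dispDerivSym_apply, Complex.norm_real, Real.norm_eq_abs] at h1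
    rw [h0]
    linarith [(le_abs_self _).trans h1]

theorem ker_dyad_dispDerivSym (α : ℝ) (ν : Rn n) (k : ℕ) (z : Rn n) :
    ker (((((2 : ℝ) ^ k)⁻¹ : ℝ) : ℂ) • dyad k (dispDerivSym α ν)) z =
      (inner ℝ ν z : ℝ) * ker (dyad k (dispSym α)) z := by
  have hR : (0 : ℝ) < 2 ^ k := by positivity
  have h : ∀ (c : ℂ) (m : 𝓢(Rn n, ℂ)) z, ker (c • m) z = c * ker m z := fun c m z ↦ by
    simp [ker, FourierTransform.fourierInv_smul]
  rw [h, dyad, dyad, ker_dil hR, ker_dil hR, ker_dispDerivSym, inner_smul_right]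
  push_cast
  field_simp

/-- The smoothing effect of the dispersion on one dyadic block. -/
theorem exists_dispersive_le {α : ℝ} (hα : 0 < α) {ν : Rn n} {c₀ : ℝ} (hc₀ : 0 < c₀)
    (hform : ∀ ξ : Rn n, c₀ * ‖ξ‖ ^ 2 ≤ ν 0 * ‖ξ‖ ^ 2 + α * ξ 0 * inner ℝ ν ξ) (Λ : ℝ) :
    ∃ c C : ℝ, 0 < c ∧ 0 ≤ C ∧ ∀ φ g : Rn n → ℝ, Weight ν Λ φ g → ∀ (k : ℕ) (f : L2 n),
      2 * (2 : ℝ) ^ k * (inner ℂ (mulOp (fun x ↦ (φ x : ℂ)) (blk k f))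
        (mult (dyad k (dispSym α)) (blk k f)) : ℂ).re ≤
      -c * ‖mulOp (fun x ↦ (g x : ℂ)) (blk k f)‖ ^ 2 + C * ((2 : ℝ) ^ k)⁻¹ ^ 2 * ‖blk k f‖ ^ 2 := by
  obtain ⟨c, C, hc, hC, hsym⟩ := exists_dispDerivSym_le hα hc₀ hform
  refine ⟨c, C * (Λ * mom 1 (fatSym : 𝓢(Rn n, ℂ))) ^ 2 + |Λ| * mom 3 (dispSym α : 𝓢(Rn n, ℂ)), hc,
    by have := mom_nonneg 3 (dispSym α : 𝓢(Rn n, ℂ)); positivity, ?_⟩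
  intro φ g hw k f
  set R : ℝ := 2 ^ k with hRdef
  have hR : 0 < R := by positivity
  set v := blk k f with hv
  set gv := mulOp (fun x ↦ (g x : ℂ)) v with hgv
  set A := dyad k (dispSym α : 𝓢(Rn n, ℂ)) with hA
  set b : 𝓢(Rn n, ℂ) := ((R⁻¹ : ℝ) : ℂ) • dyad k (dispDerivSym α ν) with hb
  set r : Rn n → ℝ := fun ξ ↦ R⁻¹ * -(fderiv ℝ (dispReal α) (R⁻¹ • ξ) ν) with hr
  have hbr : (b : Rn n → ℂ) = fun ξ ↦ (r ξ : ℂ) := by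
    ext ξ
    have : b ξ = ((R⁻¹ : ℝ) : ℂ) * dyad k (dispDerivSym α ν) ξ := rfl
    rw [this, dyad_apply, dispDerivSym_apply, ← Complex.ofReal_mul]
  have hbdd : BddMeas fun ξ ↦ (r ξ : ℂ) := hbr ▸ bddMeas_schwartz b
  have hskew : ∀ ξ, (starRingEnd ℂ) (A ξ) = -A ξ := fun ξ ↦ by
    rw [hA, dyad_apply, dispSym_apply]
    simp [Complex.conj_ofNat]
  have h1 := two_mul_re_inner_skew (bddMeas_schwartz A) hskew hw.bdd v
  set D := mulOp (fun x ↦ (φ x : ℂ)) (mult A v) - mult A (mulOp (fun x ↦ (φ x : ℂ)) v) with hD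
  have h2 : ‖D - mulOp (fun x ↦ (g x : ℂ)) (mult b gv)‖ ≤ Λ * mom 3 A * ‖v‖ := by
    refine norm_commutator_sub_symm_le A b (ker_dyad_dispDerivSym α ν k) hw.bdd hw.bdd_sqrt
      (fun x y ↦ ?_) v
    have := hw.cubic x y
    rw [← Real.norm_eq_abs, ← Complex.norm_real] at this
    push_cast at this
    exact this
  -- the self-adjoint factor `g` moves to the other side of the inner product
  have h3 : (inner ℂ v D : ℂ).re ≤ (inner ℂ gv (mult b gv) : ℂ).re + Λ * mom 3 A * ‖v‖ ^ 2 := by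
    have e : D = mulOp (fun x ↦ (g x : ℂ)) (mult b gv) +
        (D - mulOp (fun x ↦ (g x : ℂ)) (mult b gv)) := by abel
    rw [e, inner_add_right, Complex.add_re, inner_mulOp_real hw.bdd_sqrt, ← hgv]
    have := (re_inner_le v (D - mulOp (fun x ↦ (g x : ℂ)) (mult b gv))).trans
      (mul_le_mul_of_nonneg_left h2 (norm_nonneg v))
    linarith
  set p : Rn n → ℝ := fun ξ ↦ fatReal (R⁻¹ • ξ) with hp
  have hpf : (dyad k fatSym : 𝓢(Rn n, ℂ)) = fun ξ ↦ (p ξ : ℂ) := by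
    ext ξ
    rw [dyad_apply, fatSym_apply]
  -- `g v` is not localised in frequency, so that the symbol is definite on it only up to the part of
  -- `g v` outside the annulus, which is a commutator because `v` is localised
  have h4 := re_inner_mult_le hbdd (hpf ▸ bddMeas_schwartz (dyad k fatSym)) (c := R⁻¹ * c)
    (C := R⁻¹ * C) (fun ξ ↦ by
      have := mul_le_mul_of_nonneg_left (hsym (R⁻¹ • ξ)) (inv_nonneg.2 hR.le)
      rw [hr, hp]
      linarith) gv
  rw [← hbr, ← hpf] at h4
  have h5 : ‖gv - mult (dyad k fatSym) gv‖ ≤ Λ * mom 1 (dyad k fatSym : 𝓢(Rn n, ℂ)) * ‖v‖ := by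
    have := norm_commutator_le (dyad k fatSym) hw.bdd_sqrt (Λ := Λ) (fun x y ↦ by
      rw [← Complex.ofReal_sub, Complex.norm_real]
      exact hw.lip_sqrt x y) v
    rwa [hv, mult_fat_blk, ← hv, ← hgv] at this
  have h6 : ‖gv - mult (dyad k fatSym) gv‖ ^ 2 ≤
      (Λ * mom 1 (dyad k fatSym : 𝓢(Rn n, ℂ)) * ‖v‖) ^ 2 := pow_le_pow_left₀ (norm_nonneg _) h5 2
  rw [mom_dyad, ← hRdef] at h6
  rw [hA, mom_dyad, ← hRdef] at h3
  have h7 : Λ = |Λ| := (abs_of_nonneg hw.nonneg).symm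
  rw [← h7]
  calc 2 * R * (inner ℂ (mulOp (fun x ↦ (φ x : ℂ)) v) (mult A v) : ℂ).re
      = R * (inner ℂ v D : ℂ).re := by rw [← h1]; ring
    _ ≤ R * (-(R⁻¹ * c) * ‖gv‖ ^ 2 + R⁻¹ * C *
        (Λ * ((R ^ 1)⁻¹ * mom 1 (fatSym : 𝓢(Rn n, ℂ))) * ‖v‖) ^ 2
        + Λ * ((R ^ 3)⁻¹ * mom 3 (dispSym α : 𝓢(Rn n, ℂ))) * ‖v‖ ^ 2) := by
        apply mul_le_mul_of_nonneg_left _ hR.le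
        have : R⁻¹ * C * ‖gv - mult (dyad k fatSym) gv‖ ^ 2 ≤ R⁻¹ * C *
          (Λ * ((R ^ 1)⁻¹ * mom 1 (fatSym : 𝓢(Rn n, ℂ))) * ‖v‖) ^ 2 :=
          mul_le_mul_of_nonneg_left h6 (by positivity)
        linarith
    _ = _ := by
        field_simp
        ring

end FZK

end

noncomputable section

namespace FZK

variable {n : ℕ}

/-! ### The nonlinear term -/

theorem conj_ker_of_even {m : 𝓢(Rn n, ℂ)} (hm : ∀ ξ, (starRingEnd ℂ) (m (-ξ)) = m ξ) (z : Rn n) :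
    (starRingEnd ℂ) (ker m z) = ker m z := by
  rw [ker, SchwartzMap.fourierInv_coe, Real.fourierInv_eq', ← integral_conj,
    ← integral_neg_eq_self]
  congr 1
  ext ξ
  rw [smul_eq_mul, smul_eq_mul, map_mul, hm, ← Complex.exp_conj]
  simp [Complex.conj_ofNat]

theorem integral_ker (m : 𝓢(Rn n, ℂ)) : ∫ z, ker m z = m 0 := by
  have h : (𝓕 (𝓕⁻ m : 𝓢(Rn n, ℂ)) : 𝓢(Rn n, ℂ)) 0 = m 0 := by
    rw [FourierTransform.fourier_fourierInv_eq]
  rw [← h, SchwartzMap.fourier_coe, Real.fourier_eq]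
  simp [ker]

/-- The pointwise values of the low-frequency part of a bounded real function. The real part is
harmless, since the kernel of an even real symbol is real. -/
def lowFun (k : ℕ) (U : Rn n → ℝ) (x : Rn n) : ℝ :=
  ∫ z, (ker (dil ((2 : ℝ) ^ k / 8) (by positivity) lowSym) z).re * U (x - z)

section lowFun

variable (k : ℕ) {U : Rn n → ℝ} {B ℓ : ℝ}

theorem ker_low_real (z : Rn n) :
    ((ker (dil ((2 : ℝ) ^ k / 8) (by positivity) lowSym) z).re : ℂ) =
      ker (dil ((2 : ℝ) ^ k / 8) (by positivity) lowSym) z := by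
  rw [← Complex.conj_eq_iff_re]
  apply conj_ker_of_even
  intro ξ
  rw [dil_apply, dil_apply, lowSym_apply, lowSym_apply, Complex.conj_ofReal, smul_neg, bump_neg]

theorem abs_ker_low (z : Rn n) :
    |(ker (dil ((2 : ℝ) ^ k / 8) (by positivity) lowSym) z).re| =
      ‖ker (dil ((2 : ℝ) ^ k / 8) (by positivity) lowSym) z‖ := by
  conv_rhs => rw [← ker_low_real, Complex.norm_real, Real.norm_eq_abs]

theorem mom_zero_low : mom 0 (dil ((2 : ℝ) ^ k / 8) (by positivity) (lowSym : 𝓢(Rn n, ℂ))) =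
    mom 0 (lowSym : 𝓢(Rn n, ℂ)) := by
  rw [mom_dil (by positivity)]
  simp

theorem mom_one_low : mom 1 (dil ((2 : ℝ) ^ k / 8) (by positivity) (lowSym : 𝓢(Rn n, ℂ))) =
    8 * ((2 : ℝ) ^ k)⁻¹ * mom 1 (lowSym : 𝓢(Rn n, ℂ)) := by
  rw [mom_dil (by positivity), pow_one, inv_div]
  ring

theorem integrable_ker_low_mul (hU : Continuous U) (hB : ∀ x, |U x| ≤ B) (x : Rn n) :
    Integrable (fun z ↦ (ker (dil ((2 : ℝ) ^ k / 8) (by positivity) lowSym) z).re * U (x - z))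
      volume := by
  refine (ker_integrable _).re.mul_bdd (c := B) ?_ (ae_of_all _ fun z ↦ hB _)
  exact (hU.comp (continuous_const.sub continuous_id)).aestronglyMeasurable

theorem abs_integral_ker_mul_le {m : 𝓢(Rn n, ℂ)} {κ F : Rn n → ℝ} (hκ : ∀ z, |κ z| = ‖ker m z‖)
    {C : ℝ} {j : ℕ} (hF : ∀ z, |F z| ≤ C * ‖z‖ ^ j) : |∫ z, κ z * F z| ≤ C * mom j m := by
  rw [mom, ← integral_const_mul, ← Real.norm_eq_abs]
  refine norm_integral_le_of_norm_le ((mom_integrable j m).const_mul C) (ae_of_all _ fun z ↦ ?_)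
  rw [Real.norm_eq_abs, abs_mul, hκ]
  calc _ ≤ ‖ker m z‖ * (C * ‖z‖ ^ j) := mul_le_mul_of_nonneg_left (hF z) (norm_nonneg _)
    _ = _ := by ring

theorem abs_lowFun_le (hB : ∀ x, |U x| ≤ B) (x : Rn n) :
    |lowFun k U x| ≤ B * mom 0 (lowSym : 𝓢(Rn n, ℂ)) := by
  have := abs_integral_ker_mul_le (abs_ker_low k) (F := fun z ↦ U (x - z)) (C := B) (j := 0)
    (fun z ↦ by simpa using hB (x - z))
  rwa [mom_zero_low] at this

theorem abs_lowFun_sub_le (hU : Continuous U) (hB : ∀ x, |U x| ≤ B)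
    (hℓ : ∀ x y, |U x - U y| ≤ ℓ * ‖x - y‖) (x y : Rn n) :
    |lowFun k U x - lowFun k U y| ≤ ℓ * mom 0 (lowSym : 𝓢(Rn n, ℂ)) * ‖x - y‖ := by
  have := abs_integral_ker_mul_le (abs_ker_low k) (F := fun z ↦ U (x - z) - U (y - z))
    (C := ℓ * ‖x - y‖) (j := 0) (fun z ↦ by simpa using hℓ (x - z) (y - z))
  simp_rw [mul_sub] at this
  rw [integral_sub (integrable_ker_low_mul k hU hB x) (integrable_ker_low_mul k hU hB y),
    mom_zero_low] at this
  calc _ ≤ _ := this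
    _ = _ := by ring

theorem lowFun_continuous (hU : Continuous U) (hB : ∀ x, |U x| ≤ B)
    (hℓ : ∀ x y, |U x - U y| ≤ ℓ * ‖x - y‖) : Continuous (lowFun k U) :=
  (LipschitzWith.of_dist_le' fun x y ↦ by
    rw [Real.dist_eq, dist_eq_norm]
    exact abs_lowFun_sub_le k hU hB hℓ x y).continuous

theorem abs_sub_lowFun_le (hU : Continuous U) (hB : ∀ x, |U x| ≤ B)
    (hℓ : ∀ x y, |U x - U y| ≤ ℓ * ‖x - y‖) (x : Rn n) :
    |U x - lowFun k U x| ≤ ℓ * (8 * ((2 : ℝ) ^ k)⁻¹ * mom 1 (lowSym : 𝓢(Rn n, ℂ))) := by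
  have h1 := abs_integral_ker_mul_le (abs_ker_low k) (F := fun z ↦ U x - U (x - z))
    (C := ℓ) (j := 1) (fun z ↦ by simpa using hℓ x (x - z))
  have h2 : ∫ z, (ker (dil ((2 : ℝ) ^ k / 8) (by positivity) (lowSym : 𝓢(Rn n, ℂ))) z).re = 1 := by
    apply Complex.ofReal_injective
    rw [← integral_complex_ofReal]
    simp_rw [ker_low_real]
    rw [integral_ker, dil_apply, smul_zero, lowSym_apply, bump_eq_one (by simp)]
  simp_rw [mul_sub] at h1
  have h3 : Integrable (fun z ↦ (ker (dil ((2 : ℝ) ^ k / 8) (by positivity)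
      (lowSym : 𝓢(Rn n, ℂ))) z).re * U x) volume := (ker_integrable _).re.mul_const _
  rw [integral_sub h3 (integrable_ker_low_mul k hU hB x),
    integral_mul_const, mom_one_low, h2, one_mul] at h1
  exact h1

theorem lowPart_ae_eq_lowFun {f : L2 n} (hf : f =ᵐ[volume] fun x ↦ (U x : ℂ)) :
    lowPart k f =ᵐ[volume] fun x ↦ (lowFun k U x : ℂ) := by
  filter_upwards [mult_eq_integral_ker (dil ((2 : ℝ) ^ k / 8) (by positivity) lowSym) f] with x hx
  rw [lowPart, hx, lowFun, ← integral_complex_ofReal,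
    ← integral_sub_left_eq_self _ volume x]
  apply integral_congr_ae
  have h := (Measure.measurePreserving_sub_left (volume : Measure (Rn n)) x).quasiMeasurePreserving.ae
    hf
  filter_upwards [h] with z hz
  rw [hz, sub_sub_cancel, Complex.ofReal_mul, ker_low_real]

end lowFun

theorem BddMeas.ofReal {a : Rn n → ℝ} (ha : Continuous a) {C : ℝ} (h : ∀ x, |a x| ≤ C) :
    BddMeas fun x ↦ (a x : ℂ) :=
  ⟨Complex.measurable_ofReal.comp ha.measurable, C, fun x ↦ by simpa using h x⟩

variable [NeZero n]

/-- High frequencies only see products with a factor of comparable frequency. -/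
theorem mult_dann_mul_lowPart (k : ℕ) {f : L2 n} {s : Rn n → ℂ} (hs : BddMeas s)
    (hS : lowPart k f =ᵐ[volume] s) : mult (dyad k dannSym) (mulOp s (lowPart k f)) = 0 := by
  refine mult_mul_eq_zero hs hS (ρ := 2 ^ k / 4) ?_ (bddMeas_schwartz _) ?_
  · filter_upwards [coeFn_fourier_mult
      (bddMeas_schwartz (dil ((2 : ℝ) ^ k / 8) (by positivity) lowSym)) f] with ξ hξ h
    rw [lowPart, hξ, dil_apply, lowSym_apply, bump_eq_zero, Complex.ofReal_zero, zero_mul]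
    rw [norm_smul_pos (by positivity), inv_div]
    have h2 : 2 ≤ 8 / 2 ^ k * ‖ξ‖ := by
      rw [div_mul_eq_mul_div, le_div_iff₀ (by positivity)]
      linarith
    nlinarith
  · intro ξ hξ
    rw [dyad_apply, dannSym_apply, annReal_eq_zero_of_le, Complex.ofReal_zero, mul_zero]
    rw [norm_smul_pos (by positivity), inv_mul_le_iff₀ (by positivity)]
    have : (0 : ℝ) < 2 ^ k := by positivity
    linarith

theorem mult_dann_lowPart (k : ℕ) (f : L2 n) : mult (dyad k dannSym) (lowPart k f) = 0 := by
  rw [lowPart, mult_mult (bddMeas_schwartz _) (bddMeas_schwartz _)]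
  have : (fun x ↦ dyad k dannSym x * dil ((2 : ℝ) ^ k / 8) (by positivity) lowSym x) =
      fun _ : Rn n ↦ (0 : ℂ) * 1 := by
    ext ξ
    rw [dyad_apply, dil_apply, dannSym_apply, lowSym_apply, zero_mul]
    by_cases h : ‖((2 : ℝ) ^ k)⁻¹ • ξ‖ ≤ 1
    · rw [annReal_eq_zero_of_le h]; simp
    · rw [bump_eq_zero]
      · simp
      · rw [inv_div, div_eq_mul_inv, mul_smul, norm_smul_pos (by norm_num)]
        nlinarith
  rw [this, mult_const_mul (BddMeas.const 1), zero_smul]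

theorem mult_dann_eq (k : ℕ) (f : L2 n) :
    mult (dyad k dannSym) f = mult (dyad k dfatSym) (blk k f) := by
  rw [blk, mult_mult (bddMeas_schwartz _) (bddMeas_schwartz _)]
  congr 2
  ext ξ
  rw [dyad_apply, dyad_apply, dyad_apply, dannSym_apply, dfatSym_apply, annSym_apply, mul_assoc,
    ← Complex.ofReal_mul, annReal_mul_fatReal]

/-- The transport part of the nonlinearity is a commutator of the skew-adjoint operator `∂_{x₁}`,
cut off in frequency, with the product of the two weights. -/
theorem abs_transport_le {ν : Rn n} {Λ : ℝ} {φ g : Rn n → ℝ} (hw : Weight ν Λ φ g) (k : ℕ)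
    {s : Rn n → ℝ} {B ℓ m0 : ℝ} (hB0 : 0 ≤ B) (hℓ0 : 0 ≤ ℓ) (hsc : Continuous s)
    (hsb : ∀ x, |s x| ≤ B * m0) (hsl : ∀ x y, |s x - s y| ≤ ℓ * m0 * ‖x - y‖) (hm0 : 0 ≤ m0)
    (v : L2 n) :
    |2 * (inner ℂ (mulOp (fun x ↦ (φ x : ℂ)) v)
      (mulOp (fun x ↦ (s x : ℂ)) (mult (dyad k dfatSym) v)) : ℂ).re| ≤
      Λ * m0 * (B + ℓ) * (((2 : ℝ) ^ k)⁻¹ * mom 1 (dfatSym : 𝓢(Rn n, ℂ))) * ‖v‖ ^ 2 := by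
  have hΛ := hw.nonneg
  have hsB : BddMeas fun x ↦ (s x : ℂ) := .ofReal hsc hsb
  have hsφc : Continuous fun x ↦ s x * φ x := hsc.mul hw.cont
  have hsφB : BddMeas fun x ↦ ((s x * φ x : ℝ) : ℂ) :=
    .ofReal hsφc (C := B * m0 * Λ) fun x ↦ by
      rw [abs_mul]
      exact mul_le_mul (hsb x) (hw.abs_le x) (abs_nonneg _) (by positivity)
  have hsφl : ∀ x y, ‖((s x * φ x : ℝ) : ℂ) - ((s y * φ y : ℝ) : ℂ)‖ ≤
      Λ * m0 * (B + ℓ) * ‖x - y‖ := by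
    intro x y
    rw [← Complex.ofReal_sub, Complex.norm_real, Real.norm_eq_abs]
    have e : s x * φ x - s y * φ y = (s x - s y) * φ x + s y * (φ x - φ y) := by ring
    rw [e]
    refine (abs_add_le _ _).trans ?_
    rw [abs_mul, abs_mul]
    have h1 := mul_le_mul (hsl x y) (hw.abs_le x) (abs_nonneg _) (by positivity)
    have h2 := mul_le_mul (hsb y) (hw.lip x y) (abs_nonneg _) (by positivity)
    linarith
  have h1 : mulOp (fun x ↦ (s x : ℂ)) (mulOp (fun x ↦ (φ x : ℂ)) v) =
      mulOp (fun x ↦ ((s x * φ x : ℝ) : ℂ)) v := by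
    rw [mulOp_mulOp hsB hw.bdd]
    congr 2
    ext x
    push_cast
    rfl
  have hskew : ∀ ξ : Rn n, (starRingEnd ℂ) (dyad k dfatSym ξ) = -dyad k dfatSym ξ := fun ξ ↦ by
    rw [dyad_apply, dfatSym_apply, map_mul, conj_dsym, Complex.conj_ofReal, neg_mul]
  rw [inner_mulOp_real hsB, h1, two_mul_re_inner_skew (bddMeas_schwartz _) hskew hsφB]
  have h2 := norm_commutator_le (dyad k dfatSym) hsφB hsφl v
  rw [mom_dyad, pow_one] at h2
  calc _ ≤ _ := Complex.abs_re_le_norm _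
    _ ≤ _ := norm_inner_le_norm _ _
    _ ≤ ‖v‖ * (Λ * m0 * (B + ℓ) * (((2 : ℝ) ^ k)⁻¹ * mom 1 (dfatSym : 𝓢(Rn n, ℂ))) * ‖v‖) :=
      mul_le_mul_of_nonneg_left h2 (norm_nonneg v)
    _ = _ := by ring

set_option maxHeartbeats 1000000 in
/-- The nonlinear term on one dyadic block: no derivative is lost, at the cost of the supremum and
Lipschitz constant of the function. -/
theorem exists_nonlinear_le (ν : Rn n) (Λ : ℝ) :
    ∃ C : ℝ, 0 ≤ C ∧ ∀ φ g : Rn n → ℝ, Weight ν Λ φ g → ∀ (k : ℕ) (U : Rn n → ℝ) (B ℓ : ℝ),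
      Continuous U → (∀ x, |U x| ≤ B) → (∀ x y, |U x - U y| ≤ ℓ * ‖x - y‖) →
      ∀ f q : L2 n, f =ᵐ[volume] (fun x ↦ (U x : ℂ)) → q =ᵐ[volume] (fun x ↦ ((U x ^ 2 : ℝ) : ℂ)) →
      (2 : ℝ) ^ k * |(inner ℂ (mulOp (fun x ↦ (φ x : ℂ)) (blk k f))
        (mult (dyad k dannSym) q) : ℂ).re| ≤
      C * (B + ℓ) * (‖blk k f‖ ^ 2 + ‖f - lowPart k f‖ ^ 2) := by
  obtain ⟨hqm, M, hM⟩ := bddMeas_schwartz (dannSym : 𝓢(Rn n, ℂ))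
  have hM0 : 0 ≤ M := (norm_nonneg _).trans (hM 0)
  set m0 := mom 0 (lowSym : 𝓢(Rn n, ℂ)) with hm0
  set m1 := mom 1 (lowSym : 𝓢(Rn n, ℂ)) with hm1
  set d1 := mom 1 (dfatSym : 𝓢(Rn n, ℂ)) with hd1
  set e1 := mom 1 (dannSym : 𝓢(Rn n, ℂ)) with he1
  have hm0' : 0 ≤ m0 := mom_nonneg _ _
  have hm1' : 0 ≤ m1 := mom_nonneg _ _
  have hd1' : 0 ≤ d1 := mom_nonneg _ _
  have he1' : 0 ≤ e1 := mom_nonneg _ _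
  refine ⟨|Λ| * (m0 * d1 + 2 * m0 * e1 + 8 * M * m1), by positivity, ?_⟩
  intro φ g hw k U B ℓ hU hB hℓ f q hf hq
  have hΛ := hw.nonneg
  rw [abs_of_nonneg hΛ]
  have hB0 : 0 ≤ B := (abs_nonneg _).trans (hB 0)
  have hℓ0 : 0 ≤ ℓ := by
    have := (abs_nonneg _).trans (hℓ (EuclideanSpace.single 0 1) 0)
    simpa using this
  set R : ℝ := 2 ^ k with hRdef
  have hR : 0 < R := by positivity
  set v := blk k f with hv
  set S := lowPart k f with hSdef
  set w := f - S with hwdef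
  set s := lowFun k U with hs
  set Q := mult (dyad k dannSym : 𝓢(Rn n, ℂ)) with hQ
  set φv := mulOp (fun x ↦ (φ x : ℂ)) v with hφv
  have hsb : ∀ x, |s x| ≤ B * m0 := abs_lowFun_le k hB
  have hsl : ∀ x y, |s x - s y| ≤ ℓ * m0 * ‖x - y‖ := abs_lowFun_sub_le k hU hB hℓ
  have hsc : Continuous s := lowFun_continuous k hU hB hℓ
  have hsB : BddMeas fun x ↦ (s x : ℂ) := .ofReal hsc hsb
  have hwb : ∀ x, |U x - s x| ≤ ℓ * (8 * R⁻¹ * m1) := abs_sub_lowFun_le k hU hB hℓ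
  have hwB : BddMeas fun x ↦ ((U x - s x : ℝ) : ℂ) := .ofReal (hU.sub hsc) hwb
  have hS : S =ᵐ[volume] fun x ↦ (s x : ℂ) := lowPart_ae_eq_lowFun k hf
  have hw' : w =ᵐ[volume] fun x ↦ ((U x - s x : ℝ) : ℂ) := by
    filter_upwards [Lp.coeFn_sub f S, hf, hS] with x h1 h2 h3
    rw [hwdef, h1, Pi.sub_apply, h2, h3, Complex.ofReal_sub]
  -- `q = s² + 2 s w + w²`, written with the factor to be estimated in `L^∞` as a multiplication operator
  have hdec : q = mulOp (fun x ↦ (s x : ℂ)) S + (2 : ℂ) • mulOp (fun x ↦ (s x : ℂ)) w +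
      mulOp (fun x ↦ ((U x - s x : ℝ) : ℂ)) w := by
    apply Lp.ext
    filter_upwards [hq, hS, hw', coeFn_mulOp hsB S, coeFn_mulOp hsB w, coeFn_mulOp hwB w,
      Lp.coeFn_add (mulOp (fun x ↦ (s x : ℂ)) S + (2 : ℂ) • mulOp (fun x ↦ (s x : ℂ)) w)
        (mulOp (fun x ↦ ((U x - s x : ℝ) : ℂ)) w),
      Lp.coeFn_add (mulOp (fun x ↦ (s x : ℂ)) S) ((2 : ℂ) • mulOp (fun x ↦ (s x : ℂ)) w),
      Lp.coeFn_smul (2 : ℂ) (mulOp (fun x ↦ (s x : ℂ)) w)] with x h1 h2 h3 h4 h5 h6 h7 h8 h9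
    rw [h7, Pi.add_apply, h8, Pi.add_apply, h9, Pi.smul_apply, h1, h4, h5, h6, h2, h3]
    push_cast
    rw [smul_eq_mul]
    ring
  -- the two factors of `s²` are of too low frequency to reach the annulus of the block
  have hQS : Q (mulOp (fun x ↦ (s x : ℂ)) S) = 0 := mult_dann_mul_lowPart k hsB hS
  have hQw : Q w = mult (dyad k dfatSym) v := by
    rw [hwdef, map_sub, hQ, mult_dann_lowPart, sub_zero, mult_dann_eq]
  -- pulling `s` out of `Q (s w)` turns `Q w` into `∂_{x₁}` of the block itself
  set E := mulOp (fun x ↦ (s x : ℂ)) (Q w) - Q (mulOp (fun x ↦ (s x : ℂ)) w) with hE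
  have hQq : Q q = (2 : ℂ) • (mulOp (fun x ↦ (s x : ℂ)) (mult (dyad k dfatSym) v)) -
      (2 : ℂ) • E + Q (mulOp (fun x ↦ ((U x - s x : ℝ) : ℂ)) w) := by
    rw [hdec, map_add, map_add, hQS, map_smul, ← hQw, hE, ← smul_sub, sub_sub_cancel, zero_add]
  have hEn : ‖E‖ ≤ ℓ * m0 * (R⁻¹ * e1) * ‖w‖ := by
    have := norm_commutator_le (dyad k dannSym) hsB (Λ := ℓ * m0) (fun x y ↦ by
      rw [← Complex.ofReal_sub, Complex.norm_real]
      exact hsl x y) w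
    rwa [mom_dyad, pow_one, ← hRdef] at this
  have hWn : ‖Q (mulOp (fun x ↦ ((U x - s x : ℝ) : ℂ)) w)‖ ≤ M * (ℓ * (8 * R⁻¹ * m1) * ‖w‖) := by
    have hM' : ∀ ξ, ‖dyad k (dannSym : 𝓢(Rn n, ℂ)) ξ‖ ≤ M := fun ξ ↦ by
      rw [dyad_apply]; exact hM _
    refine (norm_mult_le (bddMeas_schwartz _).1 hM' _).trans ?_
    refine mul_le_mul_of_nonneg_left ?_ hM0
    exact norm_mulOp_le hwB.1 (fun x ↦ by rw [Complex.norm_real]; exact hwb x) w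
  have hφvn : ‖φv‖ ≤ Λ * ‖v‖ := norm_mulOp_le hw.bdd.1 (fun x ↦ by simpa using hw.abs_le x) v
  have hT := abs_transport_le hw k hB0 hℓ0 hsc hsb hsl hm0' v
  rw [← hφv, ← hRdef, ← hd1] at hT
  have hE2 : |(inner ℂ φv E : ℂ).re| ≤ Λ * ‖v‖ * (ℓ * m0 * (R⁻¹ * e1) * ‖w‖) :=
    (Complex.abs_re_le_norm _).trans ((norm_inner_le_norm _ _).trans
      (mul_le_mul hφvn hEn (norm_nonneg _) (by positivity)))
  have hW2 : |(inner ℂ φv (Q (mulOp (fun x ↦ ((U x - s x : ℝ) : ℂ)) w)) : ℂ).re| ≤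
      Λ * ‖v‖ * (M * (ℓ * (8 * R⁻¹ * m1) * ‖w‖)) :=
    (Complex.abs_re_le_norm _).trans ((norm_inner_le_norm _ _).trans
      (mul_le_mul hφvn hWn (norm_nonneg _) (by positivity)))
  have hsum : (inner ℂ φv (Q q) : ℂ).re =
      2 * (inner ℂ φv (mulOp (fun x ↦ (s x : ℂ)) (mult (dyad k dfatSym) v)) : ℂ).re
      - 2 * (inner ℂ φv E : ℂ).re
      + (inner ℂ φv (Q (mulOp (fun x ↦ ((U x - s x : ℝ) : ℂ)) w)) : ℂ).re := by
    rw [hQq, inner_add_right, inner_sub_right, inner_smul_right, inner_smul_right]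
    simp
  have hab : |(inner ℂ φv (Q q) : ℂ).re| ≤ Λ * m0 * (B + ℓ) * (R⁻¹ * d1) * ‖v‖ ^ 2 +
      2 * (Λ * ‖v‖ * (ℓ * m0 * (R⁻¹ * e1) * ‖w‖)) + Λ * ‖v‖ * (M * (ℓ * (8 * R⁻¹ * m1) * ‖w‖)) := by
    rw [hsum, abs_le]
    have a1 := abs_le.1 hT
    have a2 := abs_le.1 hE2
    have a3 := abs_le.1 hW2
    constructor <;> linarith [a1.1, a1.2, a2.1, a2.2, a3.1, a3.2]
  have hvw : ‖v‖ * ‖w‖ ≤ ‖v‖ ^ 2 + ‖w‖ ^ 2 := by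
    nlinarith [sq_nonneg (‖v‖ - ‖w‖), sq_nonneg ‖v‖, sq_nonneg ‖w‖]
  calc R * |(inner ℂ φv (Q q) : ℂ).re| ≤ R * _ := mul_le_mul_of_nonneg_left hab hR.le
    _ = Λ * m0 * d1 * (B + ℓ) * ‖v‖ ^ 2 + Λ * (2 * m0 * e1 + 8 * M * m1) * ℓ * (‖v‖ * ‖w‖) := by
        field_simp
        ring
    _ ≤ Λ * m0 * d1 * (B + ℓ) * (‖v‖ ^ 2 + ‖w‖ ^ 2) +
        Λ * (2 * m0 * e1 + 8 * M * m1) * (B + ℓ) * (‖v‖ ^ 2 + ‖w‖ ^ 2) := by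
        gcongr
        · linarith [sq_nonneg ‖w‖]
        · linarith
    _ = _ := by ring

end FZK

end

noncomputable section

namespace FZK

variable {n : ℕ}

/-! ### Multipliers on tempered distributions and Sobolev norms -/

theorem fourierMultiplierCLM_eq_iff {m : Rn n → ℂ} (hm : m.HasTemperateGrowth) (f g : L2 n) :
    TemperedDistribution.fourierMultiplierCLM ℂ m (Lp.toTemperedDistribution f : 𝓢'(Rn n, ℂ)) =
      Lp.toTemperedDistribution g ↔
    (𝓕 g : L2 n) =ᵐ[volume] fun ξ ↦ m ξ * (𝓕 f : L2 n) ξ := by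
  have hl (ψ : 𝓢(Rn n, ℂ)) :
      TemperedDistribution.fourierMultiplierCLM ℂ m (Lp.toTemperedDistribution f : 𝓢'(Rn n, ℂ)) ψ =
        ∫ ξ, (𝓕⁻ ψ : 𝓢(Rn n, ℂ)) ξ * (m ξ * (𝓕 f : L2 n) ξ) := by
    rw [TemperedDistribution.fourierMultiplierCLM_apply_apply, toTD_apply,
      ← integral_schwartz_mul_fourier]
    refine integral_congr_ae (ae_of_all _ fun ξ ↦ ?_)
    simp only [SchwartzMap.smulLeftCLM_apply_apply hm, smul_eq_mul]
    ring
  have hr (ψ : 𝓢(Rn n, ℂ)) : (Lp.toTemperedDistribution g : 𝓢'(Rn n, ℂ)) ψ =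
      ∫ ξ, (𝓕⁻ ψ : 𝓢(Rn n, ℂ)) ξ * (𝓕 g : L2 n) ξ := by
    rw [toTD_apply, integral_schwartz_mul_fourier, FourierTransform.fourier_fourierInv_eq]
  constructor
  · intro h
    have hloc : LocallyIntegrable (fun ξ ↦ m ξ * (𝓕 f : L2 n) ξ) volume := by
      have := (locallyIntegrable_L2 (𝓕 f : L2 n)).continuous_mul hm.1.continuous
      exact this
    refine ae_eq_of_integral_schwartz (locallyIntegrable_L2 _) hloc fun ψ _ ↦ ?_
    have h1 := hl (𝓕 ψ)
    have h2 := hr (𝓕 ψ)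
    rw [FourierTransform.fourierInv_fourier_eq] at h1 h2
    rw [← h1, ← h2, h]
  · intro h
    ext ψ
    rw [hl, hr]
    refine integral_congr_ae ?_
    filter_upwards [h] with ξ hξ
    rw [hξ]

theorem distL2Norm_fourierMultiplierCLM {m : Rn n → ℂ} (hm : m.HasTemperateGrowth) (f : L2 n) :
    distL2Norm (TemperedDistribution.fourierMultiplierCLM ℂ m
      (Lp.toTemperedDistribution f : 𝓢'(Rn n, ℂ))) =
      eLpNorm (fun ξ ↦ m ξ * (𝓕 f : L2 n) ξ) 2 volume := by
  apply le_antisymm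
  · by_cases h : MemLp (fun ξ ↦ m ξ * (𝓕 f : L2 n) ξ) 2 volume
    · set g : L2 n := 𝓕⁻ (h.toLp _) with hg
      have h1 : (𝓕 g : L2 n) = h.toLp _ := FourierTransform.fourier_fourierInv_eq _
      refine (iInf₂_le g ((fourierMultiplierCLM_eq_iff hm f g).2 ?_)).trans ?_
      · rw [h1]; exact h.coeFn_toLp
      · have h2 : ‖g‖ₑ = ‖(𝓕 g : L2 n)‖ₑ := by
          rw [← ofReal_norm, ← ofReal_norm, Lp.norm_fourier_eq]
        rw [h2, h1, Lp.enorm_toLp]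
    · have h1 : AEStronglyMeasurable (fun ξ ↦ m ξ * (𝓕 f : L2 n) ξ) volume :=
        hm.1.continuous.aestronglyMeasurable.mul (Lp.aestronglyMeasurable _)
      have : eLpNorm (fun ξ ↦ m ξ * (𝓕 f : L2 n) ξ) 2 volume = ⊤ := by
        by_contra h2
        exact h ⟨h1, lt_top_iff_ne_top.2 h2⟩
      rw [this]
      exact le_top
  · refine le_iInf₂ fun g hg ↦ ?_
    have h1 := (fourierMultiplierCLM_eq_iff hm f g).1 hg
    have h2 : ‖g‖ₑ = ‖(𝓕 g : L2 n)‖ₑ := by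
      rw [← ofReal_norm, ← ofReal_norm, Lp.norm_fourier_eq]
    rw [h2, Lp.enorm_def, eLpNorm_congr_ae h1]

theorem sobolevNorm_toTD (σ : ℝ) (f : L2 n) :
    sobolevNorm σ (Lp.toTemperedDistribution f : 𝓢'(Rn n, ℂ)) =
      eLpNorm (fun ξ ↦ besselSymbol n σ ξ * (𝓕 f : L2 n) ξ) 2 volume :=
  distL2Norm_fourierMultiplierCLM (besselSymbol_hasTemperateGrowth n σ) f

/-- The symbol `2 π i ξ_j ⟨2πξ⟩ ^ σ` of `∂_{x_j} J ^ σ`. -/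
def derivBesselSymbol (σ : ℝ) (j : Fin n) (ξ : Rn n) : ℂ :=
  (2 * Real.pi * Complex.I * (ξ j : ℂ)) * besselSymbol n σ ξ

theorem coordSymbol_hasTemperateGrowth (j : Fin n) :
    Function.HasTemperateGrowth fun ξ : Rn n ↦ (2 * Real.pi * Complex.I * (ξ j : ℂ)) := by
  have h1 : Function.HasTemperateGrowth (fun ξ : Rn n ↦ ((ξ j : ℝ) : ℂ)) :=
    (Complex.ofRealCLM.comp (EuclideanSpace.proj j : Rn n →L[ℝ] ℝ)).hasTemperateGrowth
  fun_prop

theorem derivBesselSymbol_hasTemperateGrowth (σ : ℝ) (j : Fin n) :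
    (derivBesselSymbol σ j).HasTemperateGrowth :=
  (coordSymbol_hasTemperateGrowth j).mul (besselSymbol_hasTemperateGrowth n σ)

theorem lineDeriv_eq_multiplier (j : Fin n) (F : 𝓢'(Rn n, ℂ)) :
    ∂_{stdVec j} F = TemperedDistribution.fourierMultiplierCLM ℂ
      (fun ξ : Rn n ↦ (2 * Real.pi * Complex.I * (ξ j : ℂ))) F := by
  have h1 : Function.HasTemperateGrowth (fun ξ : Rn n ↦ ((inner ℝ ξ (stdVec j) : ℝ) : ℂ)) := by
    fun_prop
  rw [TemperedDistribution.lineDeriv_eq_fourierMultiplierCLM]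
  have h2 := TemperedDistribution.fourierMultiplierCLM_smul (F := ℂ) h1 (2 * Real.pi * Complex.I)
  have h3 : (2 * (Real.pi : ℂ) * Complex.I) • (fun ξ : Rn n ↦ ((inner ℝ ξ (stdVec j) : ℝ) : ℂ)) =
      fun ξ : Rn n ↦ (2 * Real.pi * Complex.I * (ξ j : ℂ)) := by
    ext ξ
    simp [stdVec, EuclideanSpace.inner_single_right]
  rw [← h3, h2]
  rfl

theorem lineDeriv_besselJ (σ : ℝ) (j : Fin n) (F : 𝓢'(Rn n, ℂ)) :
    ∂_{stdVec j} (besselJ σ F) =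
      TemperedDistribution.fourierMultiplierCLM ℂ (derivBesselSymbol σ j) F := by
  rw [lineDeriv_eq_multiplier, besselJ,
    TemperedDistribution.fourierMultiplierCLM_fourierMultiplierCLM_apply
      (besselSymbol_hasTemperateGrowth n σ) (coordSymbol_hasTemperateGrowth j), mul_comm]
  rfl

theorem besselJ_lineDeriv (σ : ℝ) (j : Fin n) (F : 𝓢'(Rn n, ℂ)) :
    besselJ σ (∂_{stdVec j} F) =
      TemperedDistribution.fourierMultiplierCLM ℂ (derivBesselSymbol σ j) F := by
  rw [lineDeriv_eq_multiplier, besselJ,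
    TemperedDistribution.fourierMultiplierCLM_fourierMultiplierCLM_apply
      (coordSymbol_hasTemperateGrowth j) (besselSymbol_hasTemperateGrowth n σ)]
  rfl

theorem sobolevNorm_lineDeriv (σ : ℝ) (j : Fin n) (f : L2 n) :
    sobolevNorm σ (∂_{stdVec j} (Lp.toTemperedDistribution f : 𝓢'(Rn n, ℂ))) =
      eLpNorm (fun ξ ↦ derivBesselSymbol σ j ξ * (𝓕 f : L2 n) ξ) 2 volume := by
  rw [sobolevNorm, besselJ_lineDeriv,
    distL2Norm_fourierMultiplierCLM (derivBesselSymbol_hasTemperateGrowth σ j)]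

/-! ### The directions -/

theorem abs_coord_le (ξ : Rn n) (j : Fin n) : |ξ j| ≤ ‖ξ‖ := by
  simpa using PiLp.norm_apply_le ξ j

theorem norm_derivBesselSymbol_neg_one (j : Fin n) (ξ : Rn n) :
    ‖derivBesselSymbol (-1) j ξ‖ = 2 * Real.pi * |ξ j| / √(1 + ‖(2 * Real.pi) • ξ‖ ^ 2) := by
  have hpos : (0 : ℝ) < 1 + ‖(2 * Real.pi) • ξ‖ ^ 2 := by positivity
  have h1 : ‖besselSymbol n (-1) ξ‖ = (√(1 + ‖(2 * Real.pi) • ξ‖ ^ 2))⁻¹ := by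
    rw [besselSymbol, Complex.norm_real, Real.norm_of_nonneg (by positivity), Real.sqrt_eq_rpow,
      ← Real.rpow_neg hpos.le]
    norm_num
  rw [derivBesselSymbol, norm_mul, h1, div_eq_mul_inv]
  simp [abs_of_pos Real.pi_pos]

theorem norm_two_pi_smul (ξ : Rn n) : ‖(2 * Real.pi) • ξ‖ = 2 * Real.pi * ‖ξ‖ := by
  rw [norm_smul, Real.norm_of_nonneg (by positivity)]

theorem norm_derivBesselSymbol_le_one (j : Fin n) (ξ : Rn n) :
    ‖derivBesselSymbol (-1) j ξ‖ ≤ 1 := by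
  rw [norm_derivBesselSymbol_neg_one, div_le_one (by positivity), norm_two_pi_smul]
  apply Real.le_sqrt_of_sq_le
  have h1 := abs_coord_le ξ j
  have h2 : 2 * Real.pi * |ξ j| ≤ 2 * Real.pi * ‖ξ‖ := by gcongr
  have : (0 : ℝ) ≤ 2 * Real.pi * |ξ j| := by positivity
  nlinarith

/-- The norm of `J⁻¹ ∂_{x_j}` is `1`; the lower bound `9/10` is all that the admissibility of `ν`
needs. It is seen on functions with frequencies near `100 e_j`. -/
theorem transversalConst_ge [NeZero n] (hn : 2 ≤ n) : 9 / 10 ≤ transversalConst n := by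
  have hone (f : L2 n) : eLpNorm (𝓕 f : L2 n) 2 volume = ‖f‖ₑ := by
    rw [← Lp.enorm_def, ← ofReal_norm, ← ofReal_norm, Lp.norm_fourier_eq]
  have hj : ∃ j : Fin n, j ≠ 0 := ⟨⟨1, by omega⟩, fun h ↦ by simpa using congrArg Fin.val h⟩
  obtain ⟨j, hj⟩ := hj
  set S := (⨆ (j : Fin n) (_ : j ≠ 0) (f : Lp ℂ 2 (volume : Measure (Rn n))) (_ : f ≠ 0),
    sobolevNorm (-1) (∂_{stdVec j} (Lp.toTemperedDistribution f : 𝓢'(Rn n, ℂ))) / ‖f‖ₑ) with hS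
  -- finiteness of the supremum, without which `toReal` would be the junk value `0`
  have hS1 : S ≤ 1 := by
    refine iSup_le fun i ↦ iSup_le fun _ ↦ iSup_le fun f ↦ iSup_le fun _ ↦ ?_
    rw [sobolevNorm_lineDeriv]
    refine ENNReal.div_le_of_le_mul ?_
    rw [one_mul, ← hone]
    refine eLpNorm_mono fun ξ ↦ ?_
    rw [norm_mul]
    exact mul_le_of_le_one_left (norm_nonneg _) (norm_derivBesselSymbol_le_one i ξ)
  set B : Set (Rn n) := Metric.ball ((100 : ℝ) • stdVec j) 1 with hB
  have hBm : MeasurableSet B := measurableSet_ball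
  have hBt : volume B ≠ ⊤ := measure_ball_lt_top.ne
  have hB0 : volume B ≠ 0 := (Metric.measure_ball_pos volume _ one_pos).ne'
  set f : L2 n := 𝓕⁻ (indicatorConstLp 2 hBm hBt (1 : ℂ)) with hf
  have hFf : (𝓕 f : L2 n) = indicatorConstLp 2 hBm hBt (1 : ℂ) :=
    FourierTransform.fourier_fourierInv_eq _
  have hf0 : f ≠ 0 := by
    intro h
    have h0 : (𝓕 (0 : L2 n) : L2 n) = 0 := FourierTransform.fourier_zero
    rw [h, h0] at hFf
    have h1 := norm_indicatorConstLp (μ := volume) (hs := hBm) (hμs := hBt) (c := (1 : ℂ))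
      two_ne_zero ENNReal.ofNat_ne_top
    have h2 : 0 < volume.real B := ENNReal.toReal_pos hB0 hBt
    rw [← hFf, norm_zero] at h1
    have h3 : 0 < volume.real B ^ (1 / (2 : ℝ≥0∞).toReal) := Real.rpow_pos_of_pos h2 _
    simp at h1
    simp [← h1] at h3
  have key : ∀ ξ ∈ B, 9 / 10 ≤ ‖derivBesselSymbol (-1) j ξ‖ := by
    intro ξ hξ
    have hd : ‖ξ - (100 : ℝ) • stdVec j‖ < 1 := by rwa [← dist_eq_norm]
    have h1 : 99 ≤ ξ j := by
      have h2 := abs_coord_le (ξ - (100 : ℝ) • stdVec j) j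
      have h3 : (ξ - (100 : ℝ) • stdVec j) j = ξ j - 100 := by simp [stdVec]
      rw [h3] at h2
      linarith [neg_abs_le (ξ j - 100)]
    have h2 : ‖ξ‖ ≤ 101 := by
      have h3 : ‖(100 : ℝ) • (stdVec j : Rn n)‖ = 100 := by simp [stdVec, norm_smul]
      have h4 := norm_le_norm_sub_add ξ ((100 : ℝ) • stdVec j)
      linarith
    rw [norm_derivBesselSymbol_neg_one, le_div_iff₀ (by positivity), norm_two_pi_smul,
      abs_of_nonneg (by linarith)]
    have hpi := Real.pi_gt_three
    have h5 : √(1 + (2 * Real.pi * ‖ξ‖) ^ 2) ≤ 2 * Real.pi * 110 := by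
      apply Real.sqrt_le_iff.2 ⟨by positivity, ?_⟩
      have : 2 * Real.pi * ‖ξ‖ ≤ 2 * Real.pi * 101 := by gcongr
      have h0 : 0 ≤ 2 * Real.pi * ‖ξ‖ := by positivity
      nlinarith
    nlinarith
  have hlow : ENNReal.ofReal (9 / 10) ≤ S := by
    refine le_trans ?_ (le_iSup_of_le j (le_iSup_of_le hj (le_iSup_of_le f
      (le_iSup_of_le hf0 le_rfl))))
    rw [sobolevNorm_lineDeriv, ENNReal.le_div_iff_mul_le (Or.inl (by simpa using hf0))
      (Or.inl enorm_ne_top), ← hone]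
    have h1 : ENNReal.ofReal (9 / 10) * eLpNorm (𝓕 f : L2 n) 2 volume =
        eLpNorm (fun ξ ↦ ((9 / 10 : ℝ) : ℂ) * (𝓕 f : L2 n) ξ) 2 volume := by
      have := eLpNorm_const_smul (((9 / 10 : ℝ) : ℂ)) (𝓕 f : L2 n) 2 volume
      rw [← ofReal_norm, Complex.norm_real, Real.norm_of_nonneg (by norm_num)] at this
      exact this.symm
    rw [h1]
    refine eLpNorm_mono_ae ?_
    have h2 : (𝓕 f : L2 n) =ᵐ[volume] B.indicator fun _ ↦ (1 : ℂ) := by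
      rw [hFf]
      exact indicatorConstLp_coeFn
    filter_upwards [h2] with ξ hξ
    rw [norm_mul, norm_mul, hξ, Complex.norm_real, Real.norm_of_nonneg (by norm_num)]
    by_cases h : ξ ∈ B
    · gcongr
      exact key ξ h
    · simp [indicator_of_notMem h]
  have := ENNReal.toReal_mono (ne_top_of_le_ne_top ENNReal.one_ne_top hS1) hlow
  rwa [ENNReal.toReal_ofReal (by norm_num)] at this

/-- The direction `ν` as a vector of `ℝⁿ`. -/
def dirVec (ν : Fin n → ℝ) : Rn n := WithLp.toLp 2 ν

theorem inner_dirVec (ν : Fin n → ℝ) (x : Rn n) : inner ℝ (dirVec ν) x = ∑ j, ν j * x j := by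
  simp [dirVec, PiLp.inner_apply, mul_comm]

/-- Admissibility makes the form `ν₁ |ξ|² + α ξ₁ (ν · ξ)` positive definite. -/
theorem exists_form_ge [NeZero n] (hn : 2 ≤ n) {α : ℝ} (hα₀ : 0 < α) (hα₂ : α < 2) {ν : Fin n → ℝ}
    (hν : Admissible α ν) : ∃ c₀ : ℝ, 0 < c₀ ∧ ∀ ξ : Rn n,
      c₀ * ‖ξ‖ ^ 2 ≤ dirVec ν 0 * ‖ξ‖ ^ 2 + α * ξ 0 * inner ℝ (dirVec ν) ξ := by
  obtain ⟨hν0, hν⟩ := hν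
  set N := transversalNorm ν with hN
  have hN0 : 0 ≤ N := Real.sqrt_nonneg _
  -- only the first entry of the minimum in the smallness condition is used
  have hbound : (α * N) ^ 2 ≤ 400 / 81 * α * ν 0 ^ 2 := by
    rcases hν with h | ⟨-, ε, -, -, -, h⟩
    · have : N = 0 := by
        rw [hN, transversalNorm, Finset.sum_eq_zero, Real.sqrt_zero]
        intro j hj
        rw [h j (Finset.ne_of_mem_erase hj)]
        ring
      rw [this]
      have : 0 ≤ 400 / 81 * α * ν 0 ^ 2 := by positivity
      simpa using this
    · have h1 := lt_of_lt_of_le h (min_le_left _ _)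
      have hn1 : (1 : ℝ) ≤ (n : ℝ) - 1 := by
        have : (2 : ℝ) ≤ n := by exact_mod_cast hn
        linarith
      have hC := transversalConst_ge hn
      have h2 : √α ≤ √(α * ((n : ℝ) - 1)) := Real.sqrt_le_sqrt (by nlinarith)
      have h3 : 0 < √α := Real.sqrt_pos.2 hα₀
      have h4 : N * (9 / 10 * √α) ≤ 2 * ν 0 := by
        rw [lt_div_iff₀ (by positivity)] at h1
        refine le_trans ?_ h1.le
        gcongr
      have h5 : (N * (9 / 10 * √α)) ^ 2 ≤ (2 * ν 0) ^ 2 := by gcongr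
      have h6 : √α ^ 2 = α := Real.sq_sqrt hα₀.le
      have h7 : (N * (9 / 10 * √α)) ^ 2 = N ^ 2 * (81 / 100) * α := by
        rw [mul_pow, mul_pow, h6]; ring
      rw [h7] at h5
      nlinarith
  refine ⟨ν 0 / 20, by positivity, fun ξ ↦ ?_⟩
  set a := ξ 0 with ha
  set b2 := ∑ j ∈ Finset.univ.erase (0 : Fin n), ξ j ^ 2 with hb2
  have hb0 : 0 ≤ b2 := Finset.sum_nonneg fun _ _ ↦ sq_nonneg _
  have hnorm : ‖ξ‖ ^ 2 = a ^ 2 + b2 := by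
    rw [EuclideanSpace.norm_sq_eq, ← Finset.add_sum_erase _ _ (Finset.mem_univ (0 : Fin n))]
    simp [ha, hb2]
  set d := ∑ j ∈ Finset.univ.erase (0 : Fin n), ν j * ξ j with hd
  have hinner : inner ℝ (dirVec ν) ξ = ν 0 * a + d := by
    rw [inner_dirVec, ← Finset.add_sum_erase _ _ (Finset.mem_univ (0 : Fin n))]
  have hcs : d ^ 2 ≤ N ^ 2 * b2 := by
    rw [hN, transversalNorm, Real.sq_sqrt (Finset.sum_nonneg fun _ _ ↦ sq_nonneg _)]
    exact Finset.sum_mul_sq_le_sq_mul_sq _ _ _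
  have hv0 : dirVec ν 0 = ν 0 := rfl
  rw [hnorm, hinner, hv0]
  -- discriminant of the form in `a` and `d`
  have h1 : α ^ 2 * d ^ 2 ≤ 400 / 81 * α * ν 0 ^ 2 * b2 := by
    calc α ^ 2 * d ^ 2 ≤ α ^ 2 * (N ^ 2 * b2) := by gcongr
      _ = (α * N) ^ 2 * b2 := by ring
      _ ≤ _ := by gcongr
  set p := ν 0 * (19 / 20 + α) with hp
  have hp0 : 0 < p := by positivity
  have h2 : α ^ 2 * d ^ 2 ≤ 4 * p * (19 / 20 * ν 0 * b2) := by
    refine h1.trans ?_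
    have : 0 ≤ ν 0 ^ 2 * b2 := by positivity
    rw [hp]
    nlinarith
  have h3 : 0 ≤ 4 * p * (p * a ^ 2 + α * a * d + 19 / 20 * ν 0 * b2) := by
    nlinarith [sq_nonneg (2 * p * a + α * d)]
  have h4 := nonneg_of_mul_nonneg_right h3 (by positivity)
  rw [hp] at h4
  linarith

end FZK

end

noncomputable section

namespace FZK

variable {n : ℕ}

/-! ### Sobolev norms of square integrable functions -/

/-- The `H ^ σ` norm of an `L²` function, as a real number (it is `0` if the norm is infinite). -/
def sobR (σ : ℝ) (f : L2 n) : ℝ := (sobolevNorm σ (Lp.toTemperedDistribution f : 𝓢'(Rn n, ℂ))).toReal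

/-- The `L²` function `f` belongs to `H ^ σ`. -/
def MemSob (σ : ℝ) (f : L2 n) : Prop :=
  sobolevNorm σ (Lp.toTemperedDistribution f : 𝓢'(Rn n, ℂ)) < ⊤

theorem sobR_nonneg (σ : ℝ) (f : L2 n) : 0 ≤ sobR σ f := ENNReal.toReal_nonneg

theorem besselSymbol_continuous (σ : ℝ) : Continuous (besselSymbol n σ) :=
  (besselSymbol_hasTemperateGrowth n σ).1.continuous

theorem norm_besselSymbol (σ : ℝ) (ξ : Rn n) :
    ‖besselSymbol n σ ξ‖ = (1 + ‖(2 * Real.pi) • ξ‖ ^ 2) ^ (σ / 2) := by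
  rw [besselSymbol, Complex.norm_real, Real.norm_of_nonneg (by positivity)]

theorem MemSob.memLp {σ : ℝ} {f : L2 n} (h : MemSob σ f) :
    MemLp (fun ξ ↦ besselSymbol n σ ξ * (𝓕 f : L2 n) ξ) 2 volume :=
  ⟨(besselSymbol_continuous σ).aestronglyMeasurable.mul (Lp.aestronglyMeasurable _), by
    rw [← sobolevNorm_toTD]; exact h⟩

theorem MemSob.integrable_sq {σ : ℝ} {f : L2 n} (h : MemSob σ f) :
    Integrable (fun ξ ↦ ‖besselSymbol n σ ξ * (𝓕 f : L2 n) ξ‖ ^ 2) volume :=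
  h.memLp.integrable_norm_pow (by norm_num)

theorem MemSob.sobR_sq {σ : ℝ} {f : L2 n} (h : MemSob σ f) :
    sobR σ f ^ 2 = ∫ ξ, ‖besselSymbol n σ ξ * (𝓕 f : L2 n) ξ‖ ^ 2 := by
  have h1 : sobR σ f = ‖h.memLp.toLp _‖ := by
    rw [sobR, sobolevNorm_toTD, Lp.norm_toLp]
  rw [h1, norm_sq_eq_integral]
  apply integral_congr_ae
  filter_upwards [h.memLp.coeFn_toLp] with ξ hξ
  rw [hξ]

theorem norm_besselSymbol_mono {σ τ : ℝ} (h : σ ≤ τ) (ξ : Rn n) :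
    ‖besselSymbol n σ ξ‖ ≤ ‖besselSymbol n τ ξ‖ := by
  rw [norm_besselSymbol, norm_besselSymbol]
  apply Real.rpow_le_rpow_of_exponent_le
  · have := sq_nonneg ‖(2 * Real.pi) • ξ‖
    linarith
  · linarith

theorem sobolevNorm_mono {σ τ : ℝ} (h : σ ≤ τ) (f : L2 n) :
    sobolevNorm σ (Lp.toTemperedDistribution f : 𝓢'(Rn n, ℂ)) ≤
      sobolevNorm τ (Lp.toTemperedDistribution f : 𝓢'(Rn n, ℂ)) := by
  rw [sobolevNorm_toTD, sobolevNorm_toTD]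
  refine eLpNorm_mono fun ξ ↦ ?_
  rw [norm_mul, norm_mul]
  gcongr
  exact norm_besselSymbol_mono h ξ

theorem MemSob.mono {σ τ : ℝ} (h : σ ≤ τ) {f : L2 n} (hf : MemSob τ f) : MemSob σ f :=
  (sobolevNorm_mono h f).trans_lt hf

theorem sobolevNorm_zero (f : L2 n) :
    sobolevNorm 0 (Lp.toTemperedDistribution f : 𝓢'(Rn n, ℂ)) = ‖f‖ₑ := by
  rw [sobolevNorm_toTD]
  have h2 : ‖f‖ₑ = ‖(𝓕 f : L2 n)‖ₑ := by
    rw [← ofReal_norm, ← ofReal_norm, Lp.norm_fourier_eq]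
  rw [h2, Lp.enorm_def]
  simp [besselSymbol]

theorem enorm_le_sobolevNorm {σ : ℝ} (h : 0 ≤ σ) (f : L2 n) :
    ‖f‖ₑ ≤ sobolevNorm σ (Lp.toTemperedDistribution f : 𝓢'(Rn n, ℂ)) := by
  rw [← sobolevNorm_zero]
  exact sobolevNorm_mono h f

theorem MemSob.norm_le {σ : ℝ} (h : 0 ≤ σ) {f : L2 n} (hf : MemSob σ f) : ‖f‖ ≤ sobR σ f := by
  have := ENNReal.toReal_mono hf.ne (enorm_le_sobolevNorm h f)
  rwa [toReal_enorm] at this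

/-! ### Summation over the dyadic blocks -/

/-- A geometric sum of the weights `4 ^ (k s)` is governed by its last term. -/
theorem sum_geom_le {s : ℝ} (hs : 0 < s) {ρ : ℝ} (hρ : 0 ≤ ρ) (N : ℕ) :
    ∑ k ∈ Finset.range N, (if (2 : ℝ) ^ k ≤ ρ then ((4 : ℝ) ^ s) ^ k else 0) ≤
      (4 : ℝ) ^ s / ((4 : ℝ) ^ s - 1) * ρ ^ (2 * s) := by
  set q : ℝ := (4 : ℝ) ^ s with hq
  have hq1 : 1 < q := Real.one_lt_rpow (by norm_num) hs
  have hd : 0 < q - 1 := by linarith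
  induction N with
  | zero =>
    simp only [Finset.range_zero, Finset.sum_empty]
    positivity
  | succ N ih =>
    by_cases h : (2 : ℝ) ^ N ≤ ρ
    · have h1 : ∑ k ∈ Finset.range (N + 1), (if (2 : ℝ) ^ k ≤ ρ then q ^ k else 0) =
          ∑ k ∈ Finset.range (N + 1), q ^ k := by
        refine Finset.sum_congr rfl fun k hk ↦ if_pos (le_trans ?_ h)
        exact pow_le_pow_right₀ (by norm_num) (Nat.lt_succ_iff.1 (Finset.mem_range.1 hk))
      rw [h1, geom_sum_eq hq1.ne']
      have h2 : q ^ N = ((2 : ℝ) ^ N) ^ (2 * s) := by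
        rw [hq, ← Real.rpow_natCast, ← Real.rpow_natCast, ← Real.rpow_mul (by norm_num),
          ← Real.rpow_mul (by norm_num), show (4 : ℝ) = 2 ^ (2 : ℝ) by norm_num,
          ← Real.rpow_mul (by norm_num)]
        ring_nf
      have h3 : q ^ N ≤ ρ ^ (2 * s) := by
        rw [h2]
        gcongr
      rw [div_mul_eq_mul_div]
      gcongr
      calc q ^ (N + 1) - 1 ≤ q * q ^ N := by rw [pow_succ]; linarith
        _ ≤ q * ρ ^ (2 * s) := by gcongr
    · rw [Finset.sum_range_succ, if_neg h, add_zero]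
      exact ih

theorem dyad_annSym_bound (k : ℕ) (ξ : Rn n) :
    ‖dyad k annSym ξ‖ ^ 2 ≤ if (2 : ℝ) ^ k ≤ 8 * ‖ξ‖ then 1 else 0 := by
  have hR : (0 : ℝ) < 2 ^ k := by positivity
  rw [dyad_apply, annSym_apply, Complex.norm_real, Real.norm_eq_abs]
  split_ifs with h
  · exact pow_le_one₀ (abs_nonneg _) (abs_annReal_le _)
  · rw [annReal_eq_zero_of_le]
    · simp
    · rw [norm_smul, norm_inv, Real.norm_of_nonneg hR.le, inv_mul_le_iff₀ hR]
      linarith [norm_nonneg ξ]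

theorem one_sub_low_bound (k : ℕ) (ξ : Rn n) :
    ‖(1 : ℂ) - dil ((2 : ℝ) ^ k / 8) (by positivity) lowSym ξ‖ ^ 2 ≤
      if (2 : ℝ) ^ k ≤ 8 * ‖ξ‖ then 1 else 0 := by
  have hR : (0 : ℝ) < 2 ^ k / 8 := by positivity
  rw [dil_apply, lowSym_apply, ← Complex.ofReal_one, ← Complex.ofReal_sub, Complex.norm_real,
    Real.norm_eq_abs]
  split_ifs with h
  · refine pow_le_one₀ (abs_nonneg _) (abs_le.2 ⟨?_, ?_⟩)
    · linarith [bump_le_one (((2 : ℝ) ^ k / 8)⁻¹ • ξ)]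
    · linarith [bump_nonneg (((2 : ℝ) ^ k / 8)⁻¹ • ξ)]
  · rw [bump_eq_one]
    · simp
    · rw [norm_smul, norm_inv, Real.norm_of_nonneg hR.le, inv_mul_le_iff₀ hR]
      linarith [norm_nonneg ξ]

theorem norm_le_norm_two_pi_smul (ξ : Rn n) : ‖ξ‖ ≤ ‖(2 * Real.pi) • ξ‖ := by
  rw [norm_two_pi_smul]
  have := Real.pi_gt_three
  nlinarith [norm_nonneg ξ]

/-- The Littlewood–Paley pieces of an `H ^ s` function, and its high frequency parts, are square
summable with the weights `4 ^ (k s)`. -/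
theorem exists_sum_blk_le {s : ℝ} (hs : 0 < s) : ∃ C : ℝ, 0 ≤ C ∧ ∀ (f : L2 n), MemSob s f →
    ∀ N : ℕ, ∑ k ∈ Finset.range N, ((4 : ℝ) ^ s) ^ k * (‖blk k f‖ ^ 2 + ‖f - lowPart k f‖ ^ 2) ≤
      C * sobR s f ^ 2 := by
  have hq1 : 1 < (4 : ℝ) ^ s := Real.one_lt_rpow (by norm_num) hs
  have hd : 0 < (4 : ℝ) ^ s - 1 := by linarith
  set A := (4 : ℝ) ^ s / ((4 : ℝ) ^ s - 1) with hA
  have hA0 : 0 ≤ A := by positivity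
  refine ⟨2 * (A * 8 ^ (2 * s)), by positivity, fun f hf N ↦ ?_⟩
  set F : Rn n → ℂ := ⇑(𝓕 f : L2 n) with hF
  set χ : ℕ → Rn n → ℝ := fun k ξ ↦ if (2 : ℝ) ^ k ≤ 8 * ‖ξ‖ then 1 else 0 with hχ
  have hχm : ∀ k, BddMeas fun ξ ↦ (χ k ξ : ℂ) := fun k ↦ by
    refine ⟨Complex.measurable_ofReal.comp (Measurable.ite (measurableSet_le (by fun_prop)
      (by fun_prop)) measurable_const measurable_const), 1, fun ξ ↦ ?_⟩
    simp only [hχ, Complex.norm_real]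
    split_ifs <;> simp
  have hχi : ∀ k, Integrable (fun ξ ↦ χ k ξ * ‖F ξ‖ ^ 2) volume := fun k ↦
    integrable_bdd_mul_norm_sq (hχm k) _
  have h1 : ∀ k, ‖blk k f‖ ^ 2 ≤ ∫ ξ, χ k ξ * ‖F ξ‖ ^ 2 := fun k ↦ by
    rw [blk, norm_mult_sq (bddMeas_schwartz _)]
    refine integral_mono_of_nonneg (ae_of_all _ fun ξ ↦ by positivity) (hχi k)
      (ae_of_all _ fun ξ ↦ ?_)
    exact mul_le_mul_of_nonneg_right (dyad_annSym_bound k ξ) (by positivity)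
  have h2 : ∀ k, ‖f - lowPart k f‖ ^ 2 ≤ ∫ ξ, χ k ξ * ‖F ξ‖ ^ 2 := fun k ↦ by
    have e : f - lowPart k f = mult (fun ξ ↦ (1 : ℂ) -
        dil ((2 : ℝ) ^ k / 8) (by positivity) lowSym ξ) f := by
      rw [mult_sub_left (BddMeas.const 1) (bddMeas_schwartz _), mult_one]
      rfl
    rw [e, norm_mult_sq ((BddMeas.const 1).sub (bddMeas_schwartz _))]
    refine integral_mono_of_nonneg (ae_of_all _ fun ξ ↦ by positivity) (hχi k)
      (ae_of_all _ fun ξ ↦ ?_)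
    exact mul_le_mul_of_nonneg_right (one_sub_low_bound k ξ) (by positivity)
  calc ∑ k ∈ Finset.range N, ((4 : ℝ) ^ s) ^ k * (‖blk k f‖ ^ 2 + ‖f - lowPart k f‖ ^ 2)
      ≤ ∑ k ∈ Finset.range N, 2 * ∫ ξ, ((4 : ℝ) ^ s) ^ k * (χ k ξ * ‖F ξ‖ ^ 2) := by
        refine Finset.sum_le_sum fun k _ ↦ ?_
        rw [integral_const_mul, mul_left_comm]
        gcongr
        linarith [h1 k, h2 k]
    _ = 2 * ∫ ξ, ∑ k ∈ Finset.range N, ((4 : ℝ) ^ s) ^ k * (χ k ξ * ‖F ξ‖ ^ 2) := by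
        rw [← Finset.mul_sum, integral_finsetSum _ fun k _ ↦ (hχi k).const_mul _]
    _ ≤ 2 * ∫ ξ, A * 8 ^ (2 * s) * ‖besselSymbol n s ξ * F ξ‖ ^ 2 := by
        gcongr
        · exact integrable_finsetSum _ fun k _ ↦ (hχi k).const_mul _
        · exact hf.integrable_sq.const_mul _
        · intro ξ
          have h3 := sum_geom_le hs (ρ := 8 * ‖ξ‖) (by positivity) N
          have h4 : ∑ k ∈ Finset.range N, ((4 : ℝ) ^ s) ^ k * (χ k ξ * ‖F ξ‖ ^ 2) =
              (∑ k ∈ Finset.range N, (if (2 : ℝ) ^ k ≤ 8 * ‖ξ‖ then ((4 : ℝ) ^ s) ^ k else 0)) *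
                ‖F ξ‖ ^ 2 := by
            rw [Finset.sum_mul]
            refine Finset.sum_congr rfl fun k _ ↦ ?_
            simp only [hχ]
            split_ifs <;> ring
          have h5 : ‖ξ‖ ^ (2 * s) ≤ ‖besselSymbol n s ξ‖ ^ 2 := by
            rw [norm_besselSymbol, ← Real.rpow_natCast, ← Real.rpow_mul (by positivity),
              Real.rpow_mul (norm_nonneg ξ)]
            have : s / 2 * ((2 : ℕ) : ℝ) = s := by push_cast; ring
            rw [this]
            have h6 := norm_le_norm_two_pi_smul ξ
            have h7 : ‖ξ‖ ^ (2 : ℝ) = ‖ξ‖ ^ 2 := by norm_cast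
            rw [h7]
            gcongr
            nlinarith [norm_nonneg ξ]
          simp only
          rw [h4, norm_mul, mul_pow, ← mul_assoc]
          gcongr
          refine h3.trans ?_
          rw [Real.mul_rpow (by norm_num) (norm_nonneg ξ), ← mul_assoc]
          gcongr
    _ = _ := by
        rw [integral_const_mul, hf.sobR_sq]
        ring

/-! ### The Sobolev embedding -/

/-- Above the critical exponent the Fourier transform of an `H ^ σ` function is integrable, with
the corresponding powers of the frequency. -/
theorem exists_integral_fourier_le {σ : ℝ} (j : ℕ) (hσ : (n : ℝ) / 2 + j < σ) :
    ∃ C : ℝ, 0 ≤ C ∧ ∀ f : L2 n, MemSob σ f →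
      Integrable (fun ξ ↦ ‖ξ‖ ^ j * ‖(𝓕 f : L2 n) ξ‖) volume ∧
      ∫ ξ, ‖ξ‖ ^ j * ‖(𝓕 f : L2 n) ξ‖ ≤ C * sobR σ f := by
  set w : Rn n → ℝ := fun ξ ↦ ‖ξ‖ ^ j * ‖besselSymbol n (-σ) ξ‖ with hw
  have hw0 : ∀ ξ, 0 ≤ w ξ := fun ξ ↦ by positivity
  have hwc : Continuous w := by
    have := besselSymbol_continuous (n := n) (-σ)
    fun_prop
  have hw2 : ∀ ξ, w ξ ^ 2 ≤ (1 + ‖ξ‖ ^ 2) ^ (-(2 * (σ - j)) / 2) := by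
    intro ξ
    have hp : (0 : ℝ) < 1 + ‖ξ‖ ^ 2 := by positivity
    have h1 : ‖besselSymbol n (-σ) ξ‖ ≤ (1 + ‖ξ‖ ^ 2) ^ (-σ / 2) := by
      rw [norm_besselSymbol]
      apply Real.rpow_le_rpow_of_nonpos hp
      · have := norm_le_norm_two_pi_smul ξ
        gcongr
      · have : (0 : ℝ) ≤ (n : ℝ) / 2 + j := by positivity
        linarith
    calc w ξ ^ 2 = (‖ξ‖ ^ 2) ^ j * ‖besselSymbol n (-σ) ξ‖ ^ 2 := by rw [hw]; ring
      _ ≤ (1 + ‖ξ‖ ^ 2) ^ j * ((1 + ‖ξ‖ ^ 2) ^ (-σ / 2)) ^ 2 := by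
          gcongr
          linarith
      _ = (1 + ‖ξ‖ ^ 2) ^ (-(2 * (σ - j)) / 2) := by
          generalize 1 + ‖ξ‖ ^ 2 = p at hp
          rw [← Real.rpow_natCast, ← Real.rpow_natCast, ← Real.rpow_mul hp.le, ← Real.rpow_add hp]
          congr 1
          push_cast
          ring
  have hint : Integrable (fun ξ ↦ w ξ ^ 2) volume := by
    have h1 : Integrable (fun ξ : Rn n ↦ (1 + ‖ξ‖ ^ 2) ^ (-(2 * (σ - j)) / 2)) volume := by
      apply integrable_rpow_neg_one_add_norm_sq
      rw [finrank_euclideanSpace, Fintype.card_fin]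
      linarith
    refine h1.mono' (hwc.pow 2).aestronglyMeasurable (ae_of_all _ fun ξ ↦ ?_)
    rw [Real.norm_of_nonneg (by positivity)]
    exact hw2 ξ
  have hwLp : MemLp w 2 volume := (memLp_two_iff_integrable_sq hwc.aestronglyMeasurable).2 hint
  -- Cauchy–Schwarz with the weights `⟨2πξ⟩ ^ (-σ)` and `⟨2πξ⟩ ^ σ`
  refine ⟨(∫ ξ, w ξ ^ 2) ^ (1 / 2 : ℝ), by positivity, fun f hf ↦ ?_⟩
  set G : Rn n → ℝ := fun ξ ↦ ‖besselSymbol n σ ξ * (𝓕 f : L2 n) ξ‖ with hG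
  have hGLp : MemLp G 2 volume := hf.memLp.norm
  have heq : (fun ξ ↦ ‖ξ‖ ^ j * ‖(𝓕 f : L2 n) ξ‖) = fun ξ ↦ w ξ * G ξ := by
    ext ξ
    have hp : (0 : ℝ) < 1 + ‖(2 * Real.pi) • ξ‖ ^ 2 := by positivity
    have h1 : ‖besselSymbol n (-σ) ξ‖ * ‖besselSymbol n σ ξ‖ = 1 := by
      rw [norm_besselSymbol, norm_besselSymbol, ← Real.rpow_add hp]
      ring_nf
      simp
    simp only [hw, hG, norm_mul]
    linear_combination (-‖ξ‖ ^ j * ‖(𝓕 f : L2 n) ξ‖) * h1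
  rw [heq]
  refine ⟨hwLp.integrable_mul hGLp, ?_⟩
  have h2 := integral_mul_le_Lp_mul_Lq_of_nonneg (μ := volume) (Real.HolderConjugate.two_two)
    (ae_of_all _ hw0) (ae_of_all _ fun ξ ↦ norm_nonneg (besselSymbol n σ ξ * (𝓕 f : L2 n) ξ))
    (by rw [ENNReal.ofReal_ofNat]; exact hwLp) (by rw [ENNReal.ofReal_ofNat]; exact hGLp)
  refine h2.trans ?_
  have h3 : (∫ ξ, ‖besselSymbol n σ ξ * (𝓕 f : L2 n) ξ‖ ^ (2 : ℝ)) ^ (1 / 2 : ℝ) = sobR σ f := by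
    simp only [Real.rpow_two]
    rw [← hf.sobR_sq, ← Real.sqrt_eq_rpow, Real.sqrt_sq (sobR_nonneg _ _)]
  rw [h3]
  simp only [Real.rpow_two]
  exact le_rfl

end FZK

end

noncomputable section

namespace FZK

variable {n : ℕ}

/-! ### Classical representatives and their gradients -/

theorem complexify_coeFn (u : Lp ℝ 2 (volume : Measure (Rn n))) :
    complexify u =ᵐ[volume] fun x ↦ (u x : ℂ) :=
  ContinuousLinearMap.coeFn_compLp _ _

/-- The representative of an `L²` function that is given pointwise by the Fourier inversion
formula. -/
def rep (u : Lp ℝ 2 (volume : Measure (Rn n))) (x : Rn n) : ℝ :=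
  (𝓕 ((𝓕 (complexify u) : L2 n) : Rn n → ℂ) (-x)).re

theorem contDiff_rep {u : Lp ℝ 2 (volume : Measure (Rn n))}
    (h0 : Integrable (𝓕 (complexify u) : L2 n) volume)
    (h1 : Integrable (fun ξ ↦ ‖ξ‖ ^ 1 * ‖(𝓕 (complexify u) : L2 n) ξ‖) volume) :
    ContDiff ℝ 1 (rep u) := by
  have hc : ContDiff ℝ 1 (𝓕 ((𝓕 (complexify u) : L2 n) : Rn n → ℂ)) := by
    apply Real.contDiff_fourier
    intro k hk
    have hk' : k ≤ 1 := by exact_mod_cast hk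
    interval_cases k
    · simpa using h0.norm
    · exact h1
  exact Complex.reCLM.contDiff.comp (hc.comp contDiff_neg)

theorem exists_norm_fderiv_rep_le {u : Lp ℝ 2 (volume : Measure (Rn n))}
    (h0 : Integrable (𝓕 (complexify u) : L2 n) volume)
    (h1 : Integrable (fun ξ ↦ ‖ξ‖ ^ 1 * ‖(𝓕 (complexify u) : L2 n) ξ‖) volume) :
    ∃ L : ℝ, ∀ x, ‖fderiv ℝ (rep u) x‖ ≤ L := by
  set F : Rn n → ℂ := ⇑(𝓕 (complexify u) : L2 n) with hF
  have h1' : Integrable (fun ξ ↦ ‖ξ‖ * ‖F ξ‖) volume := by simpa using h1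
  obtain ⟨L, hL⟩ : ∃ L : ℝ, ∀ x, ‖fderiv ℝ (𝓕 F) x‖ ≤ L := by
    rw [Real.fderiv_fourier h0 h1']
    exact ⟨_, fun x ↦ VectorFourier.norm_fourierIntegral_le_integral_norm _ _ _ _ _⟩
  refine ⟨L, fun x ↦ ?_⟩
  have hd : HasFDerivAt (fun y ↦ 𝓕 F (-y)) ((fderiv ℝ (𝓕 F) (-x)).comp
      (-ContinuousLinearMap.id ℝ (Rn n))) x := by
    have h2 : DifferentiableAt ℝ (𝓕 F) (-x) := (Real.hasFDerivAt_fourier h0 h1' (-x)).differentiableAt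
    exact h2.hasFDerivAt.comp x (hasFDerivAt_id x).neg
  have h3 : fderiv ℝ (rep u) x = Complex.reCLM.comp ((fderiv ℝ (𝓕 F) (-x)).comp
      (-ContinuousLinearMap.id ℝ (Rn n))) := (Complex.reCLM.hasFDerivAt.comp x hd).fderiv
  rw [h3]
  refine ContinuousLinearMap.opNorm_le_bound _ ((norm_nonneg _).trans (hL 0)) fun y ↦ ?_
  refine (Complex.abs_re_le_norm _).trans ?_
  refine ((fderiv ℝ (𝓕 F) (-x)).le_opNorm _).trans ?_
  have h4 : ‖(-ContinuousLinearMap.id ℝ (Rn n)) y‖ = ‖y‖ := norm_neg y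
  exact mul_le_mul (hL _) h4.le (norm_nonneg _) ((norm_nonneg _).trans (hL 0))

theorem ae_eq_rep {u : Lp ℝ 2 (volume : Measure (Rn n))}
    (h0 : Integrable (𝓕 (complexify u) : L2 n) volume) : u =ᵐ[volume] rep u := by
  filter_upwards [complexify_coeFn u, ae_eq_fourierInv_fourier h0] with x h2 h3
  rw [rep, ← Real.fourierInv_eq_fourier_neg, ← h3, h2, Complex.ofReal_re]

theorem abs_rep_le (u : Lp ℝ 2 (volume : Measure (Rn n))) (x : Rn n) :
    |rep u x| ≤ ∫ ξ, ‖(𝓕 (complexify u) : L2 n) ξ‖ :=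
  (Complex.abs_re_le_norm _).trans (VectorFourier.norm_fourierIntegral_le_integral_norm _ _ _ _ _)

theorem complexify_sub (u v : Lp ℝ 2 (volume : Measure (Rn n))) :
    complexify (u - v) = complexify u - complexify v := by
  apply Lp.ext
  filter_upwards [complexify_coeFn u, complexify_coeFn v, complexify_coeFn (u - v),
    Lp.coeFn_sub u v, Lp.coeFn_sub (complexify u) (complexify v)] with x h1 h2 h3 h4 h5
  rw [h3, h4, h5, Pi.sub_apply, Pi.sub_apply, h1, h2, Complex.ofReal_sub]

theorem rep_sub {u v : Lp ℝ 2 (volume : Measure (Rn n))}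
    (hu : Integrable (𝓕 (complexify u) : L2 n) volume)
    (hv : Integrable (𝓕 (complexify v) : L2 n) volume) (x : Rn n) :
    rep (u - v) x = rep u x - rep v x := by
  have h1 : ((𝓕 (complexify (u - v)) : L2 n) : Rn n → ℂ) =ᵐ[volume]
      fun ξ ↦ (𝓕 (complexify u) : L2 n) ξ - (𝓕 (complexify v) : L2 n) ξ := by
    rw [complexify_sub, show (𝓕 (complexify u - complexify v) : L2 n) = 𝓕 (complexify u) -
      𝓕 (complexify v) from map_sub (FourierTransform.fourierCLM ℂ (L2 n)) _ _]
    exact Lp.coeFn_sub _ _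
  have h2 : 𝓕 ((𝓕 (complexify (u - v)) : L2 n) : Rn n → ℂ) (-x) =
      𝓕 ((𝓕 (complexify u) : L2 n) : Rn n → ℂ) (-x) -
        𝓕 ((𝓕 (complexify v) : L2 n) : Rn n → ℂ) (-x) := by
    rw [Real.fourier_eq, Real.fourier_eq, Real.fourier_eq, ← integral_sub]
    · apply integral_congr_ae
      filter_upwards [h1] with ξ h
      rw [h, smul_sub]
    · exact (Real.fourierIntegral_convergent_iff (-x)).2 hu
    · exact (Real.fourierIntegral_convergent_iff (-x)).2 hv
  rw [rep, h2, Complex.sub_re, rep, rep]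

theorem fderiv_stdVec_eq {U : Rn n → ℝ} (hU : ContDiff ℝ 1 U) (x : Rn n) (j : Fin n) :
    gradient U x j = fderiv ℝ U x (stdVec j) := by
  have h1 := (hU.differentiable one_ne_zero x).hasGradientAt.hasFDerivAt.fderiv
  rw [h1, InnerProductSpace.toDual_apply_apply]
  generalize gradient U x = w
  simp [stdVec, EuclideanSpace.inner_single_right]

/-- The weak gradient of a continuously differentiable function is the classical one. -/
theorem HasWeakGradient.ae_eq {f U : Rn n → ℝ} (hU : ContDiff ℝ 1 U) (hf : f =ᵐ[volume] U)
    {g : Rn n → Rn n} (hg : HasWeakGradient f g) : g =ᵐ[volume] gradient U := by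
  have hj : ∀ j, (fun x ↦ g x j) =ᵐ[volume] fun x ↦ fderiv ℝ U x (stdVec j) := by
    intro j
    have hc : Continuous fun x ↦ fderiv ℝ U x (stdVec j) :=
      (hU.continuous_fderiv one_ne_zero).clm_apply continuous_const
    have hloc : LocallyIntegrable (fun x ↦ g x j) volume := by
      intro x
      obtain ⟨s, hs, hi⟩ := hg.1 x
      exact ⟨s, hs, (EuclideanSpace.proj j : Rn n →L[ℝ] ℝ).integrable_comp hi⟩
    refine ae_eq_of_integral_contDiff_smul_eq hloc hc.locallyIntegrable fun ψ h1 h2 ↦ ?_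
    have h3 := hg.2 ψ h1 h2 j
    have h4 : ∫ x, f x * lineDeriv ℝ ψ x (stdVec j) = ∫ x, U x * fderiv ℝ ψ x (stdVec j) := by
      apply integral_congr_ae
      filter_upwards [hf] with x hx
      rw [hx, (h1.differentiable (by simp) x).lineDeriv_eq_fderiv]
    have h5 : HasCompactSupport fun x ↦ fderiv ℝ ψ x (stdVec j) := h2.fderiv_apply ℝ _
    have h6 : Continuous fun x ↦ fderiv ℝ ψ x (stdVec j) :=
      (h1.continuous_fderiv (by simp)).clm_apply continuous_const
    have h7 := integral_mul_fderiv_eq_neg_fderiv_mul_of_integrable (μ := volume) (f := U) (g := ψ)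
      (v := stdVec j)
      ((hc.mul h1.continuous).integrable_of_hasCompactSupport h2.mul_left)
      ((hU.continuous.mul h6).integrable_of_hasCompactSupport h5.mul_left)
      ((hU.continuous.mul h1.continuous).integrable_of_hasCompactSupport h2.mul_left)
      (fun x _ ↦ hU.differentiable one_ne_zero x) (fun x _ ↦ h1.differentiable (by simp) x)
    have h8 : ∫ x, g x j * ψ x = ∫ x, fderiv ℝ U x (stdVec j) * ψ x := by
      rw [h4, h7] at h3
      linarith
    simpa [smul_eq_mul, mul_comm] using h8
  have hall : ∀ᵐ x, ∀ j, g x j = fderiv ℝ U x (stdVec j) := ae_all_iff.2 hj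
  filter_upwards [hall] with x hx
  ext j
  rw [hx, fderiv_stdVec_eq hU]

theorem gradSupNorm_eq {f U : Rn n → ℝ} (hU : ContDiff ℝ 1 U) (hf : f =ᵐ[volume] U)
    {g : Rn n → Rn n} (hg : HasWeakGradient f g) : gradSupNorm f = eLpNorm (gradient U) ⊤ volume := by
  apply le_antisymm
  · exact (iInf₂_le g hg).trans_eq (eLpNorm_congr_ae (hg.ae_eq hU hf))
  · exact le_iInf₂ fun g' hg' ↦ (eLpNorm_congr_ae (hg'.ae_eq hU hf)).ge

theorem enorm_le_of_continuous {F : Rn n → Rn n} (hF : Continuous F) (x : Rn n) :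
    ‖F x‖ₑ ≤ eLpNorm F ⊤ volume := by
  by_contra! h
  have ho : IsOpen {y | eLpNorm F ⊤ volume < ‖F y‖ₑ} := isOpen_lt continuous_const hF.enorm
  have h0 : volume {y | eLpNorm F ⊤ volume < ‖F y‖ₑ} = 0 := by
    have := ae_le_eLpNormEssSup (f := F) (μ := volume)
    rw [← eLpNorm_exponent_top, ae_iff] at this
    simpa using this
  exact (ho.measure_pos volume ⟨x, h⟩).ne' h0

/-- The Lipschitz constant of a differentiable representative is the supremum norm of the weak
gradient. -/
theorem norm_fderiv_le_gradSupNorm {f U : Rn n → ℝ} (hU : ContDiff ℝ 1 U) (hf : f =ᵐ[volume] U)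
    {g : Rn n → Rn n} (hg : HasWeakGradient f g) (hfin : gradSupNorm f ≠ ⊤) (x : Rn n) :
    ‖fderiv ℝ U x‖ ≤ (gradSupNorm f).toReal := by
  have h1 : Continuous (gradient U) := by
    have := hU.continuous_fderiv one_ne_zero
    unfold gradient
    fun_prop
  have h2 := enorm_le_of_continuous h1 x
  rw [← gradSupNorm_eq hU hf hg] at h2
  have h3 := ENNReal.toReal_mono hfin h2
  rw [toReal_enorm] at h3
  have h4 : ‖gradient U x‖ = ‖fderiv ℝ U x‖ := by
    rw [gradient, LinearIsometryEquiv.norm_map]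
  rwa [← h4]

theorem abs_sub_le_of_fderiv {U : Rn n → ℝ} (hU : ContDiff ℝ 1 U) {ℓ : ℝ}
    (h : ∀ x, ‖fderiv ℝ U x‖ ≤ ℓ) (x y : Rn n) : |U x - U y| ≤ ℓ * ‖x - y‖ :=
  Convex.norm_image_sub_le_of_norm_fderiv_le (fun z _ ↦ hU.differentiable one_ne_zero z)
    (fun z _ ↦ h z) convex_univ (mem_univ y) (mem_univ x)

/-- The transport term in divergence form. -/
theorem integral_transport {U : Rn n → ℝ} (hU : ContDiff ℝ 1 U) {B ℓ : ℝ} (hB : ∀ x, |U x| ≤ B)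
    (hℓ : ∀ x, ‖fderiv ℝ U x‖ ≤ ℓ) (ψ : 𝓢(Rn n, ℂ)) (j : Fin n) :
    ∫ x, ((U x * fderiv ℝ U x (stdVec j) : ℝ) : ℂ) * ψ x =
      -(1 / 2) * ∫ x, ((U x ^ 2 : ℝ) : ℂ) * (∂_{stdVec j} ψ : 𝓢(Rn n, ℂ)) x := by
  have hB0 : 0 ≤ B := (abs_nonneg _).trans (hB 0)
  set V : Rn n → ℂ := fun x ↦ ((U x ^ 2 : ℝ) : ℂ) with hV
  have hVd : Differentiable ℝ V :=
    Complex.ofRealCLM.differentiable.comp ((hU.differentiable one_ne_zero).pow 2)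
  have hVf : ∀ x, fderiv ℝ V x (stdVec j) = ((2 * U x * fderiv ℝ U x (stdVec j) : ℝ) : ℂ) := by
    intro x
    have h1 : HasFDerivAt (fun y ↦ U y ^ 2) ((2 * U x) • fderiv ℝ U x) x := by
      have := (hU.differentiable one_ne_zero x).hasFDerivAt.pow 2
      simpa using this
    have h2 := (Complex.ofRealCLM.hasFDerivAt (x := U x ^ 2)).comp x h1
    have h3 : fderiv ℝ V x = Complex.ofRealCLM.comp ((2 * U x) • fderiv ℝ U x) := h2.fderiv
    rw [h3]
    simp
  have hψd : ∀ x, fderiv ℝ ψ x (stdVec j) = (∂_{stdVec j} ψ : 𝓢(Rn n, ℂ)) x := fun x ↦ by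
    rw [SchwartzMap.lineDerivOp_apply_eq_fderiv]
  have hVc : Continuous V := hVd.continuous
  have hVb : ∀ x, ‖V x‖ ≤ B ^ 2 := fun x ↦ by
    rw [hV, Complex.norm_real, Real.norm_eq_abs, abs_pow]
    gcongr
    exact hB x
  have hDc : Continuous fun x ↦ fderiv ℝ V x (stdVec j) := by
    simp_rw [hVf]
    have h1 : Continuous fun x ↦ fderiv ℝ U x (stdVec j) :=
      (hU.continuous_fderiv one_ne_zero).clm_apply continuous_const
    have h2 := hU.continuous
    fun_prop
  have hDb : ∀ x, ‖fderiv ℝ V x (stdVec j)‖ ≤ 2 * B * ℓ := fun x ↦ by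
    rw [hVf, Complex.norm_real, norm_mul, norm_mul]
    have h1 : ‖fderiv ℝ U x (stdVec j)‖ ≤ ℓ := by
      refine ((fderiv ℝ U x).le_opNorm _).trans ?_
      simpa [stdVec] using hℓ x
    rw [Real.norm_eq_abs (U x)]
    have := hB x
    simp only [Real.norm_ofNat]
    gcongr
  have h := integral_mul_fderiv_eq_neg_fderiv_mul_of_integrable (μ := volume) (f := V) (g := ψ)
    (v := stdVec j) (ψ.integrable.bdd_mul hDc.aestronglyMeasurable (ae_of_all _ hDb))
    (by
      simp_rw [hψd]
      exact (∂_{stdVec j} ψ : 𝓢(Rn n, ℂ)).integrable.bdd_mul hVc.aestronglyMeasurable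
        (ae_of_all _ hVb))
    (ψ.integrable.bdd_mul hVc.aestronglyMeasurable (ae_of_all _ hVb)) (fun x _ ↦ hVd x) (fun x _ ↦ ψ.differentiable x)
  simp_rw [hψd, hVf] at h
  rw [h, mul_neg, neg_mul, neg_neg, ← integral_const_mul]
  congr 1
  ext x
  push_cast
  ring

end FZK

end

noncomputable section

namespace FZK

variable {n : ℕ}

/-! ### From the weak to the strong equation for one block -/

/-- A curve in a Banach space whose images under a separating family of functionals are
differentiable, with derivatives coming from a continuous curve, is differentiable. -/
theorem hasDerivAt_of_separating {E ι : Type*} [NormedAddCommGroup E] [NormedSpace ℝ E]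
    [CompleteSpace E] (L : ι → E →L[ℝ] ℂ) (hsep : ∀ e, (∀ i, L i e = 0) → e = 0) {X Y : ℝ → E}
    {a b : ℝ} (hY : ContinuousOn Y (Ioo a b))
    (h : ∀ t ∈ Ioo a b, ∀ i, HasDerivAt (fun τ ↦ L i (X τ)) (L i (Y t)) t) {t : ℝ}
    (ht : t ∈ Ioo a b) : HasDerivAt X (Y t) t := by
  have hsub : ∀ t' ∈ Ioo a b, uIcc t t' ⊆ Ioo a b := fun t' ht' ↦
    (convex_Ioo a b).ordConnected.uIcc_subset ht ht'
  have hint : ∀ t' ∈ Ioo a b, IntervalIntegrable Y volume t t' := fun t' ht' ↦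
    (hY.mono (hsub t' ht')).intervalIntegrable
  -- the fundamental theorem of calculus, checked on each functional
  have hX : ∀ t' ∈ Ioo a b, X t' = X t + ∫ τ in t..t', Y τ := by
    intro t' ht'
    rw [← sub_eq_zero]
    apply hsep
    intro i
    have h1 : ∫ τ in t..t', L i (Y τ) = L i (X t') - L i (X t) :=
      intervalIntegral.integral_eq_sub_of_hasDerivAt
        (fun τ hτ ↦ h τ (hsub t' ht' hτ) i)
        (((L i).continuous.comp_continuousOn (hY.mono (hsub t' ht'))).intervalIntegrable)
    rw [map_sub, map_add, ← (L i).intervalIntegral_comp_comm (hint t' ht'), h1]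
    ring
  have hd : HasDerivAt (fun t' ↦ X t + ∫ τ in t..t', Y τ) (Y t) t := by
    refine (intervalIntegral.integral_hasDerivAt_right (hint t ht) ?_
      (hY.continuousAt (Ioo_mem_nhds ht.1 ht.2))).const_add _
    exact hY.stronglyMeasurableAtFilter isOpen_Ioo t ht
  refine hd.congr_of_eventuallyEq ?_
  filter_upwards [Ioo_mem_nhds ht.1 ht.2] with t' ht'
  exact hX t' ht'

/-- Integration against a Schwartz function, as a functional on `L²`. -/
def testFun (ψ : 𝓢(Rn n, ℂ)) : L2 n →L[ℝ] ℂ :=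
  (innerSL ℂ ((memLp_conj (ψ.memLp 2 volume)).toLp _)).restrictScalars ℝ

theorem testFun_apply (ψ : 𝓢(Rn n, ℂ)) (f : L2 n) :
    testFun ψ f = (Lp.toTemperedDistribution f : 𝓢'(Rn n, ℂ)) ψ := by
  rw [toTD_apply, integral_mul_eq_inner (ψ.memLp 2 volume)]
  rfl

theorem testFun_separating (f : L2 n) (h : ∀ ψ : 𝓢(Rn n, ℂ), testFun ψ f = 0) : f = 0 := by
  apply Lp.ext
  refine ae_eq_of_integral_schwartz (locallyIntegrable_L2 _) (locallyIntegrable_L2 _) fun ψ _ ↦ ?_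
  rw [← toTD_apply, ← toTD_apply, ← testFun_apply, ← testFun_apply, h, map_zero]

/-- The square of a function with integrable Fourier transform, as an `L²` function. -/
def square (u : Lp ℝ 2 (volume : Measure (Rn n))) : L2 n :=
  mulOp (fun x ↦ (rep u x : ℂ)) (complexify u)

theorem fracLaplacian_spec {α s : ℝ} (hα : 0 ≤ α) (hs : α ≤ s) {f : L2 n} (hf : MemSob s f) :
    (𝓕 (fracLaplacian α f) : L2 n) =ᵐ[volume]
      fun ξ ↦ ((‖(2 * Real.pi) • ξ‖ ^ α : ℝ) : ℂ) * (𝓕 f : L2 n) ξ := by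
  have h : MemLp (fun ξ : Rn n ↦ ((‖(2 * Real.pi) • ξ‖ ^ α : ℝ) : ℂ) * (𝓕 f : L2 n) ξ) 2
      volume := by
    refine (hf.mono hs).memLp.mono ?_ (ae_of_all _ fun ξ ↦ ?_)
    · have hc : Continuous fun ξ : Rn n ↦ ((‖(2 * Real.pi) • ξ‖ ^ α : ℝ) : ℂ) := by
        have h1 : Continuous fun ξ : Rn n ↦ ‖(2 * Real.pi) • ξ‖ := by fun_prop
        exact Complex.continuous_ofReal.comp (h1.rpow_const fun _ ↦ Or.inr hα)
      exact hc.aestronglyMeasurable.mul (Lp.aestronglyMeasurable _)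
    · rw [norm_mul, norm_mul, norm_besselSymbol, Complex.norm_real,
        Real.norm_of_nonneg (by positivity)]
      gcongr
      have h2 : ‖(2 * Real.pi) • ξ‖ ^ α = (‖(2 * Real.pi) • ξ‖ ^ 2) ^ (α / 2) := by
        rw [← Real.rpow_natCast, ← Real.rpow_mul (norm_nonneg _)]
        congr 1
        push_cast
        ring
      rw [h2]
      gcongr
      linarith
  rw [fracLaplacian, dif_pos h, FourierTransform.fourier_fourierInv_eq]
  exact h.coeFn_toLp

/-- A Schwartz multiplier, moved to the test function. -/
theorem toTD_mult_apply (m : 𝓢(Rn n, ℂ)) (f : L2 n) (ψ : 𝓢(Rn n, ℂ)) :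
    (Lp.toTemperedDistribution (mult m f) : 𝓢'(Rn n, ℂ)) ψ =
      ∫ ξ, (𝓕⁻ ψ : 𝓢(Rn n, ℂ)) ξ * (m ξ * (𝓕 f : L2 n) ξ) := by
  have h : (Lp.toTemperedDistribution (mult m f) : 𝓢'(Rn n, ℂ)) ψ =
      ∫ ξ, (𝓕⁻ ψ : 𝓢(Rn n, ℂ)) ξ * (𝓕 (mult m f) : L2 n) ξ := by
    rw [toTD_apply, integral_schwartz_mul_fourier, FourierTransform.fourier_fourierInv_eq]
  rw [h]
  apply integral_congr_ae
  filter_upwards [coeFn_fourier_mult (bddMeas_schwartz m) f] with ξ hξ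
  rw [hξ]

/-- The test function that realises a Schwartz multiplier by duality. -/
def dualTest (m ψ : 𝓢(Rn n, ℂ)) : 𝓢(Rn n, ℂ) := 𝓕 (SchwartzMap.smulLeftCLM ℂ m (𝓕⁻ ψ))

theorem fourierInv_dualTest (m ψ : 𝓢(Rn n, ℂ)) (ξ : Rn n) :
    (𝓕⁻ (dualTest m ψ) : 𝓢(Rn n, ℂ)) ξ = m ξ * (𝓕⁻ ψ : 𝓢(Rn n, ℂ)) ξ := by
  rw [dualTest, FourierTransform.fourierInv_fourier_eq,
    SchwartzMap.smulLeftCLM_apply_apply m.hasTemperateGrowth, smul_eq_mul]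

theorem toTD_dualTest (m : 𝓢(Rn n, ℂ)) (f : L2 n) (ψ : 𝓢(Rn n, ℂ)) :
    (Lp.toTemperedDistribution f : 𝓢'(Rn n, ℂ)) (dualTest m ψ) =
      (Lp.toTemperedDistribution (mult m f) : 𝓢'(Rn n, ℂ)) ψ := by
  rw [toTD_mult_apply, toTD_apply]
  have := integral_schwartz_mul_fourier f (𝓕⁻ (dualTest m ψ))
  rw [FourierTransform.fourier_fourierInv_eq] at this
  rw [← this]
  refine integral_congr_ae (ae_of_all _ fun ξ ↦ ?_)
  simp only [fourierInv_dualTest]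
  ring

variable [NeZero n]

/-- The time derivative of the `k`-th block of a solution: the block of
`∂_{x₁} (-Δ) ^ (α / 2) u - ∂_{x₁} (u²) / 2`, with the powers of `2 ^ k` made explicit. -/
def blkDeriv (α : ℝ) (k : ℕ) (u : Lp ℝ 2 (volume : Measure (Rn n))) : L2 n :=
  ((((2 : ℝ) ^ k) * ((2 : ℝ) ^ k) ^ α : ℝ) : ℂ) •
      mult (dyad k (dispSym α)) (blk k (complexify u)) -
    ((((2 : ℝ) ^ k / 2 : ℝ)) : ℂ) • mult (dyad k dannSym) (square u)

theorem dsym_hasTemperateGrowth : (dsym : Rn n → ℂ).HasTemperateGrowth :=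
  coordSymbol_hasTemperateGrowth 0

theorem lineDeriv_zero_eq (F : 𝓢'(Rn n, ℂ)) :
    ∂_{stdVec (0 : Fin n)} F = TemperedDistribution.fourierMultiplierCLM ℂ dsym F :=
  lineDeriv_eq_multiplier 0 F

theorem lineDeriv_toTD_dualTest (m : 𝓢(Rn n, ℂ)) (f : L2 n) (ψ : 𝓢(Rn n, ℂ)) :
    (∂_{stdVec (0 : Fin n)} (Lp.toTemperedDistribution f : 𝓢'(Rn n, ℂ))) (dualTest m ψ) =
      ∫ ξ, (𝓕⁻ ψ : 𝓢(Rn n, ℂ)) ξ * (dsym ξ * m ξ * (𝓕 f : L2 n) ξ) := by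
  rw [lineDeriv_zero_eq, TemperedDistribution.fourierMultiplierCLM_apply_apply, toTD_apply,
    ← integral_schwartz_mul_fourier]
  refine integral_congr_ae (ae_of_all _ fun ξ ↦ ?_)
  simp only [SchwartzMap.smulLeftCLM_apply_apply dsym_hasTemperateGrowth, fourierInv_dualTest,
    smul_eq_mul]
  ring

theorem dsym_mul_dyad (k : ℕ) (ξ : Rn n) :
    dsym ξ * dyad k annSym ξ = (((2 : ℝ) ^ k : ℝ) : ℂ) * dyad k dannSym ξ := by
  have h : dsym ξ = (((2 : ℝ) ^ k : ℝ) : ℂ) * dsym (((2 : ℝ) ^ k)⁻¹ • ξ) := by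
    rw [dsym_smul]
    push_cast
    field_simp
  rw [h, dyad_apply, dyad_apply, annSym_apply, dannSym_apply, mul_assoc]

theorem dispersion_mul_dyad (α : ℝ) (k : ℕ) (ξ : Rn n) :
    dsym ξ * dyad k annSym ξ * ((‖(2 * Real.pi) • ξ‖ ^ α : ℝ) : ℂ) =
      ((((2 : ℝ) ^ k) * ((2 : ℝ) ^ k) ^ α : ℝ) : ℂ) * (dyad k (dispSym α) ξ * dyad k annSym ξ) := by
  have hR : (0 : ℝ) < 2 ^ k := by positivity
  rw [dyad_apply, dyad_apply, annSym_apply, dispSym_apply]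
  set η := ((2 : ℝ) ^ k)⁻¹ • ξ with hη
  have hξ : ξ = (2 : ℝ) ^ k • η := by rw [hη, smul_inv_smul₀ hR.ne']
  by_cases h : 1 ≤ ‖η‖ ∧ ‖η‖ ≤ 4
  · have h1 : ‖(2 * Real.pi) • ξ‖ ^ α = ((2 : ℝ) ^ k) ^ α * ‖(2 * Real.pi) • η‖ ^ α := by
      rw [hξ, smul_comm, norm_smul, Real.norm_of_nonneg hR.le,
        Real.mul_rpow hR.le (norm_nonneg _)]
    rw [h1, dispReal, wideReal_eq_one (by linarith [h.1]) (by linarith [h.2]), hξ, dsym_smul, dsym]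
    push_cast
    ring
  · have h0 : annReal η = 0 := by
      rw [not_and_or, not_le, not_le] at h
      exact h.elim (fun h ↦ annReal_eq_zero_of_le h.le) (fun h ↦ annReal_eq_zero_of_ge h.le)
    rw [h0]
    simp

/-- The equation, tested against the `k`-th block of a test function. -/
theorem eqn_dualTest {α s : ℝ} (hα : 0 ≤ α) (hs : α ≤ s)
    {u : Lp ℝ 2 (volume : Measure (Rn n))} (hf : MemSob s (complexify u))
    (h0 : Integrable (𝓕 (complexify u) : L2 n) volume)
    (h1 : Integrable (fun ξ ↦ ‖ξ‖ ^ 1 * ‖(𝓕 (complexify u) : L2 n) ξ‖) volume)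
    {g : Rn n → Rn n} (hg : HasWeakGradient u g) {ℓ : ℝ} (hℓ : ∀ x, ‖fderiv ℝ (rep u) x‖ ≤ ℓ)
    (k : ℕ) (ψ : 𝓢(Rn n, ℂ)) :
    (∂_{stdVec (0 : Fin n)} (Lp.toTemperedDistribution
          (fracLaplacian α (complexify u)) : 𝓢'(Rn n, ℂ))) (dualTest (dyad k annSym) ψ)
        - ∫ x, ((u x * g x 0 : ℝ) : ℂ) * dualTest (dyad k annSym) ψ x =
      (Lp.toTemperedDistribution (blkDeriv α k u) : 𝓢'(Rn n, ℂ)) ψ := by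
  set f := complexify u with hfdef
  have hU := contDiff_rep h0 h1
  have hB := abs_rep_le u
  have hbdd : BddMeas fun x ↦ (rep u x : ℂ) := .ofReal hU.continuous hB
  have e1 : (∂_{stdVec (0 : Fin n)} (Lp.toTemperedDistribution
      (fracLaplacian α f) : 𝓢'(Rn n, ℂ))) (dualTest (dyad k annSym) ψ) =
      ((((2 : ℝ) ^ k) * ((2 : ℝ) ^ k) ^ α : ℝ) : ℂ) *
        (Lp.toTemperedDistribution (mult (dyad k (dispSym α)) (blk k f)) : 𝓢'(Rn n, ℂ)) ψ := by
    rw [lineDeriv_toTD_dualTest, toTD_mult_apply, ← integral_const_mul]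
    apply integral_congr_ae
    filter_upwards [fracLaplacian_spec hα hs hf,
      coeFn_fourier_mult (bddMeas_schwartz (dyad k annSym)) f] with ξ h2 h3
    rw [h2, blk, h3]
    have := dispersion_mul_dyad α k ξ
    linear_combination ((𝓕⁻ ψ : 𝓢(Rn n, ℂ)) ξ * (𝓕 f : L2 n) ξ) * this
  have e2 : ∫ x, ((u x * g x 0 : ℝ) : ℂ) * dualTest (dyad k annSym) ψ x =
      (((2 : ℝ) ^ k / 2 : ℝ) : ℂ) *
        (Lp.toTemperedDistribution (mult (dyad k dannSym) (square u)) : 𝓢'(Rn n, ℂ)) ψ := by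
    have e3 : ∫ x, ((u x * g x 0 : ℝ) : ℂ) * dualTest (dyad k annSym) ψ x =
        ∫ x, ((rep u x * fderiv ℝ (rep u) x (stdVec 0) : ℝ) : ℂ) *
          dualTest (dyad k annSym) ψ x := by
      apply integral_congr_ae
      filter_upwards [ae_eq_rep h0, hg.ae_eq hU (ae_eq_rep h0)] with x h2 h3
      rw [h2, h3, fderiv_stdVec_eq hU]
    have e4 : (∂_{stdVec (0 : Fin n)} (Lp.toTemperedDistribution (square u) : 𝓢'(Rn n, ℂ)))
        (dualTest (dyad k annSym) ψ) =
        - ∫ x, ((rep u x ^ 2 : ℝ) : ℂ) * (∂_{stdVec (0 : Fin n)} (dualTest (dyad k annSym) ψ) : 𝓢(Rn n, ℂ)) x := by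
      rw [TemperedDistribution.lineDerivOp_apply_apply, map_neg, toTD_apply]
      congr 1
      apply integral_congr_ae
      filter_upwards [coeFn_mulOp hbdd f, complexify_coeFn u, ae_eq_rep h0] with x h2 h3 h4
      rw [square, h2, h3, h4]
      push_cast
      ring
    have e5 : (∂_{stdVec (0 : Fin n)} (Lp.toTemperedDistribution (square u) : 𝓢'(Rn n, ℂ)))
        (dualTest (dyad k annSym) ψ) = (((2 : ℝ) ^ k : ℝ) : ℂ) *
        (Lp.toTemperedDistribution (mult (dyad k dannSym) (square u)) : 𝓢'(Rn n, ℂ)) ψ := by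
      rw [lineDeriv_toTD_dualTest, toTD_mult_apply, ← integral_const_mul]
      refine integral_congr_ae (ae_of_all _ fun ξ ↦ ?_)
      simp only [dsym_mul_dyad]
      ring
    rw [e3, integral_transport hU hB hℓ]
    rw [e5] at e4
    push_cast at e4 ⊢
    linear_combination (-1 / 2 : ℂ) * e4
  rw [e1, e2, ← testFun_apply, ← testFun_apply, ← testFun_apply, blkDeriv, map_sub,
    testFun_apply, testFun_apply, testFun_apply, testFun_apply, toTD_apply, toTD_apply, toTD_apply,
    toTD_apply, ← integral_const_mul, ← integral_const_mul]
  congr 1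
  · apply integral_congr_ae
    filter_upwards [Lp.coeFn_smul ((((2 : ℝ) ^ k) * ((2 : ℝ) ^ k) ^ α : ℝ) : ℂ)
      (mult (dyad k (dispSym α)) (blk k (complexify u)))] with x h2
    rw [h2, Pi.smul_apply, smul_eq_mul]
    ring
  · apply integral_congr_ae
    filter_upwards [Lp.coeFn_smul ((((2 : ℝ) ^ k / 2 : ℝ)) : ℂ)
      (mult (dyad k dannSym) (square u))] with x h2
    rw [h2, Pi.smul_apply, smul_eq_mul]
    ring

end FZK

end

noncomputable section

namespace FZK

variable {n : ℕ}

/-! ### Solutions as curves in `L²` -/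

theorem sobolevNorm_add_le (σ : ℝ) (f g : L2 n) :
    sobolevNorm σ (Lp.toTemperedDistribution (f + g) : 𝓢'(Rn n, ℂ)) ≤
      sobolevNorm σ (Lp.toTemperedDistribution f : 𝓢'(Rn n, ℂ)) +
        sobolevNorm σ (Lp.toTemperedDistribution g : 𝓢'(Rn n, ℂ)) := by
  rw [sobolevNorm_toTD, sobolevNorm_toTD, sobolevNorm_toTD]
  have hm : ∀ h : L2 n, AEStronglyMeasurable
      (fun ξ ↦ besselSymbol n σ ξ * (𝓕 h : L2 n) ξ) volume := fun h ↦
    (besselSymbol_continuous σ).aestronglyMeasurable.mul (Lp.aestronglyMeasurable _)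
  refine le_trans (eLpNorm_congr_ae ?_).le (eLpNorm_add_le (hm f) (hm g) (by norm_num))
  have h1 : (𝓕 (f + g) : L2 n) = 𝓕 f + 𝓕 g := FourierTransform.fourier_add f g
  rw [h1]
  filter_upwards [Lp.coeFn_add (𝓕 f : L2 n) (𝓕 g)] with ξ h
  rw [h, Pi.add_apply, Pi.add_apply, mul_add]

theorem sobolevNorm_sub_comm (σ : ℝ) (f g : L2 n) :
    sobolevNorm σ (Lp.toTemperedDistribution (f - g) : 𝓢'(Rn n, ℂ)) =
      sobolevNorm σ (Lp.toTemperedDistribution (g - f) : 𝓢'(Rn n, ℂ)) := by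
  rw [sobolevNorm_toTD, sobolevNorm_toTD]
  refine eLpNorm_congr_norm_ae ?_
  have h1 : (𝓕 (f - g) : L2 n) = -𝓕 (g - f) := by
    rw [← neg_sub, FourierTransform.fourier_neg]
  rw [h1]
  filter_upwards [Lp.coeFn_neg (𝓕 (g - f) : L2 n)] with ξ h
  rw [h, Pi.neg_apply, mul_neg, norm_neg]

theorem MemSob.sub {σ : ℝ} {f g : L2 n} (hf : MemSob σ f) (hg : MemSob σ g) :
    MemSob σ (f - g) := by
  have h := sobolevNorm_add_le σ (f - g) g
  have h2 := sobolevNorm_add_le σ f (0 - g)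
  have h3 := sobolevNorm_sub_comm σ 0 g
  rw [sub_zero] at h3
  rw [h3, zero_sub, ← sub_eq_add_neg] at h2
  exact h2.trans_lt (ENNReal.add_lt_top.2 ⟨hf, hg⟩)

theorem integrable_fourier {σ : ℝ} (hσ : (n : ℝ) / 2 < σ) {f : L2 n} (hf : MemSob σ f) :
    Integrable (𝓕 f : L2 n) volume := by
  obtain ⟨C, -, h⟩ := exists_integral_fourier_le (n := n) (σ := σ) 0 (by simpa using hσ)
  have h1 := (h f hf).1
  simp only [pow_zero, one_mul] at h1
  exact (integrable_norm_iff (Lp.aestronglyMeasurable _)).1 h1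

theorem integrable_fourier_moment {σ : ℝ} (hσ : (n : ℝ) / 2 + 1 < σ) {f : L2 n}
    (hf : MemSob σ f) : Integrable (fun ξ ↦ ‖ξ‖ ^ 1 * ‖(𝓕 f : L2 n) ξ‖) volume := by
  obtain ⟨C, -, h⟩ := exists_integral_fourier_le (n := n) (σ := σ) 1 (by simpa using hσ)
  exact (h f hf).1

theorem BddMeas.rep {σ : ℝ} (hσ : (n : ℝ) / 2 + 1 < σ) {u : Lp ℝ 2 (volume : Measure (Rn n))}
    (hf : MemSob σ (complexify u)) : BddMeas fun x ↦ (rep u x : ℂ) :=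
  .ofReal (contDiff_rep (integrable_fourier (by linarith) hf)
    (integrable_fourier_moment hσ hf)).continuous (abs_rep_le u)

/-- Squaring is locally Lipschitz from `H ^ σ` to `L²`. -/
theorem exists_norm_square_sub_le {σ : ℝ} (hσ : (n : ℝ) / 2 + 1 < σ) :
    ∃ C : ℝ, ∀ u v : Lp ℝ 2 (volume : Measure (Rn n)), MemSob σ (complexify u) →
      MemSob σ (complexify v) → ‖square v - square u‖ ≤
        C * sobR σ (complexify (v - u)) * (‖complexify v‖ + sobR σ (complexify u)) := by
  have hn : (0 : ℝ) ≤ n := Nat.cast_nonneg n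
  obtain ⟨C, hC0, hC⟩ := exists_integral_fourier_le (n := n) (σ := σ) 0 (by push_cast; linarith)
  simp only [pow_zero, one_mul] at hC
  refine ⟨C, fun u v hu hv ↦ ?_⟩
  have hvu : MemSob σ (complexify (v - u)) := by rw [complexify_sub]; exact hv.sub hu
  have hbu := BddMeas.rep hσ hu
  have hbv := BddMeas.rep hσ hv
  have e : square v - square u = mulOp (fun x ↦ (rep v x : ℂ) - (rep u x : ℂ)) (complexify v) +
      mulOp (fun x ↦ (rep u x : ℂ)) (complexify (v - u)) := by
    rw [mulOp_sub_left hbv hbu, complexify_sub, map_sub, square, square]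
    abel
  have h1 : ‖mulOp (fun x ↦ (rep v x : ℂ) - (rep u x : ℂ)) (complexify v)‖ ≤
      C * sobR σ (complexify (v - u)) * ‖complexify v‖ := by
    refine norm_mulOp_le (hbv.sub hbu).1 (fun x ↦ ?_) _
    rw [← Complex.ofReal_sub, ← rep_sub (integrable_fourier (by linarith) hv)
      (integrable_fourier (by linarith) hu), Complex.norm_real]
    exact (abs_rep_le _ x).trans (hC _ hvu).2
  have h2 : ‖mulOp (fun x ↦ (rep u x : ℂ)) (complexify (v - u))‖ ≤
      C * sobR σ (complexify u) * ‖complexify (v - u)‖ := by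
    refine norm_mulOp_le hbu.1 (fun x ↦ ?_) _
    rw [Complex.norm_real]
    exact (abs_rep_le _ x).trans (hC _ hu).2
  have h3 : ‖complexify (v - u)‖ ≤ sobR σ (complexify (v - u)) := hvu.norm_le (by linarith)
  calc ‖square v - square u‖ ≤ C * sobR σ (complexify (v - u)) * ‖complexify v‖ +
        C * sobR σ (complexify u) * sobR σ (complexify (v - u)) := by
        have := sobR_nonneg σ (complexify u)
        rw [e]
        refine (norm_add_le _ _).trans (add_le_add h1 (h2.trans ?_))
        gcongr
    _ = _ := by ring

section Solution

variable [NeZero n] {α s T : ℝ} {u : ℝ → Lp ℝ 2 (volume : Measure (Rn n))}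

theorem IsSolution.memSob (hu : IsSolution α s T u) {t : ℝ} (ht : t ∈ Ioo 0 T) :
    MemSob s (complexify (u t)) := hu.mem t ht

theorem IsSolution.tendsto_sobolevNorm (hu : IsSolution α s T u) {t₀ : ℝ} (ht : t₀ ∈ Ioo 0 T) :
    Tendsto (fun t ↦ sobolevNorm s (Lp.toTemperedDistribution (complexify (u t - u t₀)) :
      𝓢'(Rn n, ℂ))) (𝓝 t₀) (𝓝 0) := by
  refine (hu.cont t₀ ht).congr fun t ↦ ?_
  rw [complexify_sub]
  congr 1
  exact (map_sub (Lp.toTemperedDistributionCLM ℂ volume 2) _ _).symm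

theorem IsSolution.tendsto_sobR (hu : IsSolution α s T u) {t₀ : ℝ} (ht : t₀ ∈ Ioo 0 T) :
    Tendsto (fun t ↦ sobR s (complexify (u t - u t₀))) (𝓝 t₀) (𝓝 0) := by
  have := (ENNReal.tendsto_toReal ENNReal.zero_ne_top).comp (hu.tendsto_sobolevNorm ht)
  rwa [ENNReal.toReal_zero] at this

theorem IsSolution.memSob_sub (hu : IsSolution α s T u) {t t₀ : ℝ} (ht : t ∈ Ioo 0 T)
    (ht₀ : t₀ ∈ Ioo 0 T) : MemSob s (complexify (u t - u t₀)) := by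
  rw [complexify_sub]
  exact (hu.memSob ht).sub (hu.memSob ht₀)

theorem IsSolution.continuousOn (hu : IsSolution α s T u) (hs : 0 ≤ s) :
    ContinuousOn (fun t ↦ complexify (u t)) (Ioo 0 T) := by
  intro t₀ ht₀
  refine ContinuousAt.continuousWithinAt ?_
  rw [ContinuousAt, tendsto_iff_norm_sub_tendsto_zero]
  refine squeeze_zero' (Eventually.of_forall fun _ ↦ norm_nonneg _) ?_ (hu.tendsto_sobR ht₀)
  filter_upwards [Ioo_mem_nhds ht₀.1 ht₀.2] with t ht
  rw [← complexify_sub]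
  exact (hu.memSob_sub ht ht₀).norm_le hs

theorem IsSolution.continuousOn_square (hu : IsSolution α s T u) (hs : (n : ℝ) / 2 + 1 < s) :
    ContinuousOn (fun t ↦ square (u t)) (Ioo 0 T) := by
  have hn : (0 : ℝ) ≤ n := Nat.cast_nonneg n
  intro t₀ ht₀
  refine ContinuousAt.continuousWithinAt ?_
  obtain ⟨C, hC⟩ := exists_norm_square_sub_le hs
  have hc := (hu.continuousOn (by linarith)).continuousAt (Ioo_mem_nhds ht₀.1 ht₀.2)
  rw [ContinuousAt, tendsto_iff_norm_sub_tendsto_zero]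
  have hlim := ((hu.tendsto_sobR ht₀).const_mul C).mul
    (hc.norm.add_const (sobR s (complexify (u t₀))))
  rw [mul_zero, zero_mul] at hlim
  refine squeeze_zero' (Eventually.of_forall fun _ ↦ norm_nonneg _) ?_ hlim
  filter_upwards [Ioo_mem_nhds ht₀.1 ht₀.2] with t ht
  exact hC _ _ (hu.memSob ht₀) (hu.memSob ht)

theorem IsSolution.continuousOn_blkDeriv (hu : IsSolution α s T u) (hs : (n : ℝ) / 2 + 1 < s)
    (k : ℕ) : ContinuousOn (fun t ↦ blkDeriv α k (u t)) (Ioo 0 T) := by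
  have hn : (0 : ℝ) ≤ n := Nat.cast_nonneg n
  have hc (c : ℂ) : Continuous fun f : L2 n ↦ c • f := continuous_const_smul c
  have h1 : ContinuousOn (fun t ↦ mult (dyad k (dispSym α)) (blk k (complexify (u t)))) (Ioo 0 T) :=
    (mult _).continuous.comp_continuousOn
      ((blk k).continuous.comp_continuousOn (hu.continuousOn (by linarith)))
  have h2 : ContinuousOn (fun t ↦ mult (dyad k dannSym) (square (u t))) (Ioo 0 T) :=
    (mult _).continuous.comp_continuousOn (hu.continuousOn_square hs)
  exact ((hc _).comp_continuousOn h1).sub ((hc _).comp_continuousOn h2)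

theorem IsSolution.gradSupNorm_ne_top (hu : IsSolution α s T u) (hs : (n : ℝ) / 2 + 1 < s)
    {t : ℝ} (ht : t ∈ Ioo 0 T) : gradSupNorm (u t) ≠ ⊤ := by
  obtain ⟨g, hg, -⟩ := hu.eqn t ht
  have h0 := integrable_fourier (by linarith) (hu.memSob ht)
  have h1 := integrable_fourier_moment hs (hu.memSob ht)
  rw [gradSupNorm_eq (contDiff_rep h0 h1) (ae_eq_rep h0) hg]
  obtain ⟨L, hL⟩ := exists_norm_fderiv_rep_le h0 h1
  have h2 : eLpNorm (gradient (rep (u t))) ⊤ volume ≤ ENNReal.ofReal L := by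
    rw [eLpNorm_exponent_top]
    refine eLpNormEssSup_le_of_ae_bound (ae_of_all _ fun x ↦ ?_)
    rw [gradient, LinearIsometryEquiv.norm_map]
    exact hL x
  exact ne_top_of_le_ne_top ENNReal.ofReal_ne_top h2

theorem IsSolution.norm_fderiv_le (hu : IsSolution α s T u) (hs : (n : ℝ) / 2 + 1 < s)
    {t : ℝ} (ht : t ∈ Ioo 0 T) (x : Rn n) :
    ‖fderiv ℝ (rep (u t)) x‖ ≤ (gradSupNorm (u t)).toReal := by
  obtain ⟨g, hg, -⟩ := hu.eqn t ht
  have h0 := integrable_fourier (by linarith) (hu.memSob ht)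
  have h1 := integrable_fourier_moment hs (hu.memSob ht)
  exact norm_fderiv_le_gradSupNorm (contDiff_rep h0 h1) (ae_eq_rep h0) hg
    (hu.gradSupNorm_ne_top hs ht) x

/-- The blocks of a solution are differentiable curves in `L²`. -/
theorem IsSolution.hasDerivAt_blk (hu : IsSolution α s T u) (hs : (n : ℝ) / 2 + 1 < s)
    (hα : 0 ≤ α) (hαs : α ≤ s) (k : ℕ) {t : ℝ} (ht : t ∈ Ioo 0 T) :
    HasDerivAt (fun τ ↦ blk k (complexify (u τ))) (blkDeriv α k (u t)) t := by
  refine hasDerivAt_of_separating testFun testFun_separating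
    (hu.continuousOn_blkDeriv hs k) (fun t ht ψ ↦ ?_) ht
  obtain ⟨g, hg, h⟩ := hu.eqn t ht
  have h1 := h (dualTest (dyad k annSym) ψ)
  rw [eqn_dualTest hα hαs (hu.memSob ht) (integrable_fourier (by linarith) (hu.memSob ht))
    (integrable_fourier_moment hs (hu.memSob ht)) hg (hu.norm_fderiv_le hs ht) k ψ] at h1
  rw [testFun_apply]
  refine h1.congr_of_eventuallyEq (Eventually.of_forall fun τ ↦ ?_)
  simp only
  rw [testFun_apply, toDist, toTD_dualTest]
  rfl

/-- By continuity in `H ^ s` the essential supremum bounds every value. -/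
theorem IsSolution.sobolevNorm_le (hu : IsSolution α s T u) {t : ℝ} (ht : t ∈ Ioo 0 T) :
    sobolevNorm s (toDist (u t)) ≤ normLinftyHs T s u := by
  refine ENNReal.le_of_forall_pos_le_add fun ε hε _ ↦ ?_
  have hae : ∀ᵐ τ, τ ∈ Ioo 0 T → sobolevNorm s (toDist (u τ)) ≤ normLinftyHs T s u :=
    (ae_restrict_iff' measurableSet_Ioo).1 (ENNReal.ae_le_essSup _)
  have hd : Dense {τ | τ ∈ Ioo 0 T → sobolevNorm s (toDist (u τ)) ≤ normLinftyHs T s u} :=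
    Measure.dense_of_ae hae
  have hev : ∀ᶠ τ in 𝓝 t, τ ∈ Ioo 0 T ∧ sobolevNorm s (Lp.toTemperedDistribution
      (complexify (u τ - u t)) : 𝓢'(Rn n, ℂ)) < ε :=
    (show ∀ᶠ τ in 𝓝 t, τ ∈ Ioo 0 T from Ioo_mem_nhds ht.1 ht.2).and
      ((hu.tendsto_sobolevNorm ht).eventually_lt_const (by exact_mod_cast hε))
  obtain ⟨V, hV, hVo, htV⟩ := eventually_nhds_iff.1 hev
  obtain ⟨τ, hτV, hτ⟩ := hd.inter_open_nonempty V hVo ⟨t, htV⟩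
  obtain ⟨h1, h2⟩ := hV τ hτV
  rw [complexify_sub, sobolevNorm_sub_comm] at h2
  have h3 := sobolevNorm_add_le s (complexify (u t) - complexify (u τ)) (complexify (u τ))
  rw [sub_add_cancel, add_comm] at h3
  exact h3.trans (add_le_add (hτ h1) h2.le)

end Solution

end FZK

end

noncomputable section

namespace FZK

variable {n : ℕ} [NeZero n]

/-! ### The energy estimate -/

/-- The `k`-th term of the smoothing functional: the weighted energy, at the regularity
`s + α / 2`, of the `k`-th block. -/
def smoothTerm (α s : ℝ) (g : Rn n → ℝ) (k : ℕ) (f : L2 n) : ℝ :=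
  ((4 : ℝ) ^ s) ^ k * (((2 : ℝ) ^ k) ^ α * ‖mulOp (fun x ↦ (g x : ℂ)) (blk k f)‖ ^ 2)

omit [NeZero n] in
theorem smoothTerm_nonneg (α s : ℝ) (g : Rn n → ℝ) (k : ℕ) (f : L2 n) :
    0 ≤ smoothTerm α s g k f := by
  unfold smoothTerm
  positivity

theorem two_mul_re_inner_blkDeriv (α : ℝ) (k : ℕ) (u : Lp ℝ 2 (volume : Measure (Rn n)))
    (v : L2 n) : 2 * (inner ℂ v (blkDeriv α k u) : ℂ).re =
      ((2 : ℝ) ^ k) ^ α * (2 * (2 : ℝ) ^ k *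
        (inner ℂ v (mult (dyad k (dispSym α)) (blk k (complexify u))) : ℂ).re) -
      (2 : ℝ) ^ k * (inner ℂ v (mult (dyad k dannSym) (square u)) : ℂ).re := by
  rw [blkDeriv, inner_sub_right, inner_smul_right, inner_smul_right, Complex.sub_re,
    Complex.re_ofReal_mul, Complex.re_ofReal_mul]
  ring

/-- The time derivative of the weighted energy of the first `N` blocks of a solution. -/
def energyDeriv (α s : ℝ) (φ : Rn n → ℝ) (N : ℕ) (u : Lp ℝ 2 (volume : Measure (Rn n))) : ℝ :=
  ∑ k ∈ Finset.range N, ((4 : ℝ) ^ s) ^ k *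
    (2 * (inner ℂ (mulOp (fun x ↦ (φ x : ℂ)) (blk k (complexify u))) (blkDeriv α k u) : ℂ).re)

/-- The time derivative of the weighted energy of the blocks is controlled, with a gain coming from
the dispersion. -/
theorem exists_energy_deriv_le {α s r : ℝ} (hα : 0 < α) (hα₂ : α < 2)
    (hs : (n : ℝ) / 2 + 1 < s) (hr : (n : ℝ) / 2 < r) (hrs : r ≤ s) {ν : Rn n} {c₀ : ℝ}
    (hc₀ : 0 < c₀)
    (hform : ∀ ξ : Rn n, c₀ * ‖ξ‖ ^ 2 ≤ ν 0 * ‖ξ‖ ^ 2 + α * ξ 0 * inner ℝ ν ξ) (Λ : ℝ) :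
    ∃ c C : ℝ, 0 < c ∧ 0 ≤ C ∧ ∀ φ g : Rn n → ℝ, Weight ν Λ φ g →
      ∀ u : Lp ℝ 2 (volume : Measure (Rn n)), MemSob s (complexify u) →
      ∀ ℓ : ℝ, (∀ x, ‖fderiv ℝ (rep u) x‖ ≤ ℓ) → ∀ N : ℕ,
      energyDeriv α s φ N u ≤
      -c * ∑ k ∈ Finset.range N, smoothTerm α s g k (complexify u) +
        C * (1 + sobR r (complexify u) + ℓ) * sobR s (complexify u) ^ 2 := by
  have hn : (0 : ℝ) ≤ n := Nat.cast_nonneg n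
  obtain ⟨c, C₁, hc, hC₁, hdisp⟩ := exists_dispersive_le hα hc₀ hform Λ
  obtain ⟨C₂, hC₂, hnon⟩ := exists_nonlinear_le ν Λ
  obtain ⟨C₃, hC₃, hsum⟩ := exists_sum_blk_le (n := n) (s := s) (by linarith)
  obtain ⟨C₄, hC₄, hsob⟩ := exists_integral_fourier_le (n := n) (σ := r) 0 (by simpa using hr)
  refine ⟨c, (C₁ + C₂ * (C₄ + 1)) * C₃, hc, by positivity, ?_⟩
  intro φ g hw u hu ℓ hℓ N
  set f := complexify u with hf
  have h0 := integrable_fourier (by linarith) hu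
  have hU := contDiff_rep h0 (integrable_fourier_moment hs hu)
  set B := C₄ * sobR r f with hB
  have hB' : ∀ x, |rep u x| ≤ B := fun x ↦ by
    have := (hsob f (hu.mono hrs)).2
    simp only [pow_zero, one_mul] at this
    exact (abs_rep_le u x).trans this
  have hB0 : 0 ≤ B := (abs_nonneg _).trans (hB' 0)
  have hℓ0 : 0 ≤ ℓ := (norm_nonneg _).trans (hℓ 0)
  have hr0 : 0 ≤ sobR r f := sobR_nonneg _ _
  have hbdd : BddMeas fun x ↦ (rep u x : ℂ) := .ofReal hU.continuous hB'
  have hfU : f =ᵐ[volume] fun x ↦ (rep u x : ℂ) := by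
    filter_upwards [complexify_coeFn u, ae_eq_rep h0] with x h1 h2
    rw [hf, h1, h2]
  have hqU : square u =ᵐ[volume] fun x ↦ ((rep u x ^ 2 : ℝ) : ℂ) := by
    filter_upwards [coeFn_mulOp hbdd f, hfU] with x h1 h2
    rw [square, h1, h2]
    push_cast
    ring
  have hterm : ∀ k, 2 * (inner ℂ (mulOp (fun x ↦ (φ x : ℂ)) (blk k f)) (blkDeriv α k u) : ℂ).re ≤
      -c * (((2 : ℝ) ^ k) ^ α * ‖mulOp (fun x ↦ (g x : ℂ)) (blk k f)‖ ^ 2) +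
        (C₁ + C₂ * (C₄ + 1)) * (1 + sobR r f + ℓ) * (‖blk k f‖ ^ 2 + ‖f - lowPart k f‖ ^ 2) := by
    intro k
    have h1 := hdisp φ g hw k f
    have h2 := hnon φ g hw k (rep u) B ℓ hU.continuous hB' (abs_sub_le_of_fderiv hU hℓ) f _ hfU hqU
    rw [two_mul_re_inner_blkDeriv]
    set R : ℝ := 2 ^ k with hR
    have hR1 : 1 ≤ R := one_le_pow₀ (by norm_num)
    -- the remainder of the dispersive term is bounded because `α < 2`
    have hRα : R ^ α * R⁻¹ ^ 2 ≤ 1 := by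
      rw [inv_pow, ← div_eq_mul_inv, div_le_one (by positivity), ← Real.rpow_natCast]
      exact Real.rpow_le_rpow_of_exponent_le hR1 (by push_cast; linarith)
    have h3 := mul_le_mul_of_nonneg_left h1 (show 0 ≤ R ^ α by positivity)
    have h4 : -(R * (inner ℂ (mulOp (fun x ↦ (φ x : ℂ)) (blk k f))
        (mult (dyad k dannSym) (square u)) : ℂ).re) ≤
        C₂ * (B + ℓ) * (‖blk k f‖ ^ 2 + ‖f - lowPart k f‖ ^ 2) := by
      refine le_trans ?_ h2
      have := neg_abs_le (inner ℂ (mulOp (fun x ↦ (φ x : ℂ)) (blk k f))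
        (mult (dyad k dannSym) (square u)) : ℂ).re
      nlinarith
    set a := ‖blk k f‖ ^ 2 with ha
    set b := ‖f - lowPart k f‖ ^ 2 with hb
    have ha0 : 0 ≤ a := by positivity
    have hb0 : 0 ≤ b := by positivity
    have h5 : R ^ α * (C₁ * R⁻¹ ^ 2 * a) ≤ C₁ * (a + b) := by
      calc R ^ α * (C₁ * R⁻¹ ^ 2 * a) = (R ^ α * R⁻¹ ^ 2) * (C₁ * a) := by ring
        _ ≤ 1 * (C₁ * a) := by gcongr
        _ ≤ C₁ * (a + b) := by rw [one_mul]; gcongr; linarith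
    have h6 : C₁ + C₂ * (B + ℓ) ≤ (C₁ + C₂ * (C₄ + 1)) * (1 + sobR r f + ℓ) := by
      have e : (C₁ + C₂ * (C₄ + 1)) * (1 + sobR r f + ℓ) - (C₁ + C₂ * (B + ℓ)) =
        C₁ * (sobR r f + ℓ) + C₂ * (C₄ * (1 + ℓ) + (1 + sobR r f)) := by rw [hB]; ring
      have : 0 ≤ C₁ * (sobR r f + ℓ) + C₂ * (C₄ * (1 + ℓ) + (1 + sobR r f)) := by positivity
      linarith
    have h7 := mul_le_mul_of_nonneg_right h6 (add_nonneg ha0 hb0)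
    linarith
  calc energyDeriv α s φ N u ≤ ∑ k ∈ Finset.range N, ((4 : ℝ) ^ s) ^ k *
        (-c * (((2 : ℝ) ^ k) ^ α * ‖mulOp (fun x ↦ (g x : ℂ)) (blk k f)‖ ^ 2) +
        (C₁ + C₂ * (C₄ + 1)) * (1 + sobR r f + ℓ) * (‖blk k f‖ ^ 2 + ‖f - lowPart k f‖ ^ 2)) := by
        unfold energyDeriv
        gcongr with k
        exact hterm k
    _ = -c * ∑ k ∈ Finset.range N, smoothTerm α s g k f +
        (C₁ + C₂ * (C₄ + 1)) * (1 + sobR r f + ℓ) *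
          ∑ k ∈ Finset.range N, ((4 : ℝ) ^ s) ^ k * (‖blk k f‖ ^ 2 + ‖f - lowPart k f‖ ^ 2) := by
        rw [Finset.mul_sum, Finset.mul_sum, ← Finset.sum_add_distrib]
        refine Finset.sum_congr rfl fun k _ ↦ ?_
        rw [smoothTerm]
        ring
    _ ≤ -c * ∑ k ∈ Finset.range N, smoothTerm α s g k f +
        (C₁ + C₂ * (C₄ + 1)) * (1 + sobR r f + ℓ) * (C₃ * sobR s f ^ 2) := by
        gcongr
        exact hsum f hu N
    _ = _ := by ring

/-- The weighted energy of the first `N` blocks, at the regularity `s`. -/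
def energy (s : ℝ) (φ : Rn n → ℝ) (N : ℕ) (f : L2 n) : ℝ :=
  ∑ k ∈ Finset.range N, ((4 : ℝ) ^ s) ^ k *
    (inner ℂ (mulOp (fun x ↦ (φ x : ℂ)) (blk k f)) (blk k f) : ℂ).re

omit [NeZero n] in
theorem exists_abs_energy_le {s : ℝ} (hs : 0 < s) (ν : Rn n) (Λ : ℝ) : ∃ C : ℝ, 0 ≤ C ∧
    ∀ φ g : Rn n → ℝ, Weight ν Λ φ g → ∀ (f : L2 n), MemSob s f → ∀ N,
      |energy s φ N f| ≤ C * sobR s f ^ 2 := by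
  obtain ⟨C, hC, hsum⟩ := exists_sum_blk_le (n := n) hs
  refine ⟨|Λ| * C, by positivity, fun φ g hw f hf N ↦ ?_⟩
  rw [abs_of_nonneg hw.nonneg]
  have hΛ := hw.nonneg
  refine (Finset.abs_sum_le_sum_abs _ _).trans ?_
  calc _ ≤ ∑ k ∈ Finset.range N, Λ * (((4 : ℝ) ^ s) ^ k *
        (‖blk k f‖ ^ 2 + ‖f - lowPart k f‖ ^ 2)) := by
        refine Finset.sum_le_sum fun k _ ↦ ?_
        rw [abs_mul, abs_of_nonneg (by positivity), mul_left_comm Λ]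
        gcongr
        refine (Complex.abs_re_le_norm _).trans ((norm_inner_le_norm _ _).trans ?_)
        have h1 : ‖mulOp (fun x ↦ (φ x : ℂ)) (blk k f)‖ ≤ Λ * ‖blk k f‖ :=
          norm_mulOp_le hw.bdd.1 (fun x ↦ by simpa using hw.abs_le x) _
        calc _ ≤ Λ * ‖blk k f‖ * ‖blk k f‖ := by gcongr
          _ = Λ * (‖blk k f‖ ^ 2 + 0) := by ring
          _ ≤ _ := by gcongr; positivity
    _ = Λ * ∑ k ∈ Finset.range N, ((4 : ℝ) ^ s) ^ k *
        (‖blk k f‖ ^ 2 + ‖f - lowPart k f‖ ^ 2) := by rw [Finset.mul_sum]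
    _ ≤ Λ * (C * sobR s f ^ 2) := by gcongr; exact hsum f hf N
    _ = _ := by ring

theorem IsSolution.hasDerivAt_energy {α s T : ℝ} {u : ℝ → Lp ℝ 2 (volume : Measure (Rn n))}
    (hu : IsSolution α s T u) (hs : (n : ℝ) / 2 + 1 < s) (hα : 0 ≤ α) (hαs : α ≤ s)
    {φ : Rn n → ℝ} (hφ : BddMeas fun x ↦ (φ x : ℂ)) (N : ℕ) {t : ℝ} (ht : t ∈ Ioo 0 T) :
    HasDerivAt (fun τ ↦ energy s φ N (complexify (u τ)))
      (energyDeriv α s φ N (u t)) t := by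
  unfold energy energyDeriv
  refine HasDerivAt.fun_sum fun k _ ↦ HasDerivAt.const_mul _ ?_
  have h1 := hu.hasDerivAt_blk hs hα hαs k ht
  have h2 : HasDerivAt (fun τ ↦ mulOp (fun x ↦ (φ x : ℂ)) (blk k (complexify (u τ))))
      (mulOp (fun x ↦ (φ x : ℂ)) (blkDeriv α k (u t))) t :=
    ((mulOp (fun x ↦ (φ x : ℂ))).restrictScalars ℝ).hasFDerivAt.comp_hasDerivAt t h1
  have h3 := h2.inner ℂ h1
  have h4 : HasDerivAt (fun τ ↦ (inner ℂ (mulOp (fun x ↦ (φ x : ℂ)) (blk k (complexify (u τ))))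
      (blk k (complexify (u τ))) : ℂ).re) _ t :=
    Complex.reCLM.hasFDerivAt.comp_hasDerivAt t h3
  refine h4.congr_deriv ?_
  rw [Complex.reCLM_apply, Complex.add_re, ← inner_mulOp_real hφ (blkDeriv α k (u t)),
    re_inner_self_symm (blkDeriv α k (u t))]
  ring

end FZK

end

noncomputable section

namespace FZK

variable {n : ℕ}

/-! ### Integration in time -/

theorem ofReal_integral_le_lintegral {X : Type*} [MeasurableSpace X] {μ : Measure X} {h : X → ℝ}
    (hh : Integrable h μ) :
    ENNReal.ofReal (∫ x, h x ∂μ) ≤ ∫⁻ x, ENNReal.ofReal (h x) ∂μ := by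
  have h1 : ∫ x, h x ∂μ ≤ ∫ x, max (h x) 0 ∂μ :=
    integral_mono hh hh.pos_part fun x ↦ le_max_left _ _
  refine (ENNReal.ofReal_le_ofReal h1).trans ?_
  rw [ofReal_integral_eq_lintegral_ofReal hh.pos_part (ae_of_all _ fun x ↦ le_max_right _ _)]
  refine lintegral_mono fun x ↦ ?_
  rcases le_total (h x) 0 with hx | hx
  · simp [max_eq_right hx]
  · simp [max_eq_left hx]

/-- A bound on the lower integrals over all compact subintervals is a bound on the integral over the
open interval. -/
theorem lintegral_Ioo_le_of_Icc {f : ℝ → ℝ≥0∞} {a b : ℝ} (hab : a < b)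
    (hf : AEMeasurable f (volume.restrict (Ioo a b))) {K : ℝ≥0∞}
    (h : ∀ a' ∈ Ioo a b, ∀ b' ∈ Ioo a b, a' ≤ b' → ∫⁻ t in Icc a' b', f t ≤ K) :
    ∫⁻ t in Ioo a b, f t ≤ K := by
  obtain ⟨c, hac, hcb⟩ := exists_between hab
  obtain ⟨p, -, hp, hpl⟩ := exists_seq_strictAnti_tendsto' hac
  obtain ⟨q, -, hq, hql⟩ := exists_seq_strictMono_tendsto' hcb
  have hcov := aecover_Ioo_of_Icc (μ := volume) hpl hql
  have hlim := hcov.lintegral_tendsto_of_countably_generated hf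
  refine le_of_tendsto' hlim fun i ↦ ?_
  rw [Measure.restrict_restrict measurableSet_Icc]
  refine (lintegral_mono' (Measure.restrict_mono inter_subset_left le_rfl) le_rfl).trans ?_
  exact h _ ⟨(hp i).1, (hp i).2.trans hcb⟩ _ ⟨hac.trans (hq i).1, (hq i).2⟩
    ((hp i).2.trans (hq i).1).le

/-- Integration of a differential inequality `D ≤ -S + κ + B ℓ` for the derivative `D` of a bounded
energy `E`; the function `ℓ` need not be measurable. -/
theorem lintegral_le_of_energy {S D E : ℝ → ℝ} {T A B κ : ℝ} {ℓ : ℝ → ℝ≥0∞} (hT : 0 < T)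
    (hκ0 : 0 ≤ κ) (hSc : ContinuousOn S (Ioo 0 T)) (hDc : ContinuousOn D (Ioo 0 T))
    (hS0 : ∀ t, 0 ≤ S t) (hE : ∀ t ∈ Ioo 0 T, HasDerivAt E (D t) t)
    (hA : ∀ t ∈ Ioo 0 T, |E t| ≤ A)
    (h : ∀ᵐ t ∂(volume.restrict (Ioo 0 T)),
      ENNReal.ofReal (S t + D t - κ) ≤ ENNReal.ofReal B * ℓ t) :
    ∫⁻ t in Ioo 0 T, ENNReal.ofReal (S t) ≤
      ENNReal.ofReal B * (∫⁻ t in Ioo 0 T, ℓ t) + ENNReal.ofReal (2 * A) +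
        ENNReal.ofReal (T * κ) := by
  -- on compact subintervals `D` and `S` are integrable, which may fail up to the end points
  refine lintegral_Ioo_le_of_Icc hT (hSc.aemeasurable measurableSet_Ioo).ennreal_ofReal ?_
  intro a ha b hb hab
  have hsub : Icc a b ⊆ Ioo 0 T := (convex_Ioo 0 T).ordConnected.out ha hb
  have hDi : IntegrableOn D (Icc a b) volume := (hDc.mono hsub).integrableOn_Icc
  have hSi : IntegrableOn S (Icc a b) volume := (hSc.mono hsub).integrableOn_Icc
  have hκi : IntegrableOn (fun _ : ℝ ↦ κ) (Icc a b) volume := continuousOn_const.integrableOn_Icc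
  have hftc : ∫ t in Icc a b, D t = E b - E a := by
    rw [integral_Icc_eq_integral_Ioc, ← intervalIntegral.integral_of_le hab]
    refine intervalIntegral.integral_eq_sub_of_hasDerivAt (fun t ht ↦ ?_) ?_
    · rw [uIcc_of_le hab] at ht
      exact hE t (hsub ht)
    · refine ContinuousOn.intervalIntegrable ?_
      rw [uIcc_of_le hab]
      exact hDc.mono hsub
  have hftc' : -(2 * A) ≤ ∫ t in Icc a b, D t := by
    rw [hftc]
    have h1 := abs_le.1 (hA b hb)
    have h2 := abs_le.1 (hA a ha)
    linarith [h1.1, h2.2]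
  have hX : ENNReal.ofReal (∫ t in Icc a b, (S t + D t - κ)) ≤
      ENNReal.ofReal B * ∫⁻ t in Ioo 0 T, ℓ t := by
    refine (ofReal_integral_le_lintegral ((hSi.add hDi).sub hκi)).trans ?_
    refine (lintegral_mono_ae (ae_restrict_of_ae_restrict_of_subset hsub h)).trans ?_
    rw [lintegral_const_mul' _ _ ENNReal.ofReal_ne_top]
    gcongr
  have hsplit : ∫ t in Icc a b, S t =
      (∫ t in Icc a b, (S t + D t - κ)) - (∫ t in Icc a b, D t) + (b - a) * κ := by
    have e1 : ∫ t in Icc a b, (S t + D t - κ) =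
        (∫ t in Icc a b, S t) + (∫ t in Icc a b, D t) - ∫ _ in Icc a b, κ := by
      rw [← integral_add hSi hDi]
      exact integral_sub (hSi.add hDi) hκi
    have e2 : ∫ _ in Icc a b, κ = (b - a) * κ := by
      rw [setIntegral_const, smul_eq_mul, measureReal_def, Real.volume_Icc,
        ENNReal.toReal_ofReal (by linarith)]
    rw [e1, e2]
    ring
  rw [← ofReal_integral_eq_lintegral_ofReal hSi (ae_of_all _ fun t ↦ hS0 t), hsplit]
  refine (ENNReal.ofReal_le_ofReal (q := (∫ t in Icc a b, (S t + D t - κ)) +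
    2 * A + T * κ) ?_).trans ?_
  · have h1 : (b - a) * κ ≤ T * κ := by
      gcongr
      linarith [ha.1, hb.2]
    linarith
  · refine ENNReal.ofReal_add_le.trans ?_
    gcongr
    refine ENNReal.ofReal_add_le.trans ?_
    gcongr

theorem ae_le_normLinftyHs (T σ : ℝ) (u : ℝ → Lp ℝ 2 (volume : Measure (Rn n))) :
    ∀ᵐ t ∂(volume.restrict (Ioo 0 T)), sobolevNorm σ (toDist (u t)) ≤ normLinftyHs T σ u :=
  ENNReal.ae_le_essSup _

theorem normLinftyHs_mono {T σ τ : ℝ} (h : σ ≤ τ)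
    (u : ℝ → Lp ℝ 2 (volume : Measure (Rn n))) : normLinftyHs T σ u ≤ normLinftyHs T τ u :=
  essSup_mono_ae (ae_of_all _ fun _ ↦ sobolevNorm_mono h _)

theorem energy_constants_le {c C₁ C₂ m mr T : ℝ} (hc : 0 < c) (hC₁ : 0 ≤ C₁) (hC₂ : 0 ≤ C₂)
    (hmr : 0 ≤ mr) (hT : 0 < T) (G : ℝ≥0∞) :
    ENNReal.ofReal c⁻¹ * (ENNReal.ofReal (C₁ * m ^ 2) * G + ENNReal.ofReal (2 * (C₂ * m ^ 2)) +
      ENNReal.ofReal (T * (C₁ * (1 + mr) * m ^ 2))) ≤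
    ENNReal.ofReal (c⁻¹ * (C₁ + 2 * C₂)) *
      (1 + ENNReal.ofReal T + G + ENNReal.ofReal T * ENNReal.ofReal mr) *
        ENNReal.ofReal (m ^ 2) := by
  have e1 : ENNReal.ofReal (C₁ * m ^ 2) = ENNReal.ofReal C₁ * ENNReal.ofReal (m ^ 2) :=
    ENNReal.ofReal_mul hC₁
  have e2 : ENNReal.ofReal (2 * (C₂ * m ^ 2)) =
      ENNReal.ofReal (2 * C₂) * ENNReal.ofReal (m ^ 2) := by
    rw [← mul_assoc, ENNReal.ofReal_mul (p := 2 * C₂) (by positivity)]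
  have e3 : ENNReal.ofReal (T * (C₁ * (1 + mr) * m ^ 2)) =
      ENNReal.ofReal T * (ENNReal.ofReal C₁ * (1 + ENNReal.ofReal mr) * ENNReal.ofReal (m ^ 2)) := by
    rw [ENNReal.ofReal_mul hT.le, ENNReal.ofReal_mul (p := C₁ * (1 + mr)) (by positivity),
      ENNReal.ofReal_mul hC₁, ENNReal.ofReal_add zero_le_one hmr, ENNReal.ofReal_one]
  have e4 : ENNReal.ofReal (c⁻¹ * (C₁ + 2 * C₂)) =
      ENNReal.ofReal c⁻¹ * (ENNReal.ofReal C₁ + ENNReal.ofReal (2 * C₂)) := by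
    rw [ENNReal.ofReal_mul (p := c⁻¹) (by positivity), ENNReal.ofReal_add hC₁ (by positivity)]
  rw [e1, e2, e3, e4]
  generalize ENNReal.ofReal c⁻¹ = x
  generalize ENNReal.ofReal C₁ = y
  generalize ENNReal.ofReal (2 * C₂) = z
  generalize ENNReal.ofReal (m ^ 2) = w
  generalize ENNReal.ofReal T = v
  generalize ENNReal.ofReal mr = p
  calc _ ≤ x * (y * w * G + z * w + v * (y * (1 + p) * w)) +
        x * w * (y + z * (v + G + v * p)) := le_self_add
    _ = _ := by ring

variable [NeZero n]

theorem IsSolution.continuousOn_smoothTerm {α s T : ℝ}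
    {u : ℝ → Lp ℝ 2 (volume : Measure (Rn n))} (hu : IsSolution α s T u) (hs : 0 ≤ s)
    (g : Rn n → ℝ) (k : ℕ) :
    ContinuousOn (fun t ↦ smoothTerm α s g k (complexify (u t))) (Ioo 0 T) := by
  unfold smoothTerm
  refine continuousOn_const.mul (continuousOn_const.mul (ContinuousOn.pow (ContinuousOn.norm ?_) 2))
  exact (mulOp _).continuous.comp_continuousOn
    ((blk k).continuous.comp_continuousOn (hu.continuousOn hs))

theorem IsSolution.continuousOn_energy_deriv {α s T : ℝ}
    {u : ℝ → Lp ℝ 2 (volume : Measure (Rn n))} (hu : IsSolution α s T u)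
    (hs : (n : ℝ) / 2 + 1 < s) (φ : Rn n → ℝ) (N : ℕ) :
    ContinuousOn (fun t ↦ energyDeriv α s φ N (u t)) (Ioo 0 T) := by
  have hn : (0 : ℝ) ≤ n := Nat.cast_nonneg n
  unfold energyDeriv
  refine continuousOn_finsetSum _ fun k _ ↦ continuousOn_const.mul (continuousOn_const.mul ?_)
  refine Complex.continuous_re.comp_continuousOn (ContinuousOn.inner (𝕜 := ℂ) ?_ ?_)
  · exact (mulOp _).continuous.comp_continuousOn
      ((blk k).continuous.comp_continuousOn (hu.continuousOn (by linarith)))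
  · exact hu.continuousOn_blkDeriv hs k

/-- The smoothing estimate for the blocks of a solution. -/
theorem exists_lintegral_smooth_le {α s r : ℝ} (hα : 0 < α) (hα₂ : α < 2)
    (hs : (n : ℝ) / 2 + 1 < s) (hαs : α ≤ s) (hr : (n : ℝ) / 2 < r) (hrs : r ≤ s) {ν : Rn n}
    {c₀ : ℝ} (hc₀ : 0 < c₀)
    (hform : ∀ ξ : Rn n, c₀ * ‖ξ‖ ^ 2 ≤ ν 0 * ‖ξ‖ ^ 2 + α * ξ 0 * inner ℝ ν ξ) (Λ : ℝ) :
    ∃ C : ℝ≥0, ∀ φ g : Rn n → ℝ, Weight ν Λ φ g → ∀ T : ℝ, 0 < T →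
      ∀ u : ℝ → Lp ℝ 2 (volume : Measure (Rn n)), IsSolution α s T u →
      normLinftyHs T s u ≠ ⊤ →
      ∫⁻ t in Ioo 0 T, ∑' k, ENNReal.ofReal (smoothTerm α s g k (complexify (u t))) ≤
        C * (1 + ENNReal.ofReal T + normGradL1Linfty T u + ENNReal.ofReal T * normLinftyHs T r u) *
          normLinftyHs T s u ^ 2 := by
  have hn : (0 : ℝ) ≤ n := Nat.cast_nonneg n
  obtain ⟨c, C₁, hc, hC₁, hderiv⟩ := exists_energy_deriv_le hα hα₂ hs hr hrs hc₀ hform Λ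
  obtain ⟨C₂, hC₂, hen⟩ := exists_abs_energy_le (n := n) (s := s) (by linarith) ν Λ
  set K := c⁻¹ * (C₁ + 2 * C₂) with hK
  have hK0 : 0 ≤ K := by positivity
  refine ⟨K.toNNReal, fun φ g hw T hT u hu hfin ↦ ?_⟩
  set M := normLinftyHs T s u with hM
  set Mr := normLinftyHs T r u with hMr
  set G := normGradL1Linfty T u with hG
  set m := M.toReal with hm
  set mr := Mr.toReal with hmr
  have hMrfin : Mr ≠ ⊤ := ne_top_of_le_ne_top hfin (normLinftyHs_mono hrs u)
  have hm0 : 0 ≤ m := ENNReal.toReal_nonneg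
  have hmr0 : 0 ≤ mr := ENNReal.toReal_nonneg
  have hMm : M = ENNReal.ofReal m := (ENNReal.ofReal_toReal hfin).symm
  have hMrm : Mr = ENNReal.ofReal mr := (ENNReal.ofReal_toReal hMrfin).symm
  have hsob : ∀ t ∈ Ioo 0 T, sobR s (complexify (u t)) ≤ m := fun t ht ↦
    ENNReal.toReal_mono hfin (hu.sobolevNorm_le ht)
  have hsobr : ∀ t, sobolevNorm r (toDist (u t)) ≤ Mr → sobR r (complexify (u t)) ≤ mr :=
    fun t ht ↦ ENNReal.toReal_mono hMrfin ht
  clear_value m mr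
  set S : ℕ → ℝ → ℝ := fun N t ↦ ∑ k ∈ Finset.range N, smoothTerm α s g k (complexify (u t))
    with hS
  have hScont : ∀ N, ContinuousOn (S N) (Ioo 0 T) := fun N ↦
    continuousOn_finsetSum _ fun k _ ↦ hu.continuousOn_smoothTerm (by linarith) g k
  have hS0 : ∀ N t, 0 ≤ S N t := fun N t ↦ Finset.sum_nonneg fun k _ ↦ smoothTerm_nonneg _ _ _ _ _
  have key : ∀ N, ∫⁻ t in Ioo 0 T, ENNReal.ofReal (c * S N t) ≤
      ENNReal.ofReal (C₁ * m ^ 2) * G + ENNReal.ofReal (2 * (C₂ * m ^ 2)) +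
        ENNReal.ofReal (T * (C₁ * (1 + mr) * m ^ 2)) := by
    intro N
    have d1 : ContinuousOn (fun t ↦ c * S N t) (Ioo 0 T) := continuousOn_const.mul (hScont N)
    have d2 : ContinuousOn (fun t ↦ energyDeriv α s φ N (u t)) (Ioo 0 T) :=
      hu.continuousOn_energy_deriv hs φ N
    have d3 : ∀ t ∈ Ioo 0 T, HasDerivAt (fun τ ↦ energy s φ N (complexify (u τ)))
        (energyDeriv α s φ N (u t)) t := fun t ht ↦
      hu.hasDerivAt_energy hs hα.le hαs hw.bdd N ht
    have d4 : ∀ t, 0 ≤ c * S N t := fun t ↦ mul_nonneg hc.le (hS0 N t)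
    refine lintegral_le_of_energy hT (by positivity) d1 d2 d4 d3 (fun t ht ↦ ?_) ?_
    · refine (hen φ g hw _ (hu.memSob ht) N).trans ?_
      have := hsob t ht
      have h0 := sobR_nonneg s (complexify (u t))
      gcongr
    · filter_upwards [ae_le_normLinftyHs T r u, ae_restrict_mem measurableSet_Ioo] with t ht1 ht
      have hg := hu.gradSupNorm_ne_top hs ht
      obtain ⟨ℓ, hℓ⟩ : ∃ ℓ, ℓ = (gradSupNorm (u t)).toReal := ⟨_, rfl⟩
      have hgℓ : gradSupNorm (u t) = ENNReal.ofReal ℓ := by rw [hℓ, ENNReal.ofReal_toReal hg]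
      have hℓ0 : 0 ≤ ℓ := hℓ ▸ ENNReal.toReal_nonneg
      have hCm : 0 ≤ C₁ * m ^ 2 := by positivity
      rw [hgℓ, ← ENNReal.ofReal_mul hCm]
      apply ENNReal.ofReal_le_ofReal
      have h2 := hderiv φ g hw (u t) (hu.memSob ht) ℓ (hℓ ▸ hu.norm_fderiv_le hs ht) N
      have h3 : sobR r (complexify (u t)) ≤ mr := hsobr t ht1
      have h4 := hsob t ht
      have h5 := sobR_nonneg s (complexify (u t))
      have h7 := sobR_nonneg r (complexify (u t))
      have h6 : C₁ * (1 + sobR r (complexify (u t)) + ℓ) * sobR s (complexify (u t)) ^ 2 ≤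
          C₁ * (1 + mr + ℓ) * m ^ 2 := by gcongr
      have h9 : C₁ * (1 + mr + ℓ) * m ^ 2 = C₁ * (1 + mr) * m ^ 2 + C₁ * m ^ 2 * ℓ := by ring
      linarith
  have hsumN : ∀ N, ∑ k ∈ Finset.range N,
      ∫⁻ t in Ioo 0 T, ENNReal.ofReal (smoothTerm α s g k (complexify (u t))) ≤
      ENNReal.ofReal c⁻¹ * (ENNReal.ofReal (C₁ * m ^ 2) * G + ENNReal.ofReal (2 * (C₂ * m ^ 2)) +
          ENNReal.ofReal (T * (C₁ * (1 + mr) * m ^ 2))) := by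
    intro N
    rw [← lintegral_finsetSum' _ fun k _ ↦ ((hu.continuousOn_smoothTerm (by linarith) g k).aemeasurable
      measurableSet_Ioo).ennreal_ofReal]
    have e : ∀ t, ∑ k ∈ Finset.range N, ENNReal.ofReal (smoothTerm α s g k (complexify (u t))) =
        ENNReal.ofReal c⁻¹ * ENNReal.ofReal (c * S N t) := fun t ↦ by
      rw [← ENNReal.ofReal_mul (inv_nonneg.2 hc.le), inv_mul_cancel_left₀ hc.ne',
        ENNReal.ofReal_sum_of_nonneg fun k _ ↦ smoothTerm_nonneg _ _ _ _ _]
    simp_rw [e]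
    rw [lintegral_const_mul' _ _ ENNReal.ofReal_ne_top]
    gcongr
    exact key N
  rw [lintegral_tsum fun k ↦ ((hu.continuousOn_smoothTerm (by linarith) g k).aemeasurable
      measurableSet_Ioo).ennreal_ofReal]
  refine (ENNReal.tsum_le_of_sum_range_le hsumN).trans ?_
  have hKe : ((K.toNNReal : ℝ≥0) : ℝ≥0∞) = ENNReal.ofReal K := rfl
  rw [hKe, hMm, hMrm, ← ENNReal.ofReal_pow hm0]
  exact energy_constants_le hc hC₁ hC₂ hmr0 hT G

end FZK

end

noncomputable section

namespace FZK

variable {n : ℕ}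

/-! ### Uniform bounds for families of symbols -/

/-- The moments of the kernels are bounded on bounded families of Schwartz symbols. -/
theorem exists_mom_le_of_bounded {ι : Type*} (m : ι → 𝓢(Rn n, ℂ))
    (hb : ∀ k l, ∃ C, ∀ i, SchwartzMap.seminorm ℂ k l (m i) ≤ C) (j : ℕ) :
    ∃ C, ∀ i, mom j (m i) ≤ C := by
  have h1 : Bornology.IsVonNBounded ℂ (range m) := by
    refine (schwartz_withSeminorms ℂ (Rn n) ℂ).isVonNBounded_iff_seminorm_bounded.2 fun p ↦ ?_
    obtain ⟨C, hC⟩ := hb p.1 p.2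
    refine ⟨|C| + 1, by positivity, ?_⟩
    rintro _ ⟨i, rfl⟩
    exact lt_of_le_of_lt ((hC i).trans (le_abs_self C)) (lt_add_one _)
  -- continuous linear maps preserve bounded sets
  have h2 := h1.image (FourierTransform.fourierInvCLM ℂ 𝓢(Rn n, ℂ))
  rw [(schwartz_withSeminorms ℂ (Rn n) ℂ).isVonNBounded_iff_seminorm_bounded] at h2
  set q := (volume : Measure (Rn n)).integrablePower with hq
  obtain ⟨r₁, hr₁, h3⟩ := h2 (0, 0)
  obtain ⟨r₂, hr₂, h4⟩ := h2 (j + q, 0)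
  refine ⟨(2 ^ q * ∫ x : Rn n, (1 + ‖x‖) ^ (-(q : ℝ))) * (r₁ + r₂), fun i ↦ ?_⟩
  have h5 := SchwartzMap.integral_pow_mul_iteratedFDeriv_le ℂ (volume : Measure (Rn n))
    (𝓕⁻ (m i) : 𝓢(Rn n, ℂ)) j 0
  have h6 : mom j (m i) = ∫ x : Rn n, ‖x‖ ^ j * ‖iteratedFDeriv ℝ 0 (𝓕⁻ (m i) : 𝓢(Rn n, ℂ)) x‖ := by
    simp only [norm_iteratedFDeriv_zero]
    rfl
  rw [h6]
  refine h5.trans ?_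
  have h7 : 0 ≤ ∫ x : Rn n, (1 + ‖x‖) ^ (-(q : ℝ)) := integral_nonneg fun x ↦ by positivity
  have h8 := (h3 _ ⟨m i, ⟨i, rfl⟩, rfl⟩).le
  have h9 := (h4 _ ⟨m i, ⟨i, rfl⟩, rfl⟩).le
  exact mul_le_mul_of_nonneg_left (add_le_add h8 h9) (by positivity)

/-- The slices of a compactly supported smooth function of an additional real parameter form a
bounded family of Schwartz functions. -/
theorem exists_seminorm_slice_le {H : ℝ × Rn n → ℂ} (hH : ContDiff ℝ ∞ H) (hc : HasCompactSupport H)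
    {ι : Type*} (y : ι → ℝ) (m : ι → 𝓢(Rn n, ℂ)) (hm : ∀ i η, m i η = H (y i, η)) (k l : ℕ) :
    ∃ C, ∀ i, SchwartzMap.seminorm ℂ k l (m i) ≤ C := by
  have hcont : Continuous fun p : ℝ × Rn n ↦ ‖p.2‖ ^ k * ‖iteratedFDeriv ℝ l H p‖ := by
    have := hH.continuous_iteratedFDeriv (m := l) (by exact_mod_cast le_top)
    fun_prop
  have hsupp : HasCompactSupport fun p : ℝ × Rn n ↦ ‖p.2‖ ^ k * ‖iteratedFDeriv ℝ l H p‖ :=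
    (hc.iteratedFDeriv l).norm.mul_left
  obtain ⟨C, hC⟩ := hcont.bounded_above_of_compact_support hsupp
  have hC0 : 0 ≤ C := (norm_nonneg _).trans (hC 0)
  set L := ContinuousLinearMap.inr ℝ ℝ (Rn n) with hL
  refine ⟨C * ∏ _i : Fin l, ‖L‖, fun i ↦ ?_⟩
  refine SchwartzMap.seminorm_le_bound ℂ k l _ (by positivity) fun η ↦ ?_
  have h1 : (m i : Rn n → ℂ) = (fun p ↦ H ((y i, 0) + p)) ∘ L := by
    ext η
    rw [hm i η]
    simp [hL]
  have hH' : ContDiff ℝ ∞ fun p ↦ H ((y i, 0) + p) := hH.comp (contDiff_const.add contDiff_id)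
  rw [h1, L.iteratedFDeriv_comp_right hH' η (i := l) (by exact_mod_cast le_top),
    iteratedFDeriv_comp_add_left]
  have h2 := ContinuousMultilinearMap.norm_compContinuousLinearMap_le
    (iteratedFDeriv ℝ l H ((y i, 0) + L η)) (fun _ : Fin l ↦ L)
  have h3 := (le_abs_self _).trans (hC ((y i, 0) + L η))
  have h4 : ((y i, (0 : Rn n)) + L η).2 = η := by simp [hL]
  simp only [h4] at h3
  calc _ ≤ ‖η‖ ^ k * (‖iteratedFDeriv ℝ l H ((y i, 0) + L η)‖ * ∏ _i : Fin l, ‖L‖) := by gcongr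
    _ = (‖η‖ ^ k * ‖iteratedFDeriv ℝ l H ((y i, 0) + L η)‖) * ∏ _i : Fin l, ‖L‖ := by ring
    _ ≤ _ := by gcongr

/-- The rescaled Bessel symbol `e(η) (y² + |2πη|²) ^ (τ / 2)`, cut off to an annulus in `η`, as a
function of the scale `y = 2 ^ (-k)` as well. -/
def jointSym (τ : ℝ) (e : Rn n → ℂ) (p : ℝ × Rn n) : ℂ :=
  ((Real.smoothTransition (2 - p.1 ^ 2) * fatReal p.2 *
    (p.1 ^ 2 + ‖(2 * Real.pi) • p.2‖ ^ 2) ^ (τ / 2) : ℝ) : ℂ) * e p.2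

theorem jointSym_contDiff (τ : ℝ) {e : Rn n → ℂ} (he : ContDiff ℝ ∞ e) :
    ContDiff ℝ ∞ (jointSym τ e) := by
  refine ContDiff.mul (Complex.ofRealCLM.contDiff.comp ?_) (he.comp contDiff_snd)
  rw [contDiff_iff_contDiffAt]
  intro p
  by_cases h : p.2 = 0
  · have h0 : (fun p : ℝ × Rn n ↦ Real.smoothTransition (2 - p.1 ^ 2) * fatReal p.2 *
        (p.1 ^ 2 + ‖(2 * Real.pi) • p.2‖ ^ 2) ^ (τ / 2)) =ᶠ[𝓝 p] fun _ ↦ 0 := by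
      have ho : IsOpen {q : ℝ × Rn n | ‖q.2‖ < 1 / 2} := isOpen_lt (by fun_prop) continuous_const
      filter_upwards [ho.mem_nhds (show ‖p.2‖ < 1 / 2 by rw [h]; simp)] with q hq
      have hq' : ‖q.2‖ < 1 / 2 := hq
      rw [fatReal_eq_zero_of_le hq'.le]
      ring
    exact contDiffAt_const.congr_of_eventuallyEq h0
  · have h1 : (2 * Real.pi) • p.2 ≠ 0 := smul_ne_zero (by positivity) h
    have h2 : 0 < ‖(2 * Real.pi) • p.2‖ := norm_pos_iff.2 h1
    refine ContDiffAt.mul (ContDiffAt.mul ?_ ?_) ?_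
    · exact (Real.smoothTransition.contDiff.comp
        (contDiff_const.sub (contDiff_fst.pow 2))).contDiffAt
    · exact (fatReal_contDiff.comp contDiff_snd).contDiffAt
    · refine ContDiffAt.rpow_const_of_ne ?_ (by positivity)
      exact ((contDiff_fst.pow 2).add
        ((contDiff_norm_sq ℝ).comp ((contDiff_const_smul _).comp contDiff_snd))).contDiffAt

theorem jointSym_hasCompactSupport (τ : ℝ) (e : Rn n → ℂ) : HasCompactSupport (jointSym τ e) := by
  apply HasCompactSupport.of_support_subset_isCompact
    ((isCompact_Icc (a := (-2 : ℝ)) (b := 2)).prod (isCompact_closedBall (0 : Rn n) 8))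
  intro p hp
  by_contra hcon
  apply hp
  rw [mem_prod, not_and_or] at hcon
  rcases hcon with h | h
  · have : Real.smoothTransition (2 - p.1 ^ 2) = 0 := by
      apply Real.smoothTransition.zero_of_nonpos
      by_contra h2
      apply h
      constructor <;> nlinarith
    simp [jointSym, this]
  · have : fatReal p.2 = 0 := fatReal_eq_zero_of_ge (by
      rw [mem_closedBall_zero_iff] at h
      linarith)
    simp [jointSym, this]

/-- The pieces `j k` of the symbol `m` at the dyadic frequencies `2 ^ k`, with the bounds of a symbol
of order `ρ`. -/
structure DyadicSymbol (ρ A : ℝ) (m : Rn n → ℂ) (j : ℕ → 𝓢(Rn n, ℂ)) : Prop where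
  eq : ∀ k ξ, j k ξ = m ξ * fatReal (((2 : ℝ) ^ k)⁻¹ • ξ)
  norm_le : ∀ k ξ, ‖j k ξ‖ ≤ A * ((2 : ℝ) ^ k) ^ ρ
  mom_le : ∀ k, mom 1 (j k) ≤ A * ((2 : ℝ) ^ k) ^ (ρ - 1)
  nonneg : 0 ≤ A

/-- A symbol whose dyadic rescalings are slices of one smooth function, up to the factor
`(2 ^ k) ^ ρ`, is of order `ρ`. -/
theorem exists_dyadicSymbol {ρ τ : ℝ} {e m : Rn n → ℂ} (he : ContDiff ℝ ∞ e)
    (hm : ∀ (k : ℕ) η, m ((2 : ℝ) ^ k • η) = ((((2 : ℝ) ^ k) ^ ρ *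
      ((((2 : ℝ) ^ k)⁻¹) ^ 2 + ‖(2 * Real.pi) • η‖ ^ 2) ^ (τ / 2) : ℝ) : ℂ) * e η) :
    ∃ A j, DyadicSymbol ρ A m j := by
  set H := jointSym τ e with hH
  have hHs := jointSym_contDiff τ he
  have hHc := jointSym_hasCompactSupport τ e
  have hs1 (y : ℝ) : HasCompactSupport fun η ↦ H (y, η) := by
    refine hasCompactSupport_of_ball 8 fun η hη ↦ ?_
    simp [hH, jointSym, fatReal_eq_zero_of_ge hη]
  set G : ℕ → 𝓢(Rn n, ℂ) := fun k ↦ toS (fun η ↦ H (((2 : ℝ) ^ k)⁻¹, η)) (hs1 _)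
    (hHs.comp (contDiff_const.prodMk contDiff_id)) with hG
  have hGa : ∀ k η, G k η = H (((2 : ℝ) ^ k)⁻¹, η) := fun k η ↦ toS_apply _ _ _ _
  have hb := exists_seminorm_slice_le hHs hHc (fun k : ℕ ↦ ((2 : ℝ) ^ k)⁻¹) G hGa
  obtain ⟨A₁, hA₁⟩ := exists_mom_le_of_bounded G hb 1
  obtain ⟨A₂, hA₂⟩ := hb 0 0
  have hA₂0 : 0 ≤ A₂ := (apply_nonneg _ _).trans (hA₂ 0)
  have hA₁0 : 0 ≤ A₁ := (mom_nonneg _ _).trans (hA₁ 0)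
  have hsm : ∀ (c : ℂ) (G : 𝓢(Rn n, ℂ)) ξ, (c • G) ξ = c * G ξ := fun _ _ _ ↦ rfl
  refine ⟨A₁ + A₂, fun k ↦ ((((2 : ℝ) ^ k) ^ ρ : ℝ) : ℂ) • dyad k (G k), ?_, ?_, ?_, by positivity⟩
  · intro k ξ
    have hR : (0 : ℝ) < 2 ^ k := by positivity
    have hR1 : ((2 : ℝ) ^ k)⁻¹ ≤ 1 := inv_le_one_of_one_le₀ (one_le_pow₀ (by norm_num))
    have hR0 : 0 < ((2 : ℝ) ^ k)⁻¹ := by positivity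
    rw [hsm, dyad_apply, hGa]
    obtain ⟨η, rfl⟩ : ∃ η, ξ = (2 : ℝ) ^ k • η := ⟨((2 : ℝ) ^ k)⁻¹ • ξ, by
      rw [smul_inv_smul₀ hR.ne']⟩
    -- the cut-off in the scale is invisible at the scales `2 ^ (-k) ≤ 1`
    have h1 : Real.smoothTransition (2 - (((2 : ℝ) ^ k)⁻¹) ^ 2) = 1 :=
      Real.smoothTransition.one_of_one_le (by nlinarith)
    rw [hm, inv_smul_smul₀ hR.ne', hH, jointSym]
    simp only [h1, one_mul]
    push_cast
    ring
  · intro k ξ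
    rw [hsm, norm_mul, Complex.norm_real, Real.norm_of_nonneg (by positivity), mul_comm, dyad_apply]
    gcongr
    have := SchwartzMap.norm_le_seminorm ℂ (G k) (((2 : ℝ) ^ k)⁻¹ • ξ)
    linarith [hA₂ k]
  · intro k
    have hR : (0 : ℝ) < 2 ^ k := by positivity
    rw [mom_smul, mom_dyad, Complex.norm_real, Real.norm_of_nonneg (by positivity), pow_one,
      Real.rpow_sub hR, Real.rpow_one, div_eq_mul_inv, ← mul_assoc, mul_comm]
    gcongr
    linarith [hA₁ k]

theorem besselSymbol_scale (σ : ℝ) (k : ℕ) (η : Rn n) :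
    besselSymbol n σ ((2 : ℝ) ^ k • η) = ((((2 : ℝ) ^ k) ^ σ *
      ((((2 : ℝ) ^ k)⁻¹) ^ 2 + ‖(2 * Real.pi) • η‖ ^ 2) ^ (σ / 2) : ℝ) : ℂ) := by
  have hR : (0 : ℝ) < 2 ^ k := by positivity
  rw [besselSymbol, smul_comm, norm_smul, Real.norm_of_nonneg hR.le]
  congr 1
  have h1 : 1 + ((2 : ℝ) ^ k * ‖(2 * Real.pi) • η‖) ^ 2 =
      ((2 : ℝ) ^ k) ^ 2 * ((((2 : ℝ) ^ k)⁻¹) ^ 2 + ‖(2 * Real.pi) • η‖ ^ 2) := by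
    field_simp
  rw [h1, Real.mul_rpow (by positivity) (by positivity)]
  congr 1
  rw [← Real.rpow_natCast, ← Real.rpow_mul hR.le]
  congr 1
  push_cast
  ring

theorem exists_dyadicSymbol_bessel (ρ : ℝ) :
    ∃ A j, DyadicSymbol ρ A (besselSymbol n ρ) j :=
  exists_dyadicSymbol (e := fun _ ↦ 1) (τ := ρ) contDiff_const fun k η ↦ by
    rw [besselSymbol_scale, mul_one]

theorem exists_dyadicSymbol_deriv (ρ : ℝ) (i : Fin n) :
    ∃ A j, DyadicSymbol ρ A (derivBesselSymbol (ρ - 1) i) j := by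
  refine exists_dyadicSymbol (e := fun η ↦ 2 * Real.pi * Complex.I * (η i : ℂ)) (τ := ρ - 1)
    (coordSymbol_hasTemperateGrowth i).1 fun k η ↦ ?_
  have hR : (0 : ℝ) < 2 ^ k := by positivity
  have h1 : ((2 : ℝ) ^ k) ^ ρ = ((2 : ℝ) ^ k) ^ (ρ - 1) * (2 : ℝ) ^ k := by
    rw [Real.rpow_sub_one hR.ne', div_mul_cancel₀ _ hR.ne']
  rw [derivBesselSymbol, besselSymbol_scale, h1]
  simp only [PiLp.smul_apply, smul_eq_mul]
  push_cast
  ring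

end FZK

end

noncomputable section

namespace FZK

variable {n : ℕ}

/-! ### Weighted energies -/

/-- Almost orthogonality: if vectors whose indices are at distance at least `4` are orthogonal, the
square norm of a sum is controlled by the sum of the square norms. -/
theorem norm_sum_sq_le {H : Type*} [NormedAddCommGroup H] [InnerProductSpace ℂ H] {x : ℕ → H}
    (h : ∀ k l, k + 4 ≤ l → inner ℂ (x k) (x l) = (0 : ℂ)) (I : Finset ℕ) :
    ‖∑ k ∈ I, x k‖ ^ 2 ≤ 7 * ∑ k ∈ I, ‖x k‖ ^ 2 := by
  have h' : ∀ k l, ¬(k < l + 4 ∧ l < k + 4) → inner ℂ (x k) (x l) = (0 : ℂ) := by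
    intro k l hkl
    rw [not_and_or, not_lt, not_lt] at hkl
    rcases hkl with hkl | hkl
    · rw [← inner_conj_symm, h l k hkl, map_zero]
    · exact h k l hkl
  have h1 : ‖∑ k ∈ I, x k‖ ^ 2 = ∑ k ∈ I, ∑ l ∈ I, (inner ℂ (x k) (x l) : ℂ).re := by
    rw [← inner_self_eq_norm_sq (𝕜 := ℂ), sum_inner, map_sum]
    refine Finset.sum_congr rfl fun k _ ↦ ?_
    rw [inner_sum, map_sum]
    rfl
  have h2 : ∀ k l, (inner ℂ (x k) (x l) : ℂ).re ≤
      (if k < l + 4 ∧ l < k + 4 then ‖x k‖ ^ 2 / 2 else 0) +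
      (if l < k + 4 ∧ k < l + 4 then ‖x l‖ ^ 2 / 2 else 0) := by
    intro k l
    by_cases hkl : k < l + 4 ∧ l < k + 4
    · rw [if_pos hkl, if_pos hkl.symm]
      have h3 : (inner ℂ (x k) (x l) : ℂ).re ≤ ‖x k‖ * ‖x l‖ :=
        (Complex.re_le_norm _).trans (norm_inner_le_norm _ _)
      nlinarith [sq_nonneg (‖x k‖ - ‖x l‖)]
    · rw [if_neg hkl, if_neg (fun hh ↦ hkl hh.symm), h' k l hkl]
      simp
  have h3 : ∀ k, ∑ l ∈ I, (if k < l + 4 ∧ l < k + 4 then ‖x k‖ ^ 2 / 2 else 0) ≤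
      7 / 2 * ‖x k‖ ^ 2 := by
    intro k
    rw [← Finset.sum_filter, Finset.sum_const, nsmul_eq_mul]
    have h4 : (I.filter fun l ↦ k < l + 4 ∧ l < k + 4).card ≤ 7 := by
      refine (Finset.card_le_card (t := Finset.Ico (k - 3) (k + 4)) fun l hl ↦ ?_).trans ?_
      · have := (Finset.mem_filter.1 hl).2
        rw [Finset.mem_Ico]
        omega
      · rw [Nat.card_Ico]
        omega
    have h5 : ((I.filter fun l ↦ k < l + 4 ∧ l < k + 4).card : ℝ) ≤ 7 := by exact_mod_cast h4
    nlinarith [sq_nonneg ‖x k‖]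
  calc ‖∑ k ∈ I, x k‖ ^ 2 ≤ ∑ k ∈ I, ∑ l ∈ I,
        ((if k < l + 4 ∧ l < k + 4 then ‖x k‖ ^ 2 / 2 else 0) +
        (if l < k + 4 ∧ k < l + 4 then ‖x l‖ ^ 2 / 2 else 0)) := by
        rw [h1]
        exact Finset.sum_le_sum fun k _ ↦ Finset.sum_le_sum fun l _ ↦ h2 k l
    _ = 2 * ∑ k ∈ I, ∑ l ∈ I, (if k < l + 4 ∧ l < k + 4 then ‖x k‖ ^ 2 / 2 else 0) := by
        simp_rw [Finset.sum_add_distrib]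
        rw [Finset.sum_comm (f := fun k l ↦ if l < k + 4 ∧ k < l + 4 then ‖x l‖ ^ 2 / 2 else 0)]
        ring
    _ ≤ 2 * ∑ k ∈ I, 7 / 2 * ‖x k‖ ^ 2 := by
        gcongr with k
        exact h3 k
    _ = _ := by rw [← Finset.mul_sum]; ring

theorem summable_of_almost_orthogonal {H : Type*} [NormedAddCommGroup H] [InnerProductSpace ℂ H]
    [CompleteSpace H] {x : ℕ → H} (h : ∀ k l, k + 4 ≤ l → inner ℂ (x k) (x l) = (0 : ℂ))
    (hs : Summable fun k ↦ ‖x k‖ ^ 2) :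
    Summable x ∧ ‖∑' k, x k‖ ^ 2 ≤ 7 * ∑' k, ‖x k‖ ^ 2 := by
  have h1 : Summable x := by
    rw [summable_iff_vanishing_norm] at hs ⊢
    intro ε hε
    obtain ⟨I, hI⟩ := hs (ε ^ 2 / 7) (by positivity)
    refine ⟨I, fun t ht ↦ ?_⟩
    have h2 := (le_abs_self _).trans_lt (hI t ht)
    have h3 := norm_sum_sq_le h t
    exact lt_of_pow_lt_pow_left₀ 2 hε.le (by linarith)
  refine ⟨h1, le_of_tendsto' (h1.hasSum.norm.pow 2) fun I ↦ ?_⟩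
  refine (norm_sum_sq_le h I).trans ?_
  gcongr
  exact hs.sum_le_tsum I fun k _ ↦ by positivity

/-- The product of a function and the inverse of the square root `g` of the weight represents a
multiplier of `f` on the set where the weight is positive, as soon as the frequency truncations
converge after multiplication by `g`. -/
theorem weightedEnergy_le_of_tendsto {m : Rn n → ℂ} (hm : m.HasTemperateGrowth) {f h : L2 n}
    {F : ℕ → L2 n} (hF : ∀ N : ℕ, (𝓕 (F N) : L2 n) =ᵐ[volume] fun ξ ↦
      m ξ * (bump (((2 : ℝ) ^ N)⁻¹ • ξ) : ℂ) * (𝓕 f : L2 n) ξ)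
    {g : Rn n → ℝ} (hgc : Continuous g) (hg0 : ∀ x, 0 ≤ g x) (hgb : BddMeas fun x ↦ (g x : ℂ))
    (hlim : Tendsto (fun N ↦ mulOp (fun x ↦ (g x : ℂ)) (F N)) atTop (𝓝 h)) {ν₀ : ℝ} (hν₀ : 0 < ν₀) :
    weightedEnergy (TemperedDistribution.fourierMultiplierCLM ℂ m
      (Lp.toTemperedDistribution f : 𝓢'(Rn n, ℂ))) (fun x ↦ ν₀ * g x ^ 2) ≤
      ENNReal.ofReal ν₀ * ‖h‖ₑ ^ 2 := by
  set f₀ : Rn n → ℂ := fun x ↦ (g x : ℂ)⁻¹ * h x with hf₀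
  have hU : {x | 0 < ν₀ * g x ^ 2} = {x | 0 < g x} := by
    ext x
    change 0 < ν₀ * g x ^ 2 ↔ 0 < g x
    constructor
    · intro hx
      refine lt_of_le_of_ne (hg0 x) fun h0 ↦ ?_
      rw [← h0] at hx
      simp at hx
    · intro hx
      positivity
  have hUo : IsOpen {x | 0 < g x} := isOpen_lt continuous_const hgc
  have hrep : RepresentsOn (TemperedDistribution.fourierMultiplierCLM ℂ m
      (Lp.toTemperedDistribution f : 𝓢'(Rn n, ℂ))) f₀ {x | 0 < ν₀ * g x ^ 2} := by
    rw [hU]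
    refine ⟨((locallyIntegrable_L2 h).locallyIntegrableOn _).continuousOn_mul ?_
      hUo.isLocallyClosed, fun ψ hψ hsupp ↦ ?_⟩
    · refine ContinuousOn.inv₀ (Complex.continuous_ofReal.comp hgc).continuousOn fun x hx ↦ ?_
      have : 0 < g x := hx
      simpa using this.ne'
    · set θ : Rn n → ℂ := fun x ↦ ψ x * (g x : ℂ)⁻¹ with hθ
      obtain ⟨δ, hδ, hδg⟩ : ∃ δ : ℝ, 0 < δ ∧ ∀ x ∈ tsupport ψ, δ ≤ g x := by
        rcases (tsupport ψ).eq_empty_or_nonempty with he | hne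
        · exact ⟨1, one_pos, by simp [he]⟩
        · obtain ⟨x₀, hx₀, hmin⟩ := IsCompact.exists_isMinOn hψ hne hgc.continuousOn
          exact ⟨g x₀, hsupp hx₀, fun x hx ↦ hmin hx⟩
      have hθL : MemLp θ 2 volume := by
        refine (ψ.memLp 2 volume).of_le_mul (c := δ⁻¹) ?_ (ae_of_all _ fun x ↦ ?_)
        · exact (ψ.continuous.measurable.mul
            (Complex.measurable_ofReal.comp hgc.measurable).inv).aestronglyMeasurable
        · by_cases hx : x ∈ tsupport ψ
          · rw [hθ, norm_mul, mul_comm, norm_inv, Complex.norm_real,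
              Real.norm_of_nonneg (hg0 x)]
            gcongr
            exact hδg x hx
          · have h0 : ψ x = 0 := image_eq_zero_of_notMem_tsupport hx
            simp [hθ, h0]
      have hψθ : ∀ x, ψ x = θ x * (g x : ℂ) := fun x ↦ by
        by_cases hx : x ∈ tsupport ψ
        · have h1 : (g x : ℂ) ≠ 0 := by
            have : 0 < g x := hsupp hx
            simpa using this.ne'
          rw [hθ]
          field_simp
        · have h0 : ψ x = 0 := image_eq_zero_of_notMem_tsupport hx
          simp [hθ, h0]
      -- both sides are limits of the integrals against the truncations
      have l1 : Tendsto (fun N ↦ ∫ x, ψ x * F N x) atTop (𝓝 (∫ x, θ x * h x)) := by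
        have e : ∀ N, ∫ x, ψ x * F N x = ∫ x, θ x * mulOp (fun x ↦ (g x : ℂ)) (F N) x := fun N ↦ by
          apply integral_congr_ae
          filter_upwards [coeFn_mulOp hgb (F N)] with x hx
          rw [hx, hψθ]
          ring
        simp_rw [e, integral_mul_eq_inner hθL]
        exact tendsto_const_nhds.inner hlim
      have l2 : Tendsto (fun N ↦ ∫ x, ψ x * F N x) atTop
          (𝓝 (∫ ξ, (𝓕⁻ ψ : 𝓢(Rn n, ℂ)) ξ * (m ξ * (𝓕 f : L2 n) ξ))) := by
        have e : ∀ N : ℕ, ∫ x, ψ x * F N x = ∫ ξ, (𝓕⁻ ψ : 𝓢(Rn n, ℂ)) ξ *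
            (m ξ * (bump (((2 : ℝ) ^ N)⁻¹ • ξ) : ℂ) * (𝓕 f : L2 n) ξ) := fun N ↦ by
          have h1 := integral_schwartz_mul_fourier (F N) (𝓕⁻ ψ)
          rw [FourierTransform.fourier_fourierInv_eq] at h1
          rw [← h1]
          apply integral_congr_ae
          filter_upwards [hF N] with ξ hξ
          rw [hξ]
        simp_rw [e]
        have hS : Integrable (fun ξ ↦ ‖SchwartzMap.smulLeftCLM ℂ m (𝓕⁻ ψ) ξ‖ *
            ‖(𝓕 f : L2 n) ξ‖) volume :=
          ((SchwartzMap.smulLeftCLM ℂ m (𝓕⁻ ψ)).memLp 2 volume).norm.integrable_mul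
            (Lp.memLp (𝓕 f : L2 n)).norm
        refine tendsto_integral_of_dominated_convergence _ (fun N ↦ ?_) hS (fun N ↦ ?_) ?_
        · have hb : Continuous fun ξ : Rn n ↦ (bump (((2 : ℝ) ^ N)⁻¹ • ξ) : ℂ) :=
            Complex.continuous_ofReal.comp (bump_smul_contDiff _).continuous
          exact (SchwartzMap.continuous _).aestronglyMeasurable.mul
            (((hm.1.continuous.mul hb).aestronglyMeasurable).mul (Lp.aestronglyMeasurable _))
        · refine ae_of_all _ fun ξ ↦ ?_
          rw [SchwartzMap.smulLeftCLM_apply_apply hm, smul_eq_mul]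
          simp only [norm_mul]
          have h1 : ‖(bump (((2 : ℝ) ^ N)⁻¹ • ξ) : ℂ)‖ ≤ 1 := by
            rw [Complex.norm_real, Real.norm_of_nonneg (bump_nonneg _)]
            exact bump_le_one _
          calc _ = ‖m ξ‖ * ‖(𝓕⁻ ψ : 𝓢(Rn n, ℂ)) ξ‖ * ‖(𝓕 f : L2 n) ξ‖ *
                ‖(bump (((2 : ℝ) ^ N)⁻¹ • ξ) : ℂ)‖ := by ring
            _ ≤ _ := mul_le_of_le_one_right (by positivity) h1
        · refine ae_of_all _ fun ξ ↦ ?_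
          obtain ⟨N₀, hN₀⟩ := pow_unbounded_of_one_lt ‖ξ‖ (one_lt_two (α := ℝ))
          refine tendsto_const_nhds.congr' ?_
          filter_upwards [eventually_ge_atTop N₀] with N hN
          have h1 : bump (((2 : ℝ) ^ N)⁻¹ • ξ) = 1 := bump_eq_one (by
            have h2 : (2 : ℝ) ^ N₀ ≤ 2 ^ N := pow_le_pow_right₀ (by norm_num) hN
            rw [norm_smul, norm_inv, Real.norm_of_nonneg (by positivity),
              inv_mul_le_iff₀ (by positivity)]
            linarith)
          rw [h1]
          simp
      have h2 := tendsto_nhds_unique l2 l1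
      rw [TemperedDistribution.fourierMultiplierCLM_apply_apply, toTD_apply,
        ← integral_schwartz_mul_fourier]
      have h3 : ∫ x, ψ x * f₀ x = ∫ x, θ x * h x :=
        integral_congr_ae (ae_of_all _ fun x ↦ by simp only [hf₀, hθ]; ring)
      rw [h3, ← h2]
      refine integral_congr_ae (ae_of_all _ fun ξ ↦ ?_)
      simp only [SchwartzMap.smulLeftCLM_apply_apply hm, smul_eq_mul]
      ring
  refine (iInf₂_le f₀ hrep).trans ?_
  rw [enorm_sq_lintegral, ← lintegral_const_mul' _ _ ENNReal.ofReal_ne_top]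
  refine lintegral_mono fun x ↦ ?_
  rcases (hg0 x).eq_or_lt with h0 | h0
  · simp [← h0]
  · have h1 : ‖f₀ x‖ₑ ^ 2 * ENNReal.ofReal (g x ^ 2) = ‖h x‖ₑ ^ 2 := by
      have h2 : ‖(g x : ℂ)‖ₑ = ENNReal.ofReal (g x) := by
        rw [← ofReal_norm, Complex.norm_real, Real.norm_of_nonneg h0.le]
      have h3 : h x = (g x : ℂ) * f₀ x := by
        have : (g x : ℂ) ≠ 0 := by simpa using h0.ne'
        rw [hf₀]
        field_simp
      clear_value f₀
      calc _ = ‖(g x : ℂ) * f₀ x‖ₑ ^ 2 := by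
            rw [enorm_mul, mul_pow, h2, ENNReal.ofReal_pow h0.le, mul_comm]
          _ = _ := by rw [← h3]
    rw [ENNReal.ofReal_mul hν₀.le, mul_left_comm, h1]

/-- Dyadic pieces at frequencies that differ by a factor of at least `16` have disjoint supports. -/
theorem inner_dyadicSymbol_eq_zero {ρ A : ℝ} {m : Rn n → ℂ} {j : ℕ → 𝓢(Rn n, ℂ)}
    (hj : DyadicSymbol ρ A m j) {k l : ℕ} (hkl : k + 4 ≤ l) (f h : L2 n) :
    inner ℂ (mult (j k) f) (mult (j l) h) = (0 : ℂ) := by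
  have h0 : ∀ ξ, (starRingEnd ℂ) (j l ξ) * j k ξ = 0 := fun ξ ↦ by
    have hp : (0 : ℝ) < 2 ^ k := by positivity
    have hl : (2 : ℝ) ^ k * 16 ≤ 2 ^ l := by
      calc (2 : ℝ) ^ k * 16 = 2 ^ (k + 4) := by rw [pow_add]; norm_num
        _ ≤ 2 ^ l := pow_le_pow_right₀ (by norm_num) hkl
    rcases le_or_gt (8 * 2 ^ k) ‖ξ‖ with h1 | h1
    · have h2 : fatReal (((2 : ℝ) ^ k)⁻¹ • ξ) = 0 := fatReal_eq_zero_of_ge (by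
        rw [norm_smul, norm_inv, Real.norm_of_nonneg hp.le, inv_mul_eq_div, le_div_iff₀ hp]
        exact h1)
      rw [hj.eq k, h2]
      simp
    · have h2 : fatReal (((2 : ℝ) ^ l)⁻¹ • ξ) = 0 := fatReal_eq_zero_of_le (by
        have hp' : (0 : ℝ) < 2 ^ l := by positivity
        rw [norm_smul, norm_inv, Real.norm_of_nonneg hp'.le, inv_mul_eq_div, div_le_iff₀ hp']
        linarith)
      rw [hj.eq l, h2]
      simp
  have hz : mult (fun ξ ↦ (starRingEnd ℂ) (j l ξ) * j k ξ) f = 0 := by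
    have h1 : ‖mult (fun ξ ↦ (starRingEnd ℂ) (j l ξ) * j k ξ) f‖ ≤ 0 * ‖f‖ :=
      norm_mult_le ((bddMeas_schwartz (j l)).conj.mul (bddMeas_schwartz (j k))).1
        (fun ξ ↦ by rw [h0, norm_zero]) f
    rw [zero_mul] at h1
    exact norm_le_zero_iff.1 h1
  rw [inner_mult_right (bddMeas_schwartz _),
    mult_mult (bddMeas_schwartz _).conj (bddMeas_schwartz _), hz, inner_zero_left]

/-- The frequency truncations of a multiplier, summed up from dyadic blocks. -/
def trunc (m : Rn n → ℂ) (j : ℕ → 𝓢(Rn n, ℂ)) (f : L2 n) (N : ℕ) : L2 n :=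
  mult (fun ξ ↦ m ξ * (bump ξ : ℂ)) f + ∑ k ∈ Finset.range N, mult (j k) (blk k f)

theorem bddMeas_mul_bump {m : Rn n → ℂ} (hm : Continuous m) : BddMeas fun ξ ↦ m ξ * (bump ξ : ℂ) := by
  have hc : Continuous fun ξ ↦ m ξ * (bump ξ : ℂ) :=
    hm.mul (Complex.continuous_ofReal.comp bump_contDiff.continuous)
  have hs : HasCompactSupport fun ξ ↦ m ξ * (bump ξ : ℂ) := by
    refine hasCompactSupport_of_ball 2 fun ξ hξ ↦ ?_
    rw [bump_eq_zero (by nlinarith)]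
    simp
  obtain ⟨C, hC⟩ := hs.exists_bound_of_continuous hc
  exact ⟨hc.measurable, C, hC⟩

theorem fourier_trunc {ρ A : ℝ} {m : Rn n → ℂ} (hm : Continuous m) {j : ℕ → 𝓢(Rn n, ℂ)}
    (hj : DyadicSymbol ρ A m j) (f : L2 n) (N : ℕ) :
    (𝓕 (trunc m j f N) : L2 n) =ᵐ[volume] fun ξ ↦
      m ξ * (bump (((2 : ℝ) ^ N)⁻¹ • ξ) : ℂ) * (𝓕 f : L2 n) ξ := by
  induction N with
  | zero =>
    rw [trunc, Finset.sum_range_zero, add_zero]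
    filter_upwards [coeFn_fourier_mult (bddMeas_mul_bump hm) f] with ξ hξ
    rw [hξ]
    simp
  | succ N ih =>
    have e : trunc m j f (N + 1) = trunc m j f N + mult (j N) (blk N f) := by
      rw [trunc, trunc, Finset.sum_range_succ, add_assoc]
    rw [e, FourierTransform.fourier_add]
    filter_upwards [Lp.coeFn_add (𝓕 (trunc m j f N) : L2 n) (𝓕 (mult (j N) (blk N f)) : L2 n), ih,
      coeFn_fourier_mult (bddMeas_schwartz (j N)) (blk N f),
      coeFn_fourier_mult (bddMeas_schwartz (dyad N annSym)) f] with ξ h1 h2 h3 h4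
    rw [blk] at h3
    rw [h1, Pi.add_apply, h2, blk, h3, h4, hj.eq, dyad_apply, annSym_apply]
    have h5 := annReal_mul_fatReal (((2 : ℝ) ^ N)⁻¹ • ξ)
    have h6 : annReal (((2 : ℝ) ^ N)⁻¹ • ξ) =
        bump (((2 : ℝ) ^ (N + 1))⁻¹ • ξ) - bump (((2 : ℝ) ^ N)⁻¹ • ξ) := by
      rw [annReal, smul_smul, ← mul_inv, pow_succ']
    have h7 : (fatReal (((2 : ℝ) ^ N)⁻¹ • ξ) : ℂ) * annReal (((2 : ℝ) ^ N)⁻¹ • ξ) =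
        bump (((2 : ℝ) ^ (N + 1))⁻¹ • ξ) - bump (((2 : ℝ) ^ N)⁻¹ • ξ) := by
      rw [← Complex.ofReal_mul, h5, h6, Complex.ofReal_sub]
    linear_combination m ξ * (𝓕 f : L2 n) ξ * h7

theorem four_rpow_pow (s : ℝ) (k : ℕ) : ((4 : ℝ) ^ s) ^ k = (((2 : ℝ) ^ k) ^ s) ^ 2 := by
  rw [Real.rpow_pow_comm (by norm_num), sq, ← Real.mul_rpow (by positivity) (by positivity),
    ← mul_pow]
  norm_num

/-- The main part of a dyadic piece of the weighted multiplier is controlled by the local smoothing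
term of the same frequency. -/
theorem norm_sq_mult_mulOp_blk_le {α s A : ℝ} {m : Rn n → ℂ} {j : ℕ → 𝓢(Rn n, ℂ)}
    (hj : DyadicSymbol (s + α / 2) A m j) (g : Rn n → ℝ) (k : ℕ) (f : L2 n) :
    ‖mult (j k) (mulOp (fun x ↦ (g x : ℂ)) (blk k f))‖ ^ 2 ≤ A ^ 2 * smoothTerm α s g k f := by
  have h1 := norm_mult_le (j k).continuous.measurable (hj.norm_le k)
    (mulOp (fun x ↦ (g x : ℂ)) (blk k f))
  have hp : (0 : ℝ) < 2 ^ k := by positivity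
  have h2 : ((2 : ℝ) ^ k) ^ α = (((2 : ℝ) ^ k) ^ (α / 2)) ^ 2 := by
    rw [sq, ← Real.rpow_add hp]
    congr 1
    ring
  calc _ ≤ (A * ((2 : ℝ) ^ k) ^ (s + α / 2) * ‖mulOp (fun x ↦ (g x : ℂ)) (blk k f)‖) ^ 2 :=
        pow_le_pow_left₀ (norm_nonneg _) h1 2
    _ = _ := by
        rw [smoothTerm, four_rpow_pow, h2, Real.rpow_add hp]
        ring

/-- The square root of the weight commutes with a dyadic piece of the multiplier up to an error that
decays geometrically, because the multiplier has order less than `s + 1`. -/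
theorem norm_commutator_blk_le {α s A Λ : ℝ} {ν : Rn n} {m : Rn n → ℂ} {j : ℕ → 𝓢(Rn n, ℂ)}
    (hj : DyadicSymbol (s + α / 2) A m j) {φ g : Rn n → ℝ} (hφ : Weight ν Λ φ g) {f : L2 n} {D : ℝ}
    (hD : ∀ k, ((2 : ℝ) ^ k) ^ s * ‖blk k f‖ ≤ D) (k : ℕ) :
    ‖mulOp (fun x ↦ (g x : ℂ)) (mult (j k) (blk k f)) -
      mult (j k) (mulOp (fun x ↦ (g x : ℂ)) (blk k f))‖ ≤ Λ * A * D * ((2 : ℝ) ^ (α / 2 - 1)) ^ k := by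
  have hΛ := hφ.nonneg
  have hA := hj.nonneg
  have hp : (0 : ℝ) < 2 ^ k := by positivity
  have h1 := norm_commutator_le (j k) hφ.bdd_sqrt (Λ := Λ) (fun x y ↦ by
    rw [← Complex.ofReal_sub, Complex.norm_real]
    exact hφ.lip_sqrt x y) (blk k f)
  calc _ ≤ Λ * mom 1 (j k) * ‖blk k f‖ := h1
    _ ≤ Λ * (A * ((2 : ℝ) ^ k) ^ (s + α / 2 - 1)) * ‖blk k f‖ := by
        gcongr
        exact hj.mom_le k
    _ = Λ * A * (((2 : ℝ) ^ k) ^ s * ‖blk k f‖) * ((2 : ℝ) ^ (α / 2 - 1)) ^ k := by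
        rw [Real.rpow_pow_comm (by norm_num), show s + α / 2 - 1 = s + (α / 2 - 1) by ring,
          Real.rpow_add hp]
        ring
    _ ≤ _ := by
        gcongr
        exact hD k

/-- A weighted energy of order `s + α / 2` is controlled by the Sobolev norm of order `s` and the
sum of the local smoothing terms. -/
theorem exists_weightedEnergy_le {α s A : ℝ} (hα₂ : α < 2) (hs : 0 < s) {m : Rn n → ℂ}
    (hm : m.HasTemperateGrowth) {j : ℕ → 𝓢(Rn n, ℂ)} (hj : DyadicSymbol (s + α / 2) A m j)
    (ν : Rn n) {ν₀ : ℝ} (hν₀ : 0 < ν₀) (Λ : ℝ) :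
    ∃ C : ℝ≥0, ∀ φ g : Rn n → ℝ, Weight ν Λ φ g → (∀ x, 0 ≤ g x) → ∀ f : L2 n, MemSob s f →
      weightedEnergy (TemperedDistribution.fourierMultiplierCLM ℂ m
        (Lp.toTemperedDistribution f : 𝓢'(Rn n, ℂ))) (fun x ↦ ν₀ * g x ^ 2) ≤
        C * (ENNReal.ofReal (sobR s f ^ 2) + ∑' k, ENNReal.ofReal (smoothTerm α s g k f)) := by
  obtain ⟨C₃, hC₃, hblk⟩ := exists_sum_blk_le (n := n) hs
  obtain ⟨hbm, B, hB⟩ := bddMeas_mul_bump hm.1.continuous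
  have hB0 : 0 ≤ B := (norm_nonneg _).trans (hB 0)
  have hA := hj.nonneg
  set q : ℝ := (2 : ℝ) ^ (α / 2 - 1) with hq
  have hq0 : 0 ≤ q := by positivity
  have hq1 : q < 1 := Real.rpow_lt_one_of_one_lt_of_neg (by norm_num) (by linarith)
  clear_value q
  set E : ℝ := Λ * A * √C₃ * (1 - q)⁻¹ with hE
  -- the constant is positive, so that the case of an infinite sum is trivial
  refine ⟨max 1 (ν₀ * (3 * ((Λ * B) ^ 2 + 7 * A ^ 2 + E ^ 2))).toNNReal, fun φ g hφ hg0 f hf ↦ ?_⟩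
  have hΛ := hφ.nonneg
  by_cases htop : ∑' k, ENNReal.ofReal (smoothTerm α s g k f) = ⊤
  · rw [htop, add_top, ENNReal.mul_top]
    · exact le_top
    · have : (0 : ℝ≥0) < max 1 (ν₀ * (3 * ((Λ * B) ^ 2 + 7 * A ^ 2 + E ^ 2))).toNNReal :=
        lt_max_of_lt_left one_pos
      exact_mod_cast this.ne'
  have hS : Summable fun k ↦ smoothTerm α s g k f := by
    refine (ENNReal.summable_toReal htop).congr fun k ↦ ?_
    exact (ENNReal.toReal_ofReal (smoothTerm_nonneg _ _ _ _ _))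
  set M := sobR s f with hM
  have hM0 : 0 ≤ M := sobR_nonneg s f
  have hD : ∀ k, ((2 : ℝ) ^ k) ^ s * ‖blk k f‖ ≤ √C₃ * M := by
    intro k
    have h1 := hblk f hf (k + 1)
    have h2 : ((4 : ℝ) ^ s) ^ k * ‖blk k f‖ ^ 2 ≤ C₃ * M ^ 2 := by
      refine le_trans ?_ h1
      refine le_trans ?_ (Finset.single_le_sum (f := fun k ↦
        ((4 : ℝ) ^ s) ^ k * (‖blk k f‖ ^ 2 + ‖f - lowPart k f‖ ^ 2)) (fun i _ ↦ by positivity)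
        (Finset.self_mem_range_succ k))
      gcongr
      exact le_add_of_nonneg_right (sq_nonneg _)
    refine (pow_le_pow_iff_left₀ (by positivity) (by positivity) two_ne_zero).1 ?_
    rw [mul_pow, mul_pow, Real.sq_sqrt hC₃, ← four_rpow_pow]
    exact h2
  set G : L2 n →L[ℂ] L2 n := mulOp (fun x ↦ (g x : ℂ)) with hG
  have hGle : ∀ f, ‖G f‖ ≤ Λ * ‖f‖ := fun f ↦ norm_mulOp_le hφ.bdd_sqrt.1 (fun x ↦ by
    simpa using hφ.abs_sqrt_le x) f
  set x : ℕ → L2 n := fun k ↦ mult (j k) (G (blk k f)) with hx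
  set y : ℕ → L2 n := fun k ↦ G (mult (j k) (blk k f)) - mult (j k) (G (blk k f)) with hy
  have hxle : ∀ k, ‖x k‖ ^ 2 ≤ A ^ 2 * smoothTerm α s g k f :=
    fun k ↦ norm_sq_mult_mulOp_blk_le hj g k f
  have hyle : ∀ k, ‖y k‖ ≤ Λ * A * (√C₃ * M) * q ^ k := fun k ↦ by
    rw [hq]
    exact norm_commutator_blk_le hj hφ hD k
  have hxs : Summable fun k ↦ ‖x k‖ ^ 2 :=
    Summable.of_nonneg_of_le (fun k ↦ by positivity) hxle (hS.mul_left _)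
  obtain ⟨hxsum, hxnorm⟩ := summable_of_almost_orthogonal (x := x)
    (fun k l hkl ↦ inner_dyadicSymbol_eq_zero hj hkl _ _) hxs
  have hgeo : HasSum (fun k ↦ Λ * A * (√C₃ * M) * q ^ k) (E * M) := by
    have e : E * M = Λ * A * (√C₃ * M) * (1 - q)⁻¹ := by rw [hE]; ring
    rw [e]
    exact (hasSum_geometric_of_lt_one hq0 hq1).mul_left _
  have hysum : Summable y := Summable.of_norm_bounded hgeo.summable hyle
  have hynorm : ‖∑' k, y k‖ ≤ E * M := tsum_of_norm_bounded hgeo hyle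
  have hxnorm' : ‖∑' k, x k‖ ^ 2 ≤ 7 * A ^ 2 * ∑' k, smoothTerm α s g k f := by
    refine hxnorm.trans ?_
    have h1 := hxs.tsum_le_tsum hxle (hS.mul_left _)
    rw [tsum_mul_left] at h1
    linarith
  set w : L2 n := G (mult (fun ξ ↦ m ξ * (bump ξ : ℂ)) f) with hw
  have hwle : ‖w‖ ≤ Λ * B * M := by
    calc ‖w‖ ≤ Λ * (B * ‖f‖) := (hGle _).trans (by gcongr; exact norm_mult_le hbm hB f)
      _ ≤ Λ * (B * M) := by gcongr; exact hf.norm_le hs.le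
      _ = _ := by ring
  -- `w`, `x k` and `y k` come from the low frequencies, the main parts and the commutators
  have hlim : Tendsto (fun N ↦ G (trunc m j f N)) atTop (𝓝 (w + (∑' k, x k + ∑' k, y k))) := by
    have e : ∀ N, G (trunc m j f N) =
        w + (∑ k ∈ Finset.range N, x k + ∑ k ∈ Finset.range N, y k) := fun N ↦ by
      rw [trunc, map_add, map_sum, ← Finset.sum_add_distrib]
      congr 1
      exact Finset.sum_congr rfl fun k _ ↦ by simp [hx, hy]
    simp_rw [e]
    exact tendsto_const_nhds.add
      (hxsum.hasSum.tendsto_sum_nat.add hysum.hasSum.tendsto_sum_nat)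
  refine (weightedEnergy_le_of_tendsto hm (fourier_trunc hm.1.continuous hj f) hφ.cont_sqrt hg0
    hφ.bdd_sqrt hlim hν₀).trans ?_
  set S := ∑' k, smoothTerm α s g k f with hS'
  have hS0 : 0 ≤ S := tsum_nonneg fun k ↦ smoothTerm_nonneg _ _ _ _ _
  rw [← ENNReal.ofReal_tsum_of_nonneg (fun k ↦ smoothTerm_nonneg _ _ _ _ _) hS,
    ← ENNReal.ofReal_add (sq_nonneg _) hS0, ← ofReal_norm, ← ENNReal.ofReal_pow (norm_nonneg _),
    ← ENNReal.ofReal_mul hν₀.le]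
  have hfin : ν₀ * ‖w + (∑' k, x k + ∑' k, y k)‖ ^ 2 ≤
      ν₀ * (3 * ((Λ * B) ^ 2 + 7 * A ^ 2 + E ^ 2)) * (M ^ 2 + S) := by
    have h1 : ‖w + (∑' k, x k + ∑' k, y k)‖ ^ 2 ≤
        3 * (‖w‖ ^ 2 + ‖∑' k, x k‖ ^ 2 + ‖∑' k, y k‖ ^ 2) := by
      have h2 : ‖w + (∑' k, x k + ∑' k, y k)‖ ≤ ‖w‖ + (‖∑' k, x k‖ + ‖∑' k, y k‖) :=
        (norm_add_le _ _).trans (by gcongr; exact norm_add_le _ _)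
      have h3 := pow_le_pow_left₀ (norm_nonneg _) h2 2
      nlinarith [sq_nonneg (‖w‖ - ‖∑' k, x k‖), sq_nonneg (‖w‖ - ‖∑' k, y k‖),
        sq_nonneg (‖∑' k, x k‖ - ‖∑' k, y k‖)]
    have h4 : ‖w‖ ^ 2 ≤ (Λ * B) ^ 2 * M ^ 2 := by
      rw [← mul_pow]
      exact pow_le_pow_left₀ (norm_nonneg _) hwle 2
    have h5 : ‖∑' k, y k‖ ^ 2 ≤ E ^ 2 * M ^ 2 := by
      rw [← mul_pow]
      exact pow_le_pow_left₀ (norm_nonneg _) hynorm 2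
    have h6 : (Λ * B) ^ 2 * M ^ 2 + 7 * A ^ 2 * S + E ^ 2 * M ^ 2 ≤
        ((Λ * B) ^ 2 + 7 * A ^ 2 + E ^ 2) * (M ^ 2 + S) := by
      have a1 : 0 ≤ (Λ * B) ^ 2 * S := by positivity
      have a2 : 0 ≤ A ^ 2 * M ^ 2 := by positivity
      have a3 : 0 ≤ E ^ 2 * S := by positivity
      linarith
    calc _ ≤ ν₀ * (3 * (((Λ * B) ^ 2 + 7 * A ^ 2 + E ^ 2) * (M ^ 2 + S))) := by
          gcongr
          linarith
      _ = _ := by ring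
  refine (ENNReal.ofReal_le_ofReal hfin).trans ?_
  rw [ENNReal.ofReal_mul (by positivity)]
  gcongr
  exact ENNReal.coe_le_coe.2 (le_max_right _ _)

end FZK

end

noncomputable section

namespace FZK

variable {n : ℕ} [NeZero n]

/-- The weight `∂_{x₁} φ` of a plane wave. -/
theorem lineDeriv_planeWave {ϕ : ℝ → ℝ} (hϕ : Differentiable ℝ ϕ) (ν : Fin n → ℝ) (δ : ℝ) (x : Rn n) :
    lineDeriv ℝ (fun x : Rn n ↦ ϕ (inner ℝ (dirVec ν) x + δ)) x (stdVec 0) =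
      ν 0 * deriv ϕ (inner ℝ (dirVec ν) x + δ) := by
  have e : inner ℝ (dirVec ν) (stdVec (0 : Fin n)) = ν 0 := by
    rw [inner_dirVec]
    simp [stdVec]
  have h1 : HasDerivAt (fun t : ℝ ↦ inner ℝ (dirVec ν) (x + t • stdVec (0 : Fin n)) + δ) (ν 0) 0 := by
    have h2 : HasDerivAt (fun t : ℝ ↦ inner ℝ (dirVec ν) x + t * ν 0 + δ) (1 * ν 0) 0 :=
      (((hasDerivAt_id (0 : ℝ)).mul_const (ν 0)).const_add _).add_const δ
    rw [one_mul] at h2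
    simpa only [inner_add_right, inner_smul_right, e] using h2
  have h3 := (hϕ (inner ℝ (dirVec ν) x + δ)).hasDerivAt
  rw [lineDeriv, mul_comm]
  refine HasDerivAt.deriv (HasDerivAt.comp (0 : ℝ) ?_ h1)
  simpa using h3

/-- Integration in time of the pointwise bound for the weighted energies. -/
theorem lintegral_weightedEnergy_le {α s T : ℝ} {u : ℝ → Lp ℝ 2 (volume : Measure (Rn n))}
    (hu : IsSolution α s T u) {g : Rn n → ℝ} {P : 𝓢'(Rn n, ℂ) → 𝓢'(Rn n, ℂ)} {w : Rn n → ℝ} {C : ℝ≥0}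
    (h : ∀ f : L2 n, MemSob s f →
      weightedEnergy (P (Lp.toTemperedDistribution f : 𝓢'(Rn n, ℂ))) w ≤
        C * (ENNReal.ofReal (sobR s f ^ 2) + ∑' k, ENNReal.ofReal (smoothTerm α s g k f))) :
    ∫⁻ t in Ioo 0 T, weightedEnergy (P (toDist (u t))) w ≤
      C * (ENNReal.ofReal T * normLinftyHs T s u ^ 2 +
        ∫⁻ t in Ioo 0 T, ∑' k, ENNReal.ofReal (smoothTerm α s g k (complexify (u t)))) := by
  calc _ ≤ ∫⁻ t in Ioo 0 T, C * (normLinftyHs T s u ^ 2 +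
        ∑' k, ENNReal.ofReal (smoothTerm α s g k (complexify (u t)))) := by
        refine setLIntegral_mono' measurableSet_Ioo fun t ht ↦ (h _ (hu.memSob ht)).trans ?_
        gcongr
        rw [ENNReal.ofReal_pow (sobR_nonneg _ _), sobR, ENNReal.ofReal_toReal (hu.memSob ht).ne]
        gcongr
        exact hu.sobolevNorm_le ht
    _ = _ := by
        rw [lintegral_const_mul' _ _ ENNReal.coe_ne_top, lintegral_add_left measurable_const,
          setLIntegral_const, Real.volume_Ioo, sub_zero, mul_comm (ENNReal.ofReal T)]

end FZK

end

theorem lemma1p2 (n : ℕ) [NeZero n] (hn : 2 ≤ n) (α : ℝ) (hα₀ : 0 < α) (hα₂ : α < 2)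
    (s : ℝ) (hs : (n : ℝ) / 2 + 1 < s) (r : ℝ) (hr : (n : ℝ) / 2 < r)
    (ν : Fin n → ℝ) (hν : FZK.Admissible α ν) (c : ℝ) :
    ∃ K : ℝ≥0, ∀ (ϕ : ℝ → ℝ) (δ : ℝ) (φ : FZK.Rn n → ℝ),
      ContDiff ℝ ∞ ϕ →
      Monotone ϕ →
      (∀ y ∈ Icc (0 : ℝ) 1, deriv ϕ y = 1) →
      (∀ j : ℕ, j ≤ 4 → ∀ y : ℝ, |iteratedDeriv j ϕ y| ≤ c) →
      (∀ y : ℝ, 0 ≤ deriv ϕ y) →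
      (∀ x : FZK.Rn n, φ x = ϕ (∑ j, ν j * x j + δ)) →
      ∀ (T : ℝ), 0 < T → ∀ u : ℝ → Lp ℝ 2 (volume : Measure (FZK.Rn n)),
        FZK.IsSolution α s T u →
        (∫⁻ t in Ioo 0 T,
            FZK.weightedEnergy (FZK.besselJ (s + α / 2) (FZK.toDist (u t)))
              (fun x ↦ lineDeriv ℝ φ x (FZK.stdVec 0)))
          + (∫⁻ t in Ioo 0 T,
            FZK.weightedEnergy
              (∂_{FZK.stdVec (0 : Fin n)} (FZK.besselJ (s + (α - 2) / 2) (FZK.toDist (u t))))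
              (fun x ↦ lineDeriv ℝ φ x (FZK.stdVec 0)))
        ≤ K * (1 + ENNReal.ofReal T + FZK.normGradL1Linfty T u
              + ENNReal.ofReal T * FZK.normLinftyHs T r u)
            * FZK.normLinftyHs T s u ^ 2 := by
  have hn' : (2 : ℝ) ≤ n := by exact_mod_cast hn
  obtain ⟨c₀, hc₀, hform⟩ := FZK.exists_form_ge hn hα₀ hα₂ hν
  obtain ⟨Λ, -, hΛ⟩ := FZK.weight_of_profile (FZK.dirVec ν) c
  obtain ⟨A₁, j₁, hj₁⟩ := FZK.exists_dyadicSymbol_bessel (n := n) (s + α / 2)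
  obtain ⟨A₂, j₂, hj₂⟩ := FZK.exists_dyadicSymbol_deriv (n := n) (s + α / 2) 0
  obtain ⟨C₁, hC₁⟩ := FZK.exists_weightedEnergy_le hα₂ (by linarith)
    (FZK.besselSymbol_hasTemperateGrowth n _) hj₁ (FZK.dirVec ν) hν.1 Λ
  obtain ⟨C₂, hC₂⟩ := FZK.exists_weightedEnergy_le hα₂ (by linarith)
    (FZK.derivBesselSymbol_hasTemperateGrowth _ 0) hj₂ (FZK.dirVec ν) hν.1 Λ
  -- an exponent `r > s` may be lowered to `s`, since the norm of `H ^ r` increases with `r`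
  obtain ⟨C, hC⟩ := FZK.exists_lintegral_smooth_le hα₀ hα₂ hs (by linarith)
    (lt_min hr (by linarith : (n : ℝ) / 2 < s)) (min_le_right r s) hc₀ hform Λ
  refine ⟨(C₁ + C₂) * (1 + C) + 1, fun ϕ δ φ hϕ _ _ hb hpos hφ T hT u hu ↦ ?_⟩
  set M := FZK.normLinftyHs T s u with hM
  set X := 1 + ENNReal.ofReal T + FZK.normGradL1Linfty T u
    + ENNReal.ofReal T * FZK.normLinftyHs T r u with hX
  have hX1 : 1 ≤ X := by
    rw [hX, add_assoc, add_assoc]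
    exact le_self_add
  -- `K X > 0`, so that the right-hand side is infinite in this case
  by_cases htop : M = ⊤
  · have hK : (1 : ℝ≥0∞) ≤ ((C₁ + C₂) * (1 + C) + 1 : ℝ≥0) := by
      exact_mod_cast le_add_self
    have : ((C₁ + C₂) * (1 + C) + 1 : ℝ≥0) * X ≠ 0 :=
      (zero_lt_one.trans_le (one_le_mul_of_one_le_of_one_le hK hX1)).ne'
    rw [htop, ENNReal.top_pow two_ne_zero, ENNReal.mul_top this]
    exact le_top
  have hw := hΛ ϕ δ hϕ hb hpos
  have hφ' : φ = fun x ↦ ϕ (inner ℝ (FZK.dirVec ν) x + δ) := by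
    ext x
    rw [hφ, FZK.inner_dirVec]
  have hweight : (fun x ↦ lineDeriv ℝ φ x (FZK.stdVec 0)) =
      fun x ↦ ν 0 * √(deriv ϕ (inner ℝ (FZK.dirVec ν) x + δ)) ^ 2 := by
    ext x
    rw [hφ', FZK.lineDeriv_planeWave (hϕ.differentiable (by simp)), Real.sq_sqrt (hpos _)]
  rw [hweight]
  set g : FZK.Rn n → ℝ := fun x ↦ √(deriv ϕ (inner ℝ (FZK.dirVec ν) x + δ)) with hg
  have hg0 : ∀ x, 0 ≤ g x := fun x ↦ Real.sqrt_nonneg _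
  have h1 := FZK.lintegral_weightedEnergy_le hu (P := FZK.besselJ (s + α / 2))
    (hC₁ _ g hw hg0)
  have h2 := FZK.lintegral_weightedEnergy_le hu
    (P := fun F ↦ ∂_{FZK.stdVec (0 : Fin n)} (FZK.besselJ (s + (α - 2) / 2) F)) (g := g)
    (w := fun x ↦ ν 0 * g x ^ 2) (C := C₂) fun f hf ↦ by
      rw [FZK.lineDeriv_besselJ, show s + (α - 2) / 2 = s + α / 2 - 1 by ring]
      exact hC₂ _ g hw hg0 f hf
  have h3 := hC _ g hw T hT u hu htop
  have h4 : ∫⁻ t in Ioo 0 T, ∑' k, ENNReal.ofReal (FZK.smoothTerm α s g k (FZK.complexify (u t))) ≤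
      C * X * M ^ 2 := by
    refine h3.trans ?_
    gcongr
    rw [hX]
    gcongr
    exact FZK.normLinftyHs_mono (min_le_left r s) u
  have hXT : ENNReal.ofReal T ≤ X := by
    rw [hX, add_comm 1, add_assoc, add_assoc]
    exact le_self_add
  calc _ ≤ C₁ * (X * M ^ 2 + C * X * M ^ 2) + C₂ * (X * M ^ 2 + C * X * M ^ 2) := by
        refine add_le_add (h1.trans ?_) (h2.trans ?_) <;> gcongr
    _ = ((C₁ + C₂) * (1 + C) : ℝ≥0) * X * M ^ 2 := by push_cast; ring
    _ ≤ _ := by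
        gcongr
        exact le_self_add
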